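/- **Instance.** An instance of the bipartite traveling tournament problem (BTTP) consists of two disjoint leagues $X$, $Y$ with $n$ teams each and a non-negative semi-metric $w$ on $X\cup Y$ (symmetric, $w(v,v)=0$, triangle inequality). A feasible solution (schedule) assigns to each of $2n$ consecutive days one game for every team, each game being between a team of $X$ and a team of $Y$ at the home of one of them, such that every $x\in X$ and $y\in Y$ play exactly once at the home of $x$ and exactly once at the home of $y$; no pair plays on two consecutive days; and no team has more than three consecutive home games or more than three consecutive away games. Every team starts at home, travels directly from each game venue to the next, and returns home at the end; the weight of a schedule is the total distance traveled by all teams, and $\mathrm{OPT}$ is the minimum weight of a feasible schedule. For a set $A$ of teams put $\delta_A(v)=\sum_{u\in A}w(v,u)$. **Parameters.** Let $\varepsilon>0$, $d=6\lceil 1/\varepsilon\rceil$, $m=2\lfloor n/(6d)\rfloor-1$, $n_\varepsilon=3md$, $l=n-n_\varepsilon$, and assume $n\ge 108d^3$. Then $3d\le l\le m$. **Random labeling.** (1) $X_\varepsilon$ consists of $n_\varepsilon$ teams $x\in X$ with the highest costs $\delta_Y(x)$, and $Y_\varepsilon$ of $n_\varepsilon$ teams $y\in Y$ with the highest costs $\delta_X(y)$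 (ties broken arbitrarily). A 3-path packing of the complete graph on $A$ is a set of vertex-disjoint paths $vv'v''$ on three vertices that cover $A$; for a packing $\mathcal P$, $w(\mathcal P)$ is its total edge weight and $\delta_B(\mathcal P)=\sum_{vv'v''\in\mathcal P}(\delta_B(v)+\delta_B(v''))$. Let 3-path packings $\mathcal P_{X_\varepsilon}$ of $G[X_\varepsilon]$ and $\mathcal P_{Y_\varepsilon}$ of $G[Y_\varepsilon]$ be given. (2) The $md$ paths of $\mathcal P_{X_\varepsilon}$ are named $P_1,\dots,P_{md}$ and those of $\mathcal P_{Y_\varepsilon}$ are named $Q_1,\dots,Q_{md}$ in independent uniformly random orders, and the teams of $X_\varepsilon$, $Y_\varepsilon$ are labeled so that $P_i=x_{3i-3}x_{3i-2}x_{3i-1}$ and $Q_i=y_{3i-3}y_{3i-2}y_{3i-1}$, each path being read in an arbitrary one of its two directions. (3) The other teams of $X$ and $Y$ are labeled $x_{n_\varepsilon},\dots,x_{n-1}$ and $y_{n_\varepsilon},\dots,y_{n-1}$ arbitrarily. **3-path construction.** For $0\le i<m$ let $S_i=\{x_{3di},\dots,x_{3di+3d-1}\}$, $T_i=\{y_{3di},\dots,y_{3di+3d-1}\}$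 (super-teams). For $0\le p<l$ let $L_p=\{x_{n_\varepsilon+p},y_{n_\varepsilon+p}\}$ (team-pairs). Write $s\to t$ for a game at the home of $t$, and $\overline{M}$ for a set $M$ of games with reversed venues. There are $m$ time slots of $6d$ days each, followed by a last time slot of $2l$ days; slots and days are counted from $0$. In slot $r<m$, for each position $p<m$, the super-teams $S_i$ and $T_j$ with $i=(p+r)\bmod m$, $j=(p+2r)\bmod m$ meet; let $s_0,\dots,s_{3d-1}$ and $t_0,\dots,t_{3d-1}$ be their teams. * If $p\ge l$ (normal super-game): for $0\le a,b<d$ and $0\le a',b'\le 2$, the game $s_{3a+a'}\to t_{3b+b'}$ is on day $(6(a+b)+a'+b')\bmod 6d$ of the slot and the game $t_{3b+b'}\to s_{3a+a'}$ is on day $(6(a+b)+a'+b'+3)\bmod 6d$ of the slot. * If $p<l$ (left super-game): let $s_{3d}=x_{n_\varepsilon+p}$, $t_{3d}=y_{n_\varepsilon+p}$ and $m_c=\{s_k\to t_{(k+c)\bmod(3d+1)}\}_{k=0}^{3d}$. The $6d$ days are $m_1\overline{m_2}m_3\overline{m_4}\cdots m_{3d-1}\overline{m_{3d}}\; m_2\overline{m_3}m_4\cdots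 m_{3d}\overline{m_1}$. In the last slot, the teams of the team-pairs play $m_0\overline{m_1}m_2\overline{m_3}\cdots$ ($l$ days) and then the same $l$ days with reversed venues, where now $m_c=\{x_{n_\varepsilon+k}\to y_{n_\varepsilon+(k+c)\bmod l}\}_{k=0}^{l-1}$. At the same time the teams of the super-teams play $M_0\overline{M_1}M_2\overline{M_3}\cdots$ ($l$ days) and then the same $l$ days with reversed venues, where $M_p$ consists of the games $s_k\to t_k$, $0\le k<3d$, over all $m$ left super-games at position $p$. **Theorem.** For every $\varepsilon>0$, every $n\ge 108d^3$, every instance, all $X_\varepsilon,Y_\varepsilon$ as in (1), and all 3-path packings $\mathcal P_{X_\varepsilon}$ of $G[X_\varepsilon]$ and $\mathcal P_{Y_\varepsilon}$ of $G[Y_\varepsilon]$, the 3-path construction with random labeling always yields a feasible schedule, however the free choices of directions and in (3) are made (they may even depend on the random orders), and its expected weight is at most $$\delta_{Y_\varepsilon}(\mathcal P_{X_\varepsilon})+n_\varepsilon w(\mathcal P_{X_\varepsilon})+\delta_{X_\varepsilon}(\mathcal P_{Y_\varepsilon})+n_\varepsilon w(\mathcal P_{Y_\varepsilon})+\varepsilon\cdot\mathrm{OPT}.$$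 Moreover the method runs in $O(n^2)$ time with an absolute constant: on a unit-cost random access machine with addition, subtraction and comparison of natural numbers, addition and comparison of reals (the weights), and uniform random integers, there are a program that computes sets $X_\varepsilon,Y_\varepsilon$ as in (1) from $n$, $d$ and $w$, and a program that, given $n$, $d$, $w$ and the two packings, outputs a schedule distributed as that of the 3-path construction with random labeling (for some admissible way of making the free choices), each within $C n^2$ steps for every outcome of the random draws. -/

import Mathlib

open scoped BigOperators

namespace BTTP

/-! ### Instances, schedules, weights -/

/-- The `2 * n` teams: `Sum.inl` is the league `X`, `Sum.inr` is the league `Y`. -/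
abbrev Team (n : ℕ) : Type := Fin n ⊕ Fin n

/-- The league `X`. -/
def leagueX (n : ℕ) : Finset (Team n) := Finset.univ.filter fun v => v.isLeft = true

/-- The league `Y`. -/
def leagueY (n : ℕ) : Finset (Team n) := Finset.univ.filter fun v => v.isLeft = false

/-- An instance: a non-negative semi-metric (symmetric, triangle inequality) on the homes. -/
structure Inst (n : ℕ) where
  w : Team n → Team n → ℝ
  w_self : ∀ v, w v v = 0
  w_nonneg : ∀ u v, 0 ≤ w u v
  w_symm : ∀ u v, w u v = w v u
  w_triangle : ∀ u v z, w u z ≤ w u v + w v z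

/-- A timetable on `2 * n` days: for each day and each team its opponent, and whether the team
plays at home (`true`) or away (`false`). -/
abbrev Schedule (n : ℕ) : Type := Fin (2 * n) → Team n → Team n × Bool

/-- A feasible solution: a double round-robin bipartite tournament on `2 * n` days that satisfies
the no-repeat and the bounded-by-3 constraints. -/
structure Feasible {n : ℕ} (S : Schedule n) : Prop where
  /-- opponents come from the other league -/
  cross : ∀ t v, (S t v).1.isLeft ≠ v.isLeft
  /-- if `v` plays `u`, then `u` plays `v` -/
  mutual_opp : ∀ t v, (S t (S t v).1).1 = v
  /-- exactly one of two opponents plays at home -/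
  mutual_venue : ∀ t v, (S t (S t v).1).2 = !(S t v).2
  /-- each `x` and `y` play exactly once at the home of `x`, and exactly once at that of `y` -/
  double_round : ∀ (x y : Fin n) (h : Bool), ∃! t, S t (Sum.inl x) = (Sum.inr y, h)
  /-- no pair plays each other on two consecutive days -/
  no_repeat : ∀ (t t' : Fin (2 * n)) (v : Team n),
    (t' : ℕ) = (t : ℕ) + 1 → (S t v).1 ≠ (S t' v).1
  /-- there are no four consecutive home games and no four consecutive away games -/
  bounded_by_three : ∀ (v : Team n) (t : ℕ) (ht : t + 3 < 2 * n) (h : Bool),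
    ¬ ∀ k : Fin 4, (S ⟨t + k, by have := k.isLt; omega⟩ v).2 = h

/-- The place of team `v` at stage `k`: at home at stage `0`, at the venue of its game on day
`t` at stage `t + 1`, and at home again after the last game. -/
def place {n : ℕ} (S : Schedule n) (v : Team n) : ℕ → Team n
  | 0 => v
  | t + 1 => if ht : t < 2 * n then
      (if (S ⟨t, ht⟩ v).2 then v else (S ⟨t, ht⟩ v).1) else v

namespace Inst

variable {n : ℕ} (I : Inst n)

/-- Length of the itinerary (a closed walk) of team `v`, with direct traveling. -/
noncomputable def itinerary (S : Schedule n) (v : Team n) : ℝ :=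
  ∑ k ∈ Finset.range (2 * n + 1), I.w (place S v k) (place S v (k + 1))

/-- The weight of a schedule: the total distance traveled by all teams. -/
noncomputable def weight (S : Schedule n) : ℝ := ∑ v : Team n, I.itinerary S v

/-- The weight of an optimal solution. -/
noncomputable def opt : ℝ := sInf {c | ∃ S : Schedule n, Feasible S ∧ c = I.weight S}

/-- `δ_A(v)`, the total weight of the edges between `v` and `A`. -/
noncomputable def delta (A : Finset (Team n)) (v : Team n) : ℝ := ∑ u ∈ A, I.w v u

end Inst

/-! ### 3-path packings -/

/-- A 3-path packing with `k` paths of the complete graph on the vertex set `A`: vertex-disjoint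
simple paths `vtx i 0, vtx i 1, vtx i 2` that cover exactly `A`. -/
structure Packing {n : ℕ} (k : ℕ) (A : Finset (Team n)) where
  vtx : Fin k → Fin 3 → Team n
  disjoint : ∀ i i' c c', vtx i c = vtx i' c' → i = i' ∧ c = c'
  covers : ∀ v, v ∈ A ↔ ∃ i c, vtx i c = v

/-- `w(𝒫)`, the total weight of the edges of the packing. -/
noncomputable def Packing.weight {n k : ℕ} {A : Finset (Team n)} (P : Packing k A)
    (I : Inst n) : ℝ :=
  ∑ i, (I.w (P.vtx i 0) (P.vtx i 1) + I.w (P.vtx i 1) (P.vtx i 2))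

/-- `δ_B(𝒫)`, the sum of `δ_B` over the terminals of the paths. -/
noncomputable def Packing.delta {n k : ℕ} {A : Finset (Team n)} (P : Packing k A)
    (I : Inst n) (B : Finset (Team n)) : ℝ :=
  ∑ i, (I.delta B (P.vtx i 0) + I.delta B (P.vtx i 2))

/-! ### Parameters of the construction -/

/-- `d = 6⌈1/ε⌉`, the number of paths in a super-team. -/
noncomputable def pathsPerSuperTeam (ε : ℝ) : ℕ := 6 * ⌈1 / ε⌉₊

/-- `m = 2⌊n/(6d)⌋ - 1`, the number of super-teams in each league. -/
def numSuper (n d : ℕ) : ℕ := 2 * (n / (6 * d)) - 1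

/-- `n_ε = 3md`. -/
def coreSize (n d : ℕ) : ℕ := 3 * numSuper n d * d

/-- `l = n - n_ε`, the number of team-pairs. -/
def numPairs (n d : ℕ) : ℕ := n - coreSize n d

/-- `A` consists of `k` elements of `L` with the highest costs (ties broken arbitrarily). -/
def IsTop {n : ℕ} (L : Finset (Team n)) (cost : Team n → ℝ) (k : ℕ) (A : Finset (Team n)) :
    Prop :=
  A ⊆ L ∧ A.card = k ∧ ∀ a ∈ A, ∀ b ∈ L, b ∉ A → cost b ≤ cost a

/-! ### The 3-path construction, in terms of labels

Labels, super-teams, positions, time slots and days are all counted from `0`. The super-team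
`S_i` has the `X`-labels `3di, …, 3di + 3d - 1`, `T_j` has the `Y`-labels `3dj, …, 3dj + 3d - 1`,
and the team-pair `L_p` consists of the `X`-label and the `Y`-label `n_ε + p`.
In time slot `r` the super-teams at position `p` are `S_i` and `T_j` with `i = (p + r) mod m` and
`j = (p + 2r) mod m`; their super-game is a left one, with `L_p`, if `p < l`, and normal otherwise.
-/

/-- The `X`-super-team at position `p` in slot `r`. -/
def superX (n d p r : ℕ) : ℕ := (p + r) % numSuper n d

/-- The `Y`-super-team at position `p` in slot `r`. -/
def superY (n d p r : ℕ) : ℕ := (p + 2 * r) % numSuper n d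

/-- Labels taking part in a left super-game of super-team `i` with team-pair `p`:
`k < 3d` is the `k`-th team of the super-team, `k = 3d` is the team of the team-pair. -/
def leftLabel (n d i p k : ℕ) : ℕ := if k < 3 * d then 3 * d * i + k else coreSize n d + p

/-- The round played on day `q < 6d` of a left super-game: `(c, false)` stands for `m_c` (the
`X`-teams play away), `(c, true)` for `m_c` with reversed venues. The first half is
`m_1 m̄_2 m_3 ⋯ m̄_{3d}`, the second half is `m_2 m̄_3 ⋯ m_{3d} m̄_1`. -/
def leftRound (d q : ℕ) : ℕ × Bool :=
  if q < 3 * d then (q + 1, decide ((q + 1) % 2 = 0))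
  else if q < 6 * d - 1 then (q - 3 * d + 2, decide ((q - 3 * d + 2) % 2 = 1))
  else (1, true)

/-- The round played on day `q < 2l` of the last time slot: the first half is
`m_0 m̄_1 m_2 m̄_3 ⋯`, the second half is the first one with reversed venues. -/
def lastRound (l q : ℕ) : ℕ × Bool :=
  if q < l then (q, decide (q % 2 = 1)) else (q - l, decide ((q - l) % 2 = 0))

/-- `Game n d t i j h`: on day `t` the team with `X`-label `i` plays the team with `Y`-label `j`,
at the home of the former if `h = true`, and at the home of the latter if `h = false`. -/
inductive Game (n d : ℕ) : ℕ → ℕ → ℕ → Bool → Prop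
  /-- normal super-games, the `X`-team is away -/
  | normalAway (r p a a' b b' : ℕ) (hr : r < numSuper n d)
      (hp : numPairs n d ≤ p) (hp' : p < numSuper n d)
      (ha : a < d) (ha' : a' < 3) (hb : b < d) (hb' : b' < 3) :
      Game n d (6 * d * r + (6 * (a + b) + a' + b') % (6 * d))
        (3 * d * superX n d p r + (3 * a + a')) (3 * d * superY n d p r + (3 * b + b')) false
  /-- normal super-games, the `X`-team is at home -/
  | normalHome (r p a a' b b' : ℕ) (hr : r < numSuper n d)
      (hp : numPairs n d ≤ p) (hp' : p < numSuper n d)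
      (ha : a < d) (ha' : a' < 3) (hb : b < d) (hb' : b' < 3) :
      Game n d (6 * d * r + (6 * (a + b) + a' + b' + 3) % (6 * d))
        (3 * d * superX n d p r + (3 * a + a')) (3 * d * superY n d p r + (3 * b + b')) true
  /-- left super-games -/
  | left (r p q k : ℕ) (hr : r < numSuper n d) (hp : p < numPairs n d)
      (hq : q < 6 * d) (hk : k < 3 * d + 1) :
      Game n d (6 * d * r + q)
        (leftLabel n d (superX n d p r) p k)
        (leftLabel n d (superY n d p r) p ((k + (leftRound d q).1) % (3 * d + 1)))
        (leftRound d q).2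
  /-- last time slot, teams in team-pairs -/
  | lastPair (q k : ℕ) (hq : q < 2 * numPairs n d) (hk : k < numPairs n d) :
      Game n d (6 * d * numSuper n d + q)
        (coreSize n d + k)
        (coreSize n d + (k + (lastRound (numPairs n d) q).1) % numPairs n d)
        (lastRound (numPairs n d) q).2
  /-- last time slot, teams in super-teams: the two games between the `k`-th teams of two
  super-teams that met in a left super-game at position `p`, where `p` is the number of the
  round of day `q` -/
  | lastSuper (q r k : ℕ) (hq : q < 2 * numPairs n d) (hr : r < numSuper n d) (hk : k < 3 * d) :
      Game n d (6 * d * numSuper n d + q)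
        (3 * d * superX n d (lastRound (numPairs n d) q).1 r + k)
        (3 * d * superY n d (lastRound (numPairs n d) q).1 r + k)
        (lastRound (numPairs n d) q).2

/-- The games of `S` are exactly those of the 3-path construction for the labelings `x` of the
league `X` and `y` of the league `Y`. -/
def IsThreePathSchedule {n : ℕ} (d : ℕ) (x y : Fin n → Team n) (S : Schedule n) : Prop :=
  ∀ (t : Fin (2 * n)) (i j : Fin n) (h : Bool),
    (S t (x i) = (y j, h) ↔ Game n d t i j h) ∧ (S t (y j) = (x i, !h) ↔ Game n d t i j h)

/-! ### Random labeling -/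

/-- `x` is a labeling of the league `L` in which, for each `i`, the path `σ i` of the packing gets
the label `P_i`, so its vertices get the labels `3i, 3i + 1, 3i + 2` in one of the two
directions. The teams outside of the packing are labeled arbitrarily by the other labels. -/
structure IsLabeling {n k : ℕ} {A : Finset (Team n)} (L : Finset (Team n)) (P : Packing k A)
    (σ : Equiv.Perm (Fin k)) (x : Fin n → Team n) : Prop where
  inj : Function.Injective x
  mem : ∀ j, x j ∈ L
  paths : ∀ i : Fin k,
    (∀ (c : Fin 3) (j : Fin n), (j : ℕ) = 3 * (i : ℕ) + (c : ℕ) → x j = P.vtx (σ i) c) ∨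
    (∀ (c : Fin 3) (j : Fin n), (j : ℕ) = 3 * (i : ℕ) + (c : ℕ) → x j = P.vtx (σ i) c.rev)

/-- The sample space: a permutation of the paths of each of the two packings. -/
abbrev Perms (k : ℕ) : Type := Equiv.Perm (Fin k) × Equiv.Perm (Fin k)

/-- A possible choice of labelings in the random labeling method. The choices that the method
leaves open (directions of paths, order of the teams outside of the packings) may depend on the
random permutations in any way. -/
def LabelingChoice {n k : ℕ} {A B : Finset (Team n)} (P : Packing k A) (Q : Packing k B)
    (x y : Perms k → Fin n → Team n) : Prop :=
  ∀ ω, IsLabeling (leagueX n) P ω.1 (x ω) ∧ IsLabeling (leagueY n) Q ω.2 (y ω)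

/-- `S` is a random schedule (a function of the two random permutations) that is produced by the
3-path construction with random labeling. -/
def IsRandomThreePath {n k : ℕ} {A B : Finset (Team n)} (d : ℕ) (P : Packing k A)
    (Q : Packing k B) (S : Perms k → Schedule n) : Prop :=
  ∃ x y : Perms k → Fin n → Team n, LabelingChoice P Q x y ∧
    ∀ ω, IsThreePathSchedule d (x ω) (y ω) (S ω)

/-- The expected weight of a random schedule for independent uniform permutations. -/
noncomputable def Inst.expectedWeight {n k : ℕ} (I : Inst n) (S : Perms k → Schedule n) : ℝ :=
  (∑ ω, I.weight (S ω)) / (Fintype.card (Perms k) : ℝ)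

/-! ### The machine model

A unit-cost randomized random access machine, as a structured programming language. It has
natural-number registers and memory (addition, truncated subtraction, comparison, but no
multiplication), real registers and memory (addition and comparison), and can draw uniform random
integers. Memory cells have an array name and two indices. All loops are bounded, so that every
program terminates. -/

structure MState where
  nreg : ℕ → ℕ
  narr : ℕ → ℕ → ℕ → ℕ
  rreg : ℕ → ℝ
  rarr : ℕ → ℕ → ℕ → ℝ
  /-- the number of steps so far, which programs cannot read -/
  time : ℕ

/-- Natural-number expressions. -/
inductive NExp
  | lit (k : ℕ)
  | reg (v : ℕ)
  | arr (a : ℕ) (i j : NExp)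
  | add (e f : NExp)
  | sub (e f : NExp)

/-- Real expressions. -/
inductive RExp
  | zero
  | reg (v : ℕ)
  | arr (a : ℕ) (i j : NExp)
  | add (e f : RExp)

/-- Tests. -/
inductive Test
  | nle (e f : NExp)
  | neq (e f : NExp)
  | rle (e f : RExp)

/-- Programs. -/
inductive Prog
  | skip
  | setN (v : ℕ) (e : NExp)
  | setNArr (a : ℕ) (i j e : NExp)
  | setR (v : ℕ) (e : RExp)
  | setRArr (a : ℕ) (i j : NExp) (e : RExp)
  /-- put a uniform random element of `{0, …, e}` into register `v` -/
  | rand (v : ℕ) (e : NExp)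
  | seq (p q : Prog)
  | ite (b : Test) (p q : Prog)
  /-- for `v = 0, …, e - 1` (with `e` evaluated once, at the beginning) run `p` -/
  | loop (v : ℕ) (e : NExp) (p : Prog)

def NExp.eval (s : MState) : NExp → ℕ
  | lit k => k
  | reg v => s.nreg v
  | arr a i j => s.narr a (i.eval s) (j.eval s)
  | add e f => e.eval s + f.eval s
  | sub e f => e.eval s - f.eval s

/-- The number of steps for evaluating an expression is the number of its nodes. -/
def NExp.cost : NExp → ℕ
  | lit _ => 1
  | reg _ => 1
  | arr _ i j => i.cost + j.cost + 1
  | add e f => e.cost + f.cost + 1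
  | sub e f => e.cost + f.cost + 1

noncomputable def RExp.eval (s : MState) : RExp → ℝ
  | zero => 0
  | reg v => s.rreg v
  | arr a i j => s.rarr a (i.eval s) (j.eval s)
  | add e f => e.eval s + f.eval s

def RExp.cost : RExp → ℕ
  | zero => 1
  | reg _ => 1
  | arr _ i j => i.cost + j.cost + 1
  | add e f => e.cost + f.cost + 1

def Test.eval (s : MState) : Test → Prop
  | nle e f => e.eval s ≤ f.eval s
  | neq e f => e.eval s = f.eval s
  | rle e f => e.eval s ≤ f.eval s

def Test.cost : Test → ℕ
  | nle e f => e.cost + f.cost + 1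
  | neq e f => e.cost + f.cost + 1
  | rle e f => e.cost + f.cost + 1

namespace MState

/-- Let `k` steps pass. -/
def tick (s : MState) (k : ℕ) : MState := { s with time := s.time + k }

def setN (s : MState) (v k : ℕ) : MState := { s with nreg := Function.update s.nreg v k }

def setR (s : MState) (v : ℕ) (r : ℝ) : MState := { s with rreg := Function.update s.rreg v r }

def setNArr (s : MState) (a i j k : ℕ) : MState :=
  { s with narr := fun a' i' j' => if a' = a ∧ i' = i ∧ j' = j then k else s.narr a' i' j' }

def setRArr (s : MState) (a i j : ℕ) (r : ℝ) : MState :=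
  { s with rarr := fun a' i' j' => if a' = a ∧ i' = i ∧ j' = j then r else s.rarr a' i' j' }

end MState

/-- Run `f 0`, `f 1`, …, `f (k - 1)` one after the other. -/
noncomputable def iterate (f : ℕ → MState → PMF MState) : ℕ → MState → PMF MState
  | 0, s => PMF.pure s
  | k + 1, s => (iterate f k s).bind (f k)

open Classical in
/-- The distribution of the final state of a program that is started in a given state. -/
noncomputable def Prog.run : Prog → MState → PMF MState
  | skip, s => PMF.pure (s.tick 1)
  | setN v e, s => PMF.pure ((s.setN v (e.eval s)).tick (e.cost + 1))
  | setNArr a i j e, s => PMF.pure ((s.setNArr a (i.eval s) (j.eval s) (e.eval s)).tick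
      (i.cost + j.cost + e.cost + 1))
  | setR v e, s => PMF.pure ((s.setR v (e.eval s)).tick (e.cost + 1))
  | setRArr a i j e, s => PMF.pure ((s.setRArr a (i.eval s) (j.eval s) (e.eval s)).tick
      (i.cost + j.cost + e.cost + 1))
  | rand v e, s => (PMF.uniformOfFintype (Fin (e.eval s + 1))).map
      fun k => (s.setN v (k : ℕ)).tick (e.cost + 1)
  | seq p q, s => (p.run s).bind q.run
  | ite b p q, s => if b.eval s then p.run (s.tick (b.cost + 1)) else q.run (s.tick (b.cost + 1))
  | loop v e p, s => iterate (fun k s' => p.run ((s'.setN v k).tick 1)) (e.eval s)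
      (s.tick (e.cost + 1))

/-! ### Input and output -/

/-- The number of a team in the memory: `0, …, n - 1` for `X` and `n, …, 2n - 1` for `Y`. -/
def code {n : ℕ} : Team n → ℕ
  | Sum.inl i => i
  | Sum.inr j => n + j

/-- The array of weights, `0` outside of the range. -/
noncomputable def Inst.table {n : ℕ} (I : Inst n) (i j : ℕ) : ℝ :=
  ∑ u : Team n, ∑ v : Team n, if code u = i ∧ code v = j then I.w u v else 0

/-- The array of the vertices of the paths of a packing, `0` outside of the range. -/
def Packing.table {n k : ℕ} {A : Finset (Team n)} (P : Packing k A) (i j : ℕ) : ℕ :=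
  if h : i < k ∧ j < 3 then code (P.vtx ⟨i, h.1⟩ ⟨j, h.2⟩) else 0

/-- Input for the selection of the core: `n` and `d` in the natural-number registers 0 and 1,
and the weights in the real array 0; everything else is zero. -/
noncomputable def coreInput {n : ℕ} (d : ℕ) (I : Inst n) : MState where
  nreg v := if v = 0 then n else if v = 1 then d else 0
  narr _ _ _ := 0
  rreg _ := 0
  rarr a i j := if a = 0 then I.table i j else 0
  time := 0

/-- Input for the construction: as for the selection of the core and, in the natural-number
arrays 0 and 1, the two packings. -/
noncomputable def packingInput {n k : ℕ} {A B : Finset (Team n)} (d : ℕ) (I : Inst n)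
    (P : Packing k A) (Q : Packing k B) : MState where
  nreg v := if v = 0 then n else if v = 1 then d else 0
  narr a i j := if a = 0 then P.table i j else if a = 1 then Q.table i j else 0
  rreg _ := 0
  rarr a i j := if a = 0 then I.table i j else 0
  time := 0

/-- The state `s` shows the set `A`: its indicator function is row 0 of natural-number array 2. -/
def ShowsSet {n : ℕ} (s : MState) (A : Finset (Team n)) : Prop :=
  ∀ v : Team n, s.narr 2 0 (code v) = if v ∈ A then 1 else 0

/-- The output timetable in a state: for each day and team, the number of the opponent (array 2)
and the indicator of a home game (array 3). -/
def outputTable (n : ℕ) (s : MState) : Fin (2 * n) → Team n → ℕ × ℕ :=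
  fun t v => (s.narr 2 t (code v), s.narr 3 t (code v))

/-- A schedule in the output format. -/
def encode {n : ℕ} (S : Schedule n) : Fin (2 * n) → Team n → ℕ × ℕ :=
  fun t v => (code (S t v).1, if (S t v).2 then 1 else 0)

end BTTP

/-! Feasibility rests on counting. Explicit formulas show that every team has a game on every day
(`exists_game_of_label_X`, `exists_game_of_label_Y`) and that every pair has a game at each venue,
never on adjacent days (`exists_days`). The construction has 2n² game indices, which is also the
number of pairs (day, X-team), of pairs (day, Y-team) and of triples (X-team, Y-team, venue). So
these three surjections are bijections: no team plays twice on a day and no game is repeated. In the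
first m slots the venue depends only on the kind of the slot and on the day modulo 6, and the last
slot almost alternates; four equal venues in a row are then excluded by a case distinction on the
position of the slot boundary (`homePattern_bounded`).

For the weight, let T be the total weight of the edges between the leagues (`Inst.total`). In a
feasible schedule a trip away from home has at most three stops, and its length is at least twice
the distance from home to each of them. Hence twice the sum of the distances from a team to its
opponents is at most three times its itinerary, and OPT ≥ 4T/3 (`Inst.total_le_opt`).

For the upper bound, detours through home are inserted into an itinerary, except where a team visits
the vertices of a path on consecutive days (`Inst.itinerary_le`). This happens for all pairs of
paths that meet in a normal super-game, unless their games may be cut by the end of the slot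
(`IsBadPair`). A good pair costs exactly `mainCharge`, which does not depend on the directions of
the paths; its sum over all pairs of paths is the main term of the bound (`sum_mainCharge`). Each
remaining game, of a bad pair or of a team outside of the core, costs at most four times its edge.
With K = md paths in each league, every path has at most ld + m bad partners (`card_bad_le`), and
under the random orders a given pair of path labels has expected cross weight at most T/K². So the
bad pairs cost at most 4(ld + m)T/(md) ≤ 16T/(3d) in expectation. The teams outside of the core are
the cheapest ones, so they carry at most the fraction l/n of T in each league and cost at most 8lT/n
≤ T/d. The sum is below 8T/d, and εd ≥ 6 gives 8T/d ≤ ε · 4T/3 ≤ ε · OPT.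

The programs find the parameters by repeated subtraction and addition, the core by counting for each
team the teams that come before it, and the orders by a shuffle whose every step is a bijection
`Perm k × Fin (k + 1) ≃ Perm (k + 1)`, so that uniformity is preserved. The timetable is written
with a bounded number of steps per game. By uniqueness of games no game overwrites another one, so
the order of writing does not matter. -/

namespace BTTP

/-! ### Arithmetic of the parameters -/

/-- The properties of the parameters on which the construction relies. -/
structure Admissible (n d : ℕ) : Prop where
  six_le : 6 ≤ d
  even_d : d % 2 = 0
  odd_m : numSuper n d % 2 = 1
  core_add : coreSize n d + numPairs n d = n
  le_pairs : 3 * d ≤ numPairs n d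
  pairs_lt : numPairs n d < 9 * d
  pairs_le : numPairs n d ≤ numSuper n d
  large : 36 * d ^ 2 ≤ numSuper n d + 1
  cube_le : 108 * d ^ 3 ≤ n

/-- With k = ⌊n/(6d)⌋ one has n_ε + 3d = 6dk. So l is 3d plus the remainder of n modulo 6d, whence
3d ≤ l < 9d, while n ≥ 108d³ gives k ≥ 18d² and makes m = 2k − 1 much larger than l. -/
lemma admissible_of_le {ε : ℝ} (hε : 0 < ε) {n d : ℕ} (hd : d = pathsPerSuperTeam ε)
    (hn : 108 * d ^ 3 ≤ n) : Admissible n d := by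
  have hc : 1 ≤ ⌈1 / ε⌉₊ := Nat.one_le_iff_ne_zero.2 (by
    have : 0 < ⌈1 / ε⌉₊ := Nat.ceil_pos.2 (by positivity)
    omega)
  have h6 : 6 ≤ d := by rw [hd, pathsPerSuperTeam]; omega
  have hev : d % 2 = 0 := by rw [hd, pathsPerSuperTeam]; omega
  set k := n / (6 * d) with hk
  have hk18 : 18 * d ^ 2 ≤ k := by
    rw [hk, Nat.le_div_iff_mul_le (by omega)]
    calc 18 * d ^ 2 * (6 * d) = 108 * d ^ 3 := by ring
      _ ≤ n := hn
  have hdd : d * 6 ≤ d ^ 2 := by rw [pow_two]; exact Nat.mul_le_mul_left _ h6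
  have hm : numSuper n d = 2 * k - 1 := rfl
  have hdm : 6 * d * k + n % (6 * d) = n := Nat.div_add_mod n (6 * d)
  have hrem : n % (6 * d) < 6 * d := Nat.mod_lt _ (by omega)
  have hcore : coreSize n d + 3 * d = 6 * d * k := by
    rw [coreSize, hm]
    obtain ⟨k', hk'⟩ : ∃ k', k = k' + 1 := ⟨k - 1, by omega⟩
    rw [hk', show 2 * (k' + 1) - 1 = 2 * k' + 1 by omega]
    ring
  have hl : numPairs n d = n - coreSize n d := rfl
  refine ⟨h6, hev, by omega, by omega, by omega, by omega, by omega, by omega, hn⟩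

/-! ### Modular arithmetic of positions, slots and days -/

section Arith

lemma mod_sub_add {m a b : ℕ} (ha : a < m) (hb : b ≤ m) : ((a + m - b) % m + b) % m = a := by
  rw [Nat.mod_add_mod, show a + m - b + b = a + m by omega, Nat.add_mod_right, Nat.mod_eq_of_lt ha]

/-- As m is odd, (m + 1)/2 inverts 2 modulo m, and r = (j − p)/2 works. This is the reason for an
odd number of super-teams: every Y-super-team has to pass through every position. -/
lemma exists_half_slot {m p j : ℕ} (hm : m % 2 = 1) (hp : p ≤ m) (hj : j < m) :
    ∃ r < m, (p + 2 * r) % m = j := by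
  refine ⟨((j + m - p) * ((m + 1) / 2)) % m, Nat.mod_lt _ (by omega), ?_⟩
  have h : (p + 2 * ((j + m - p) * ((m + 1) / 2))) % m = j := by
    have h2 : 2 * ((m + 1) / 2) = m + 1 := by omega
    calc (p + 2 * ((j + m - p) * ((m + 1) / 2))) % m
        = (p + (j + m - p) * (2 * ((m + 1) / 2))) % m := by ring_nf
      _ = (p + (j + m - p) + (j + m - p) * m) % m := by rw [h2]; ring_nf
      _ = j := by
        rw [Nat.add_mul_mod_self_right, show p + (j + m - p) = j + m by omega, Nat.add_mod_right,
          Nat.mod_eq_of_lt hj]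
  rw [Nat.add_mod, Nat.mul_mod_mod, ← Nat.add_mod, h]

/-- The slot in which the super-teams with numbers `i` and `j` meet. -/
def meetSlot (m i j : ℕ) : ℕ := (j + m - i) % m

/-- The position at which the super-teams with numbers `i` and `j` meet. -/
def meetPos (m i j : ℕ) : ℕ := (2 * i + m - j) % m

/-- The system i = p + r, j = p + 2r has the solution r = j − i, p = 2i − j modulo m. The added m
keeps the subtractions from being truncated. -/
lemma meetPos_add_slot {m i j : ℕ} (hi : i < m) (hj : j < m) :
    (meetPos m i j + meetSlot m i j) % m = i := by
  rw [meetPos, meetSlot, ← Nat.add_mod,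
    show 2 * i + m - j + (j + m - i) = i + m + m by omega, Nat.add_mod_right, Nat.add_mod_right,
    Nat.mod_eq_of_lt hi]

lemma meetPos_add_two_slot {m i j : ℕ} (hi : i < m) (hj : j < m) :
    (meetPos m i j + 2 * meetSlot m i j) % m = j := by
  rw [two_mul, ← add_assoc, Nat.add_mod, meetPos_add_slot hi hj, meetSlot, Nat.mod_mod,
    Nat.add_mod_mod, show i + (j + m - i) = j + m by omega, Nat.add_mod_right, Nat.mod_eq_of_lt hj]

/-- In a normal super-game, the day determines the opponent and the venue. -/
lemma exists_normal_opponent {d a a' q : ℕ} (ha : a < d) (ha' : a' < 3) (hq : q < 6 * d) :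
    ∃ b < d, ∃ b' < 3, (6 * (a + b) + a' + b' + (if 3 ≤ (q + 6 - a') % 6 then 3 else 0)) % (6 * d)
      = q := by
  have key : ∃ b < d, ∃ b' < 3,
      6 * (a + b) + a' + b' + (if 3 ≤ (q + 6 - a') % 6 then 3 else 0) = q ∨
      6 * (a + b) + a' + b' + (if 3 ≤ (q + 6 - a') % 6 then 3 else 0) = q + 6 * d := by
    -- The summand 6 prevents truncation and raises the quotient by one, so the quotient is
    -- congruent to a + b + 1 modulo d. The two cases are whether or not the day wraps around the
    -- end of the slot.
    by_cases hu : a + 1 ≤ (q + 6 - a') / 6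
    · refine ⟨(q + 6 - a') / 6 - 1 - a, by omega, (q + 6 - a') % 6 % 3, by omega, Or.inl ?_⟩
      split_ifs <;> omega
    · refine ⟨(q + 6 - a') / 6 + d - 1 - a, by omega, (q + 6 - a') % 6 % 3, by omega, Or.inr ?_⟩
      split_ifs <;> omega
  obtain ⟨b, hb, b', hb', h | h⟩ := key
  · exact ⟨b, hb, b', hb', by rw [h, Nat.mod_eq_of_lt hq]⟩
  · exact ⟨b, hb, b', hb', by rw [h, Nat.add_mod_right, Nat.mod_eq_of_lt hq]⟩

lemma mul_add_lt {D m r q : ℕ} (hr : r < m) (hq : q < D) : D * r + q < D * m := by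
  calc D * r + q < D * r + D := by omega
    _ = D * (r + 1) := by ring
    _ ≤ D * m := Nat.mul_le_mul_left _ hr

lemma exists_mul_add {D m t : ℕ} (ht : t < D * m) : ∃ r < m, ∃ q < D, t = D * r + q := by
  have hD : 0 < D := by rcases Nat.eq_zero_or_pos D with rfl | h; · simp at ht
                        · exact h
  exact ⟨t / D, Nat.div_lt_of_lt_mul ht, t % D, Nat.mod_lt _ hD, (Nat.div_add_mod t D).symm⟩

end Arith

lemma Game.cast {n d t i j t' i' j' : ℕ} {h h' : Bool} (g : Game n d t i j h) (ht : t = t')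
    (hi : i = i') (hj : j = j') (hh : h = h') : Game n d t' i' j' h' := by
  subst ht hi hj hh; exact g

lemma coreSize_eq (n d : ℕ) : coreSize n d = 3 * d * numSuper n d := by
  rw [coreSize]; ring

/-! ### Every team has a game on every day, every pair has a game at each venue -/

section

variable {n d : ℕ} (H : Admissible n d)

include H

lemma Admissible.two_mul : 2 * n = 6 * d * numSuper n d + 2 * numPairs n d := by
  have h := H.core_add
  have h2 := coreSize_eq n d
  have h3 : 2 * (3 * d * numSuper n d) = 6 * d * numSuper n d := by ring
  omega

omit H in
lemma leftLabel_of_lt {i p k : ℕ} (hk : k < 3 * d) : leftLabel n d i p k = 3 * d * i + k := by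
  rw [leftLabel, if_pos hk]

omit H in
lemma leftLabel_last (i p : ℕ) : leftLabel n d i p (3 * d) = coreSize n d + p := by
  rw [leftLabel, if_neg (lt_irrefl _)]

lemma superX_lt (p r : ℕ) : superX n d p r < numSuper n d :=
  Nat.mod_lt _ (by have := H.odd_m; omega)

lemma superY_lt (p r : ℕ) : superY n d p r < numSuper n d :=
  Nat.mod_lt _ (by have := H.odd_m; omega)

lemma core_label_lt {i k : ℕ} (hi : i < numSuper n d) (hk : k < 3 * d) : 3 * d * i + k < n := by
  have := mul_add_lt hi hk
  have h2 := H.core_add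
  rw [coreSize_eq] at h2
  omega

lemma leftLabel_lt {i p k : ℕ} (hi : i < numSuper n d) (hp : p < numPairs n d) :
    leftLabel n d i p k < n := by
  rw [leftLabel]
  split_ifs with h
  · exact core_label_lt H hi h
  · have := H.core_add; omega

omit H in
lemma lastRound_lt {q : ℕ} (hq : q < 2 * numPairs n d) :
    (lastRound (numPairs n d) q).1 < numPairs n d := by
  rw [lastRound]; split_ifs <;> simp only <;> omega

lemma Game.bounds {t i j : ℕ} {h : Bool} (g : Game n d t i j h) : t < 2 * n ∧ i < n ∧ j < n := by
  have h2 := H.two_mul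
  have h6 := H.six_le
  have hc := H.core_add
  induction g with
  | normalAway r p a a' b b' hr hp hp' ha ha' hb hb' =>
    have h1 := mul_add_lt (D := 6 * d) hr
      (Nat.mod_lt (6 * (a + b) + a' + b') (show 6 * d > 0 by omega))
    exact ⟨by omega, core_label_lt H (superX_lt H _ _) (by omega),
      core_label_lt H (superY_lt H _ _) (by omega)⟩
  | normalHome r p a a' b b' hr hp hp' ha ha' hb hb' =>
    have h1 := mul_add_lt (D := 6 * d) hr
      (Nat.mod_lt (6 * (a + b) + a' + b' + 3) (show 6 * d > 0 by omega))
    exact ⟨by omega, core_label_lt H (superX_lt H _ _) (by omega),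
      core_label_lt H (superY_lt H _ _) (by omega)⟩
  | left r p q k hr hp hq hk =>
    have h1 := mul_add_lt (D := 6 * d) hr hq
    exact ⟨by omega, leftLabel_lt H (superX_lt H _ _) hp, leftLabel_lt H (superY_lt H _ _) hp⟩
  | lastPair q k hq hk =>
    have : (k + (lastRound (numPairs n d) q).1) % numPairs n d < numPairs n d :=
      Nat.mod_lt _ (by omega)
    exact ⟨by omega, by omega, by omega⟩
  | lastSuper q r k hq hr hk =>
    exact ⟨by omega, core_label_lt H (superX_lt H _ _) hk, core_label_lt H (superY_lt H _ _) hk⟩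

/-- `true` at the days at which the `X`-team of a game is at home: `L` tells for each slot whether
the team (of either league) takes part in a left super-game, and `c` is its position in its path. -/
def homePattern (n d : ℕ) (L : ℕ → Bool) (c t : ℕ) : Bool :=
  if t < 6 * d * numSuper n d then
    (if L (t / (6 * d)) then decide (t % 2 = 1) else decide (3 ≤ (t + 6 - c) % 6))
  else (lastRound (numPairs n d) (t - 6 * d * numSuper n d)).2

-- The venue alternates from day to day, also across the middle of the super-game because 3d is
-- even. Slots have even length, so the parity of the absolute day can be used.
omit H in
lemma homePattern_left {L : ℕ → Bool} {r q : ℕ} (c : ℕ) (hev : d % 2 = 0) (hr : r < numSuper n d)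
    (hq : q < 6 * d) (hL : L r = true) :
    homePattern n d L c (6 * d * r + q) = (leftRound d q).2 := by
  have hdiv : (6 * d * r + q) / (6 * d) = r := by
    rw [Nat.mul_add_div (by omega), Nat.div_eq_of_lt hq, add_zero]
  have hpar : (6 * d * r + q) % 2 = q % 2 := by
    rw [show 6 * d * r = 2 * (3 * d * r) by ring]; omega
  rw [homePattern, if_pos (mul_add_lt hr hq), hdiv, if_pos hL, hpar, leftRound]
  split_ifs with h1 h2
  · exact decide_eq_decide.2 (by omega)
  · exact decide_eq_decide.2 (by omega)
  · simp; omega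

omit H in
lemma homePattern_normal {L : ℕ → Bool} {r q c : ℕ} (hc : c < 3) (hr : r < numSuper n d)
    (hq : q < 6 * d) (hL : L r = false) :
    homePattern n d L c (6 * d * r + q) = decide (3 ≤ (q + 6 - c) % 6) := by
  have hdiv : (6 * d * r + q) / (6 * d) = r := by
    rw [Nat.mul_add_div (by omega), Nat.div_eq_of_lt hq, add_zero]
  rw [homePattern, if_pos (mul_add_lt hr hq), hdiv, if_neg (by simp [hL])]
  rw [show 6 * d * r = 6 * (d * r) by ring]
  exact decide_eq_decide.2 (by omega)

omit H in
lemma homePattern_last {L : ℕ → Bool} {q : ℕ} (c : ℕ) :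
    homePattern n d L c (6 * d * numSuper n d + q) = (lastRound (numPairs n d) q).2 := by
  rw [homePattern, if_neg (by omega), Nat.add_sub_cancel_left]

lemma day_cases {t : ℕ} (ht : t < 2 * n) : (∃ r < numSuper n d, ∃ q < 6 * d, t = 6 * d * r + q) ∨
    ∃ q < 2 * numPairs n d, t = 6 * d * numSuper n d + q := by
  by_cases h : t < 6 * d * numSuper n d
  · exact Or.inl (exists_mul_add h)
  · exact Or.inr ⟨t - 6 * d * numSuper n d, by have := H.two_mul; omega, by omega⟩

lemma label_cases {i : ℕ} (hi : i < n) :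
    (∃ i0 < numSuper n d, ∃ k < 3 * d, i = 3 * d * i0 + k) ∨
    ∃ p < numPairs n d, i = coreSize n d + p := by
  by_cases h : i < 3 * d * numSuper n d
  · exact Or.inl (exists_mul_add h)
  · rw [← coreSize_eq] at h
    exact Or.inr ⟨i - coreSize n d, by have := H.core_add; omega, by omega⟩

omit H in
lemma normal_game {r p a a' b b' q : ℕ} (hr : r < numSuper n d)
    (hp : numPairs n d ≤ p) (hp' : p < numSuper n d)
    (ha : a < d) (ha' : a' < 3) (hb : b < d) (hb' : b' < 3) (h : Bool)
    (hq : (6 * (a + b) + a' + b' + (if h then 3 else 0)) % (6 * d) = q) :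
    Game n d (6 * d * r + q)
      (3 * d * superX n d p r + (3 * a + a')) (3 * d * superY n d p r + (3 * b + b')) h := by
  subst hq
  cases h
  · exact (Game.normalAway r p a a' b b' hr hp hp' ha ha' hb hb').cast (by simp) rfl rfl rfl
  · exact (Game.normalHome r p a a' b b' hr hp hp' ha ha' hb hb').cast (by simp) rfl rfl rfl

/-- Every `X`-team plays on every day. -/
lemma exists_game_of_label_X {i : ℕ} (hi : i < n) :
    ∃ L : ℕ → Bool, ∀ t < 2 * n, ∃ j < n, Game n d t i j (homePattern n d L (i % 3) t) := by
  have h6 := H.six_le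
  have hlm := H.pairs_le
  suffices ∃ L : ℕ → Bool, ∀ t < 2 * n, ∃ j, Game n d t i j (homePattern n d L (i % 3) t) by
    obtain ⟨L, hL⟩ := this
    refine ⟨L, fun t ht => ?_⟩
    obtain ⟨j, g⟩ := hL t ht
    exact ⟨j, (g.bounds H).2.2, g⟩
  rcases label_cases H hi with ⟨i0, hi0, k, hk, rfl⟩ | ⟨p, hp, rfl⟩
  -- In slot r the super-team i0 is at position i0 − r modulo m, and its super-game is a left one
  -- exactly if this position is below l.
  · refine ⟨fun r => decide ((i0 + numSuper n d - r) % numSuper n d < numPairs n d),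
      fun t ht => ?_⟩
    have h3 : (3 * d * i0 + k) % 3 = k % 3 := by
      rw [mul_assoc, Nat.mul_add_mod]
    rcases day_cases H ht with ⟨r, hr, q, hq, rfl⟩ | ⟨q, hq, rfl⟩
    · have hX : superX n d ((i0 + numSuper n d - r) % numSuper n d) r = i0 :=
        mod_sub_add hi0 hr.le
      by_cases hL : (i0 + numSuper n d - r) % numSuper n d < numPairs n d
      · refine ⟨_, (Game.left r _ q k hr hL hq (by omega)).cast rfl ?_ rfl ?_⟩
        · rw [hX, leftLabel_of_lt hk]
        · rw [homePattern_left _ H.even_d hr hq (by simpa using hL)]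
      · obtain ⟨b, hb, b', hb', hqe⟩ := exists_normal_opponent (d := d) (a := k / 3) (a' := k % 3)
          (q := q) (by omega) (by omega) hq
        refine ⟨_, (normal_game (a := k / 3) (a' := k % 3) hr (by simpa using hL)
          (Nat.mod_lt _ (by omega)) (by omega) (by omega) hb hb'
          (decide (3 ≤ (q + 6 - k % 3) % 6)) ?_).cast rfl ?_ rfl ?_⟩
        · simpa using hqe
        · rw [hX, Nat.div_add_mod]
        · rw [h3, homePattern_normal (by omega) hr hq (by simpa using hL)]
    · have hc := lastRound_lt hq
      set c := (lastRound (numPairs n d) q).1 with hcd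
      -- The round number c is also the position of the left super-games that are completed on this
      -- day, and the super-team i0 is at position c in slot i0 − c.
      refine ⟨_, (Game.lastSuper q ((i0 + numSuper n d - c) % numSuper n d) k hq
        (Nat.mod_lt _ (by omega)) hk).cast rfl ?_ rfl (homePattern_last _).symm⟩
      rw [← hcd, superX, add_comm c, mod_sub_add hi0 (by omega)]
  · refine ⟨fun _ => true, fun t ht => ?_⟩
    rcases day_cases H ht with ⟨r, hr, q, hq, rfl⟩ | ⟨q, hq, rfl⟩
    · exact ⟨_, (Game.left r p q (3 * d) hr hp hq (by omega)).cast rfl (leftLabel_last _ _) rfl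
        (homePattern_left _ H.even_d hr hq rfl).symm⟩
    · exact ⟨_, (Game.lastPair q p hq hp).cast rfl rfl rfl (homePattern_last _).symm⟩

lemma leftRound_le {q : ℕ} (hq : q < 6 * d) :
    1 ≤ (leftRound d q).1 ∧ (leftRound d q).1 ≤ 3 * d := by
  have := H.six_le
  rw [leftRound]; split_ifs <;> simp only <;> omega

/-- Every `Y`-team plays on every day. -/
lemma exists_game_of_label_Y {j : ℕ} (hj : j < n) :
    ∃ L : ℕ → Bool, ∀ t < 2 * n, ∃ i < n, Game n d t i j (homePattern n d L (j % 3) t) := by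
  have h6 := H.six_le
  have hlm := H.pairs_le
  suffices ∃ L : ℕ → Bool, ∀ t < 2 * n, ∃ i, Game n d t i j (homePattern n d L (j % 3) t) by
    obtain ⟨L, hL⟩ := this
    refine ⟨L, fun t ht => ?_⟩
    obtain ⟨i, g⟩ := hL t ht
    exact ⟨i, (g.bounds H).2.1, g⟩
  have hshift : ∀ q < 6 * d, ∀ k < 3 * d + 1,
      ∃ k' < 3 * d + 1, (k' + (leftRound d q).1) % (3 * d + 1) = k := by
    intro q hq k hk
    exact ⟨(k + (3 * d + 1) - (leftRound d q).1) % (3 * d + 1), Nat.mod_lt _ (by omega),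
      mod_sub_add hk (by have := leftRound_le H hq; omega)⟩
  rcases label_cases H hj with ⟨j0, hj0, k, hk, rfl⟩ | ⟨p, hp, rfl⟩
  · refine ⟨fun r => decide ((j0 + numSuper n d - (2 * r) % numSuper n d) % numSuper n d
      < numPairs n d), fun t ht => ?_⟩
    have h3 : (3 * d * j0 + k) % 3 = k % 3 := by
      rw [mul_assoc, Nat.mul_add_mod]
    rcases day_cases H ht with ⟨r, hr, q, hq, rfl⟩ | ⟨q, hq, rfl⟩
    · have hY : superY n d ((j0 + numSuper n d - (2 * r) % numSuper n d) % numSuper n d) r = j0 := by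
        rw [superY, ← Nat.add_mod_mod]
        exact mod_sub_add hj0 (Nat.mod_lt _ (by omega)).le
      by_cases hL : (j0 + numSuper n d - (2 * r) % numSuper n d) % numSuper n d < numPairs n d
      · obtain ⟨k', hk', hkk⟩ := hshift q hq k (by omega)
        refine ⟨_, (Game.left r _ q k' hr hL hq hk').cast rfl rfl ?_ ?_⟩
        · rw [hkk, hY, leftLabel_of_lt hk]
        · rw [homePattern_left _ H.even_d hr hq (by simpa using hL)]
      · obtain ⟨b, hb, b', hb', hqe⟩ := exists_normal_opponent (d := d) (a := k / 3) (a' := k % 3)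
          (q := q) (by omega) (by omega) hq
        refine ⟨_, (normal_game (a := b) (a' := b') (b := k / 3) (b' := k % 3) hr
          (by simpa using hL) (Nat.mod_lt _ (by omega)) hb hb' (by omega)
          (Nat.mod_lt k (by norm_num)) (decide (3 ≤ (q + 6 - k % 3) % 6)) ?_).cast rfl rfl
          ?_ ?_⟩
        · rw [add_comm b (k / 3), add_right_comm _ b']
          simpa using hqe
        · rw [hY, Nat.div_add_mod]
        · rw [h3, homePattern_normal (by omega) hr hq (by simpa using hL)]
    · have hc := lastRound_lt hq
      set c := (lastRound (numPairs n d) q).1 with hcd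
      -- The slot in which a Y-super-team is at position c is found by halving j0 − c modulo the odd
      -- number m.
      obtain ⟨r, hr, hrj⟩ := exists_half_slot (p := c) H.odd_m (by omega) hj0
      refine ⟨_, (Game.lastSuper q r k hq hr hk).cast rfl rfl ?_ (homePattern_last _).symm⟩
      rw [← hcd, superY, hrj]
  · refine ⟨fun _ => true, fun t ht => ?_⟩
    rcases day_cases H ht with ⟨r, hr, q, hq, rfl⟩ | ⟨q, hq, rfl⟩
    · obtain ⟨k', hk', hkk⟩ := hshift q hq (3 * d) (by omega)
      refine ⟨_, (Game.left r p q k' hr hp hq hk').cast rfl rfl ?_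
        (homePattern_left _ H.even_d hr hq rfl).symm⟩
      rw [hkk, leftLabel_last]
    · have hc := lastRound_lt hq
      refine ⟨_, (Game.lastPair q ((p + numPairs n d - (lastRound (numPairs n d) q).1) %
        numPairs n d) hq (Nat.mod_lt _ (by omega))).cast rfl rfl ?_ (homePattern_last _).symm⟩
      rw [mod_sub_add hp hc.le]

/-- Round c is played on day c − 1 and again 3d − 1 days later, except that round 1 closes the
second half on day 6d − 1. In both cases the two days have different parities, hence opposite
venues, and they are far apart. -/
lemma exists_leftRound {c : ℕ} (hc : 1 ≤ c) (hc' : c ≤ 3 * d) : ∃ q : Bool → ℕ,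
    (∀ h, q h < 6 * d ∧ leftRound d (q h) = (c, h)) ∧ q true ≠ q false + 1 ∧
      q false ≠ q true + 1 := by
  have h6 := H.six_le
  have hev := H.even_d
  have first : leftRound d (c - 1) = (c, decide (c % 2 = 0)) := by
    rw [leftRound, if_pos (by omega), Nat.sub_add_cancel hc]
  have second : leftRound d (if c = 1 then 6 * d - 1 else 3 * d + c - 2)
      = (c, decide (c % 2 = 1)) := by
    split_ifs with h1
    · subst h1
      rw [leftRound, if_neg (by omega), if_neg (by omega)]; simp
    · rw [leftRound, if_neg (by omega), if_pos (by omega),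
        show 3 * d + c - 2 - 3 * d + 2 = c by omega]
  rcases Nat.mod_two_eq_zero_or_one c with hp | hp
  · refine ⟨fun h => if h then c - 1 else if c = 1 then 6 * d - 1 else 3 * d + c - 2, ?_, ?_, ?_⟩
    · rintro (_ | _)
      · exact ⟨by dsimp only; split_ifs <;> omega, second.trans (by simp [hp])⟩
      · exact ⟨by dsimp only; simp only [if_true]; omega, first.trans (by simp [hp])⟩
    · simp only [if_true, Bool.false_eq_true, if_false]; split_ifs <;> omega
    · simp only [if_true, Bool.false_eq_true, if_false]; split_ifs <;> omega
  · refine ⟨fun h => if h then if c = 1 then 6 * d - 1 else 3 * d + c - 2 else c - 1, ?_, ?_, ?_⟩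
    · rintro (_ | _)
      · exact ⟨by dsimp only; simp only [Bool.false_eq_true, if_false]; omega, first.trans (by simp [hp])⟩
      · exact ⟨by dsimp only; simp only [if_true]; split_ifs <;> omega, second.trans (by simp [hp])⟩
    · simp only [if_true, Bool.false_eq_true, if_false]; split_ifs <;> omega
    · simp only [if_true, Bool.false_eq_true, if_false]; split_ifs <;> omega

-- Round c is played on the days c and l + c. The second half reverses the venues of the first one,
-- so the parity of l plays no role.
omit H in
lemma exists_lastRound {l c : ℕ} (hl : 3 ≤ l) (hc : c < l) : ∃ q : Bool → ℕ,
    (∀ h, q h < 2 * l ∧ lastRound l (q h) = (c, h)) ∧ q true ≠ q false + 1 ∧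
      q false ≠ q true + 1 := by
  have first : lastRound l c = (c, decide (c % 2 = 1)) := by
    rw [lastRound, if_pos hc]
  have second : lastRound l (l + c) = (c, decide (c % 2 = 0)) := by
    rw [lastRound, if_neg (by omega), Nat.add_sub_cancel_left]
  rcases Nat.mod_two_eq_zero_or_one c with hp | hp
  · refine ⟨fun h => if h then l + c else c, ?_, ?_, ?_⟩
    · rintro (_ | _)
      · exact ⟨by dsimp only; split_ifs <;> omega, first.trans (by simp [hp])⟩
      · exact ⟨by simp only [if_true]; omega, second.trans (by simp [hp])⟩
    all_goals simp only [if_true, Bool.false_eq_true, if_false]; omega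
  · refine ⟨fun h => if h then c else l + c, ?_, ?_, ?_⟩
    · rintro (_ | _)
      · exact ⟨by dsimp only; split_ifs <;> omega, second.trans (by simp [hp])⟩
      · exact ⟨by simp only [if_true]; omega, first.trans (by simp [hp])⟩
    all_goals simp only [if_true, Bool.false_eq_true, if_false]; omega

-- Since 6 divides 6d, the reduction modulo 6d keeps residues modulo 6. The two days differ by 3
-- modulo 6, so they are not adjacent.
omit H in
lemma normal_day_ne {s s' A B B' : ℕ} (h : (A + B) % (6 * d) = s) (h' : (A + B') % (6 * d) = s')
    (hB : B' = B + 3) (R : ℕ) : 6 * d * R + s' ≠ 6 * d * R + s + 1 ∧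
    6 * d * R + s ≠ 6 * d * R + s' + 1 := by
  have e1 : s % 6 = (A + B) % 6 := by rw [← h, Nat.mod_mod_of_dvd _ ⟨d, rfl⟩]
  have e2 : s' % 6 = (A + B') % 6 := by rw [← h', Nat.mod_mod_of_dvd _ ⟨d, rfl⟩]
  omega

/-- Every pair plays at either venue, and not on two consecutive days. -/
lemma exists_days {i j : ℕ} (hi : i < n) (hj : j < n) : ∃ D : Bool → ℕ,
    (∀ h, Game n d (D h) i j h) ∧ D true ≠ D false + 1 ∧ D false ≠ D true + 1 := by
  have h6 := H.six_le
  have hlm := H.pairs_le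
  have hle := H.le_pairs
  rcases label_cases H hi with ⟨i0, hi0, k, hk, rfl⟩ | ⟨p, hp, rfl⟩
  · rcases label_cases H hj with ⟨j0, hj0, k', hk', rfl⟩ | ⟨p, hp, rfl⟩
    · set r := meetSlot (numSuper n d) i0 j0 with hr
      set p := meetPos (numSuper n d) i0 j0 with hp
      have hrm : r < numSuper n d := Nat.mod_lt _ (by omega)
      have hpm : p < numSuper n d := Nat.mod_lt _ (by omega)
      have hX : superX n d p r = i0 := meetPos_add_slot hi0 hj0
      have hY : superY n d p r = j0 := meetPos_add_two_slot hi0 hj0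
      by_cases hpl : p < numPairs n d
      -- A left super-game omits round 0, so teams of equal index in their super-teams do not meet
      -- there. They meet in the last slot, in round p.
      · by_cases hkk : k = k'
        · obtain ⟨q, hq, hne⟩ := exists_lastRound (by omega) hpl
          refine ⟨fun h => 6 * d * numSuper n d + q h, fun h => ?_, by dsimp only; omega, by dsimp only; omega⟩
          obtain ⟨hq1, hq2⟩ := hq h
          refine (Game.lastSuper (q h) r k hq1 hrm hk).cast rfl ?_ ?_ (by rw [hq2])
          · rw [hq2, hX]
          · rw [hq2, hY, hkk]
        · set c := (k' + (3 * d + 1) - k) % (3 * d + 1) with hc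
          have hck : (k + c) % (3 * d + 1) = k' := by
            rw [add_comm]; exact mod_sub_add (by omega) (by omega)
          have hc0 : c ≠ 0 := by
            intro h0
            rw [h0, add_zero, Nat.mod_eq_of_lt (by omega)] at hck
            exact hkk hck
          have hcl : c < 3 * d + 1 := Nat.mod_lt _ (by omega)
          obtain ⟨q, hq, hne⟩ := exists_leftRound H (c := c) (by omega) (by omega)
          refine ⟨fun h => 6 * d * r + q h, fun h => ?_, by dsimp only; omega, by dsimp only; omega⟩
          obtain ⟨hq1, hq2⟩ := hq h
          refine (Game.left r p (q h) k hrm hpl hq1 (by omega)).cast rfl ?_ ?_ (by rw [hq2])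
          · rw [hX, leftLabel_of_lt hk]
          · rw [hq2, hY, hck, leftLabel_of_lt hk']
      · have hne := normal_day_ne (d := d) (A := 6 * (k / 3 + k' / 3) + k % 3 + k' % 3) (B := 0) (B' := 3)
          rfl rfl rfl r
        refine ⟨fun h => 6 * d * r +
          (6 * (k / 3 + k' / 3) + k % 3 + k' % 3 + (if h then 3 else 0)) % (6 * d),
          fun h => ?_, hne.1, hne.2⟩
        refine (normal_game hrm (by omega) hpm (a := k / 3) (a' := k % 3) (b := k' / 3)
          (b' := k' % 3) (by omega) (by omega) (by omega) (by omega) h rfl).cast rfl ?_ ?_ rfl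
        · rw [hX, Nat.div_add_mod]
        · rw [hY, Nat.div_add_mod]
    · set r := (i0 + numSuper n d - p) % numSuper n d with hr
      have hrm : r < numSuper n d := Nat.mod_lt _ (by omega)
      have hX : superX n d p r = i0 := by
        rw [superX, add_comm]; exact mod_sub_add hi0 (by omega)
      -- In a left super-game the team of the team-pair has index 3d, and round 3d − k leads from
      -- index k to 3d.
      obtain ⟨q, hq, hne⟩ := exists_leftRound H (c := 3 * d - k) (by omega) (by omega)
      refine ⟨fun h => 6 * d * r + q h, fun h => ?_, by dsimp only; omega, by dsimp only; omega⟩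
      obtain ⟨hq1, hq2⟩ := hq h
      refine (Game.left r p (q h) k hrm hp hq1 (by omega)).cast rfl ?_ ?_ (by rw [hq2])
      · rw [hX, leftLabel_of_lt hk]
      · rw [hq2]
        simp only
        rw [show k + (3 * d - k) = 3 * d by omega, Nat.mod_eq_of_lt (by omega), leftLabel_last]
  · rcases label_cases H hj with ⟨j0, hj0, k', hk', rfl⟩ | ⟨p', hp', rfl⟩
    · obtain ⟨r, hrm, hY⟩ := exists_half_slot (p := p) H.odd_m (by omega) hj0
      -- Round k' + 1 leads from index 3d to k' modulo 3d + 1.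
      obtain ⟨q, hq, hne⟩ := exists_leftRound H (c := k' + 1) (by omega) (by omega)
      refine ⟨fun h => 6 * d * r + q h, fun h => ?_, by dsimp only; omega, by dsimp only; omega⟩
      obtain ⟨hq1, hq2⟩ := hq h
      refine (Game.left r p (q h) (3 * d) hrm hp hq1 (by omega)).cast rfl (leftLabel_last _ _) ?_
        (by rw [hq2])
      rw [hq2, superY, hY]
      simp only
      rw [show 3 * d + (k' + 1) = k' + (3 * d + 1) by omega, Nat.add_mod_right,
        Nat.mod_eq_of_lt (by omega), leftLabel_of_lt hk']
    · obtain ⟨q, hq, hne⟩ := exists_lastRound (l := numPairs n d)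
        (c := (p' + numPairs n d - p) % numPairs n d) (by omega) (Nat.mod_lt _ (by omega))
      refine ⟨fun h => 6 * d * numSuper n d + q h, fun h => ?_, by dsimp only; omega, by dsimp only; omega⟩
      obtain ⟨hq1, hq2⟩ := hq h
      refine (Game.lastPair (q h) p hq1 hp).cast rfl rfl ?_ (by rw [hq2])
      rw [hq2, add_comm p, mod_sub_add hp' (by omega)]

end

/-! ### The games of the construction form a schedule -/

/-- The index set of the games of the construction. -/
abbrev GameIndex (n d : ℕ) : Type :=
  ((Fin (numSuper n d) × Fin (numSuper n d - numPairs n d) × (Fin d × Fin 3) × (Fin d × Fin 3))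
    × Bool) ⊕
  (Fin (numSuper n d) × Fin (numPairs n d) × Fin (6 * d) × Fin (3 * d + 1)) ⊕
  (Fin (2 * numPairs n d) × Fin (numPairs n d)) ⊕
  (Fin (2 * numPairs n d) × Fin (numSuper n d) × Fin (3 * d))

/-- The day, the labels and the venue of a game. -/
def GameIndex.game {n d : ℕ} : GameIndex n d → ℕ × ℕ × ℕ × Bool
  | .inl ((r, p, a, b), h) =>
    let p' : ℕ := numPairs n d + p
    (6 * d * r + (6 * ((a.1 : ℕ) + b.1) + a.2 + b.2 + (if h then 3 else 0)) % (6 * d),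
      3 * d * superX n d p' r + (3 * a.1 + a.2), 3 * d * superY n d p' r + (3 * b.1 + b.2), h)
  | .inr (.inl (r, p, q, k)) =>
    (6 * d * r + q, leftLabel n d (superX n d p r) p k,
      leftLabel n d (superY n d p r) p ((k + (leftRound d q).1) % (3 * d + 1)), (leftRound d q).2)
  | .inr (.inr (.inl (q, k))) =>
    (6 * d * numSuper n d + q, coreSize n d + k,
      coreSize n d + (k + (lastRound (numPairs n d) q).1) % numPairs n d,
      (lastRound (numPairs n d) q).2)
  | .inr (.inr (.inr (q, r, k))) =>
    (6 * d * numSuper n d + q,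
      3 * d * superX n d (lastRound (numPairs n d) q).1 r + k,
      3 * d * superY n d (lastRound (numPairs n d) q).1 r + k, (lastRound (numPairs n d) q).2)

section

variable {n d : ℕ}

lemma GameIndex.game_spec (a : GameIndex n d) :
    Game n d a.game.1 a.game.2.1 a.game.2.2.1 a.game.2.2.2 := by
  rcases a with ⟨⟨r, p, a, b⟩, h⟩ | ⟨r, p, q, k⟩ | ⟨q, k⟩ | ⟨q, r, k⟩
  · exact normal_game r.2 (Nat.le_add_right _ _) (by have := p.2; omega) a.1.2 a.2.2 b.1.2 b.2.2 h
      rfl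
  · exact Game.left r p q k r.2 p.2 q.2 k.2
  · exact Game.lastPair q k q.2 k.2
  · exact Game.lastSuper q r k q.2 r.2 k.2

lemma Game.exists_index {t i j : ℕ} {h : Bool} (g : Game n d t i j h) :
    ∃ a : GameIndex n d, a.game = (t, i, j, h) := by
  induction g with
  | normalAway r p a a' b b' hr hp hp' ha ha' hb hb' =>
    refine ⟨.inl ((⟨r, hr⟩, ⟨p - numPairs n d, by omega⟩, (⟨a, ha⟩, ⟨a', ha'⟩),
      (⟨b, hb⟩, ⟨b', hb'⟩)), false), ?_⟩
    simp [GameIndex.game, Nat.add_sub_cancel' hp]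
  | normalHome r p a a' b b' hr hp hp' ha ha' hb hb' =>
    refine ⟨.inl ((⟨r, hr⟩, ⟨p - numPairs n d, by omega⟩, (⟨a, ha⟩, ⟨a', ha'⟩),
      (⟨b, hb⟩, ⟨b', hb'⟩)), true), ?_⟩
    simp [GameIndex.game, Nat.add_sub_cancel' hp]
  | left r p q k hr hp hq hk =>
    exact ⟨.inr (.inl (⟨r, hr⟩, ⟨p, hp⟩, ⟨q, hq⟩, ⟨k, hk⟩)), rfl⟩
  | lastPair q k hq hk => exact ⟨.inr (.inr (.inl (⟨q, hq⟩, ⟨k, hk⟩))), rfl⟩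
  | lastSuper q r k hq hr hk => exact ⟨.inr (.inr (.inr (⟨q, hq⟩, ⟨r, hr⟩, ⟨k, hk⟩))), rfl⟩

/-- With u = m − l the count is 18d²mu + 6dml(3d + 1) + 2l² + 6dml = 2(3dm + l)², and 3dm + l = n.
-/
lemma GameIndex.card (H : Admissible n d) : Fintype.card (GameIndex n d) = 2 * n * n := by
  obtain ⟨u, hu⟩ : ∃ u, numSuper n d = u + numPairs n d :=
    ⟨numSuper n d - numPairs n d, by have := H.pairs_le; omega⟩
  have h2 : n = 3 * d * (u + numPairs n d) + numPairs n d := by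
    rw [← hu, ← coreSize_eq]; exact H.core_add.symm
  simp only [GameIndex, Fintype.card_sum, Fintype.card_prod, Fintype.card_fin, Fintype.card_bool]
  rw [show numSuper n d - numPairs n d = u by omega, hu]
  generalize numPairs n d = l at h2
  rw [h2]
  ring

/-- This converts existence into uniqueness: a surjection from the games onto a set of 2n² elements
is injective. No two kinds of games have to be compared directly. -/
lemma GameIndex.injective_of_surjective (H : Admissible n d) {β : Type*} [Fintype β]
    (hβ : Fintype.card β = 2 * n * n) (f : GameIndex n d → β) (hf : Function.Surjective f) :
    Function.Injective f :=
  ((Fintype.bijective_iff_surjective_and_card f).2 ⟨hf, by rw [GameIndex.card H, hβ]⟩).1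

lemma Game.unique_X (H : Admissible n d) {t i j j' : ℕ} {h h' : Bool} (g : Game n d t i j h)
    (g' : Game n d t i j' h') : j = j' ∧ h = h' := by
  let f : GameIndex n d → Fin (2 * n) × Fin n := fun a =>
    (⟨a.game.1, (a.game_spec.bounds H).1⟩, ⟨a.game.2.1, (a.game_spec.bounds H).2.1⟩)
  have hf : Function.Surjective f := by
    rintro ⟨t, i⟩
    obtain ⟨L, hL⟩ := exists_game_of_label_X H i.2
    obtain ⟨j, -, g⟩ := hL t t.2
    obtain ⟨a, ha⟩ := g.exists_index
    refine ⟨a, ?_⟩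
    simp [f, ha]
  obtain ⟨a, ha⟩ := g.exists_index
  obtain ⟨b, hb⟩ := g'.exists_index
  have : a = b := GameIndex.injective_of_surjective H (by simp) f hf (by simp [f, ha, hb])
  subst this
  simp_all

lemma Game.unique_Y (H : Admissible n d) {t i i' j : ℕ} {h h' : Bool} (g : Game n d t i j h)
    (g' : Game n d t i' j h') : i = i' ∧ h = h' := by
  let f : GameIndex n d → Fin (2 * n) × Fin n := fun a =>
    (⟨a.game.1, (a.game_spec.bounds H).1⟩, ⟨a.game.2.2.1, (a.game_spec.bounds H).2.2⟩)
  have hf : Function.Surjective f := by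
    rintro ⟨t, j⟩
    obtain ⟨L, hL⟩ := exists_game_of_label_Y H j.2
    obtain ⟨j, -, g⟩ := hL t t.2
    obtain ⟨a, ha⟩ := g.exists_index
    refine ⟨a, ?_⟩
    simp [f, ha]
  obtain ⟨a, ha⟩ := g.exists_index
  obtain ⟨b, hb⟩ := g'.exists_index
  have : a = b := GameIndex.injective_of_surjective H (by simp) f hf (by simp [f, ha, hb])
  subst this
  simp_all

lemma Game.unique_day (H : Admissible n d) {t t' i j : ℕ} {h : Bool} (g : Game n d t i j h)
    (g' : Game n d t' i j h) : t = t' := by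
  let f : GameIndex n d → Fin n × Fin n × Bool := fun a =>
    (⟨a.game.2.1, (a.game_spec.bounds H).2.1⟩, ⟨a.game.2.2.1, (a.game_spec.bounds H).2.2⟩,
      a.game.2.2.2)
  have hf : Function.Surjective f := by
    rintro ⟨i, j, h⟩
    obtain ⟨D, hD, -⟩ := exists_days H i.2 j.2
    obtain ⟨a, ha⟩ := (hD h).exists_index
    refine ⟨a, ?_⟩
    simp [f, ha]
  obtain ⟨a, ha⟩ := g.exists_index
  obtain ⟨b, hb⟩ := g'.exists_index
  have : a = b := GameIndex.injective_of_surjective H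
    (by simp only [Fintype.card_prod, Fintype.card_fin, Fintype.card_bool]; ring) f hf
    (by simp [f, ha, hb])
  subst this
  simp_all

lemma Game.not_consecutive (H : Admissible n d) {t i j : ℕ} {h h' : Bool} (g : Game n d t i j h)
    (g' : Game n d (t + 1) i j h') : False := by
  obtain ⟨D, hD, h1, h2⟩ := exists_days H (g.bounds H).2.1 (g.bounds H).2.2
  have e := g.unique_day H (hD h)
  have e' := g'.unique_day H (hD h')
  cases h <;> cases h' <;> omega

/-- All slots begin at multiples of 6, and in the first m slots the venue either alternates or
consists of three away and three home days, shifted by c. A window of four days crosses at most one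
slot boundary, so only the patterns on its two sides have to be combined. In the last slot the venue
can repeat only once, between the two halves. -/
lemma homePattern_bounded (H : Admissible n d) (L : ℕ → Bool) {c t : ℕ} (hc : c < 3)
    (h : Bool) : ¬ ∀ k < 4, homePattern n d L c (t + k) = h := by
  intro hall
  have h6 := H.six_le
  have hl := H.le_pairs
  -- `B` stands for the end of the slot of day t and `b` for the kind of this slot. Behind `B` there
  -- is either a slot of kind `b'` or the last slot.
  have key : ∀ B : ℕ, 6 ∣ B → ∀ b : Bool,
      (∀ k < 4, t + k < B →
        (h = true ↔ if b then (t + k) % 2 = 1 else 3 ≤ (t + k + 6 - c) % 6)) →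
      ((∃ b' : Bool, ∀ k < 4, B ≤ t + k →
        (h = true ↔ if b' then (t + k) % 2 = 1 else 3 ≤ (t + k + 6 - c) % 6)) ∨
      (∀ k < 4, B ≤ t + k → t + k - B < numPairs n d → (h = true ↔ (t + k - B) % 2 = 1)) ∧
      (∀ k < 4, B ≤ t + k → ¬ t + k - B < numPairs n d →
        (h = true ↔ (t + k - B - numPairs n d) % 2 = 0))) → False := by
    intro B hB b h1 h2
    obtain ⟨e, rfl⟩ := hB
    rcases h2 with ⟨b', h2⟩ | ⟨h2, h3⟩
    · have cases_k : ∃ f : Bool → ℕ → Prop, (∀ b k, f b k ↔ if b then (t + k) % 2 = 1 else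
          3 ≤ (t + k + 6 - c) % 6) ∧ (∀ k < 4, t + k < 6 * e → (h = true ↔ f b k)) ∧
          (∀ k < 4, 6 * e ≤ t + k → (h = true ↔ f b' k)) := ⟨_, fun _ _ => Iff.rfl, h1, h2⟩
      obtain ⟨f, hf, h1, h2⟩ := cases_k
      have ft : ∀ k, f true k ↔ (t + k) % 2 = 1 := fun k => hf true k
      have ff : ∀ k, f false k ↔ 3 ≤ (t + k + 6 - c) % 6 := fun k => by simpa using hf false k
      have hcases : 6 * e ≤ t ∨ 6 * e = t + 1 ∨ 6 * e = t + 2 ∨ 6 * e = t + 3 ∨ t + 4 ≤ 6 * e := by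
        omega
      rcases hcases with hc1 | hc1 | hc1 | hc1 | hc1
      · have b0 := h2 0 (by omega) (by omega)
        have b1 := h2 1 (by omega) (by omega)
        have b2 := h2 2 (by omega) (by omega)
        have b3 := h2 3 (by omega) (by omega)
        cases b' <;> cases h <;>
          simp only [ft, ff, Bool.false_eq_true, false_iff, true_iff] at b0 b1 b2 b3 <;> omega
      · have b0 := h1 0 (by omega) (by omega)
        have b1 := h2 1 (by omega) (by omega)
        have b2 := h2 2 (by omega) (by omega)
        have b3 := h2 3 (by omega) (by omega)
        cases b <;> cases b' <;> cases h <;>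
          simp only [ft, ff, Bool.false_eq_true, false_iff, true_iff] at b0 b1 b2 b3 <;> omega
      · have b0 := h1 0 (by omega) (by omega)
        have b1 := h1 1 (by omega) (by omega)
        have b2 := h2 2 (by omega) (by omega)
        have b3 := h2 3 (by omega) (by omega)
        cases b <;> cases b' <;> cases h <;>
          simp only [ft, ff, Bool.false_eq_true, false_iff, true_iff] at b0 b1 b2 b3 <;> omega
      · have b0 := h1 0 (by omega) (by omega)
        have b1 := h1 1 (by omega) (by omega)
        have b2 := h1 2 (by omega) (by omega)
        have b3 := h2 3 (by omega) (by omega)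
        cases b <;> cases b' <;> cases h <;>
          simp only [ft, ff, Bool.false_eq_true, false_iff, true_iff] at b0 b1 b2 b3 <;> omega
      · have b0 := h1 0 (by omega) (by omega)
        have b1 := h1 1 (by omega) (by omega)
        have b2 := h1 2 (by omega) (by omega)
        have b3 := h1 3 (by omega) (by omega)
        cases b <;> cases h <;>
          simp only [ft, ff, Bool.false_eq_true, false_iff, true_iff] at b0 b1 b2 b3 <;> omega
    -- In the last slot two consecutive days can have equal venues only at the junction of its
    -- halves, at distance l from its start. As l > 3, a constant window has at most one day in the
    -- last slot.
    · have same : ∀ k < 3, 6 * e ≤ t + k → t + k + 1 - 6 * e = numPairs n d := by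
        intro k hk hkB
        by_contra hne
        by_cases e1 : t + (k + 1) - 6 * e < numPairs n d
        · have c1 := h2 k (by omega) hkB (by omega)
          have c2 := h2 (k + 1) (by omega) (by omega) e1
          cases h <;> simp only [Bool.false_eq_true, false_iff, true_iff] at c1 c2 <;> omega
        · have c1 := h3 k (by omega) hkB (by omega)
          have c2 := h3 (k + 1) (by omega) (by omega) e1
          cases h <;> simp only [Bool.false_eq_true, false_iff, true_iff] at c1 c2 <;> omega
      have s0 := same 0 (by omega)
      have s1 := same 1 (by omega)
      have hlow : 6 * e > t + 1 := by omega
      -- If exactly one day of the window is in the last slot, it is the first day there, an away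
      -- day for X. But the day before a boundary is a home day in both patterns: its parity is odd,
      -- and the shift c is at most 2.
      have hmid : ∀ k < 4, 6 * e = t + k → h = false := by
        intro k hk hke
        have := h2 k hk (by omega) (by omega)
        cases h
        · rfl
        · simp at this; omega
      have s2 := same 2 (by omega)
      have b0 := h1 0 (by omega) (by omega)
      have b1 := h1 1 (by omega) (by omega)
      have b2 := h1 2 (by omega)
      have b3 := h1 3 (by omega)
      have m2 := hmid 2 (by omega)
      have m3 := hmid 3 (by omega)
      cases b <;> cases h <;>
        simp only [Bool.false_eq_true, if_true, if_false, false_iff, true_iff,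
          Bool.true_eq_false, imp_false, imp_true_iff] at b0 b1 b2 b3 m2 m3 <;> omega
  have slot : ∀ k < 4, ∀ r, t + k < 6 * d * numSuper n d → (t + k) / (6 * d) = r →
      (h = true ↔ if L r then (t + k) % 2 = 1 else 3 ≤ (t + k + 6 - c) % 6) := by
    intro k hk r h1 h2
    rw [← hall k hk, homePattern, if_pos h1, h2]
    split_ifs <;> simp
  have hdvd : ∀ r, 6 ∣ 6 * d * r := fun r => ⟨d * r, by ring⟩
  have last : ∀ k < 4, 6 * d * numSuper n d ≤ t + k →
      (t + k - 6 * d * numSuper n d < numPairs n d →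
        (h = true ↔ (t + k - 6 * d * numSuper n d) % 2 = 1)) ∧
      (¬ t + k - 6 * d * numSuper n d < numPairs n d →
        (h = true ↔ (t + k - 6 * d * numSuper n d - numPairs n d) % 2 = 0)) := by
    intro k hk h1
    rw [← hall k hk, homePattern, if_neg (by omega), lastRound]
    constructor <;> intro h2
    · rw [if_pos h2]; simp
    · rw [if_neg h2]; simp
  by_cases ht' : t < 6 * d * numSuper n d
  · obtain ⟨r, hr, q, hq, hrq⟩ := exists_mul_add ht'
    have hB : 6 * d * (r + 1) = 6 * d * r + 6 * d := by ring
    have hdiv : ∀ k, t + k < 6 * d * (r + 1) → (t + k) / (6 * d) = r := by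
      intro k hk
      rw [hrq, add_assoc, Nat.mul_add_div (by omega), Nat.div_eq_of_lt (by omega), add_zero]
    have hle : 6 * d * (r + 1) ≤ 6 * d * numSuper n d := Nat.mul_le_mul_left _ hr
    refine key _ (hdvd (r + 1)) (L r) (fun k hk hkB => slot k hk r (by omega) (hdiv k hkB)) ?_
    rcases Nat.lt_or_ge (r + 1) (numSuper n d) with hr1 | hr1
    · left
      have hle2 : 6 * d * (r + 1 + 1) ≤ 6 * d * numSuper n d := Nat.mul_le_mul_left _ hr1
      have hB2 : 6 * d * (r + 1 + 1) = 6 * d * (r + 1) + 6 * d := by ring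
      refine ⟨L (r + 1), fun k hk hkB => slot k hk (r + 1) (by omega) ?_⟩
      obtain ⟨e, he⟩ := Nat.exists_eq_add_of_le hkB
      rw [he, Nat.mul_add_div (by omega), Nat.div_eq_of_lt (by omega), add_zero]
    · right
      have : r + 1 = numSuper n d := by omega
      rw [this]
      exact ⟨fun k hk h1 => (last k hk h1).1, fun k hk h1 => (last k hk h1).2⟩
  -- The window lies in the last slot: no day precedes `B`, and the value `false` is a dummy.
  · refine key _ (hdvd (numSuper n d)) false (fun k hk hkB => by omega) (Or.inr ?_)
    exact ⟨fun k hk h1 => (last k hk h1).1, fun k hk h1 => (last k hk h1).2⟩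

/-- Labelings of the two leagues. -/
structure LeagueLabels (x y : Fin n → Team n) : Prop where
  x_inj : Function.Injective x
  x_mem : ∀ i, x i ∈ leagueX n
  y_inj : Function.Injective y
  y_mem : ∀ i, y i ∈ leagueY n

namespace LeagueLabels

variable {x y : Fin n → Team n} (hxy : LeagueLabels x y)

include hxy

lemma x_left (i : Fin n) : (x i).isLeft = true := by simpa [leagueX] using hxy.x_mem i

lemma y_left (i : Fin n) : (y i).isLeft = false := by simpa [leagueY] using hxy.y_mem i

lemma x_ne_y (i j : Fin n) : x i ≠ y j := fun h => by
  have := hxy.x_left i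
  rw [h, hxy.y_left] at this
  cases this

lemma exists_x (u : Fin n) : ∃ i, x i = Sum.inl u := by
  have h : ∀ i, ∃ u : Fin n, x i = Sum.inl u := fun i => by
    have := hxy.x_left i
    cases hx : x i with
    | inl a => exact ⟨a, rfl⟩
    | inr a => rw [hx] at this; cases this
  choose f hf using h
  have hinj : Function.Injective f := fun a b hab => hxy.x_inj (by rw [hf, hf, hab])
  obtain ⟨i, hi⟩ := (Finite.injective_iff_surjective.1 hinj) u
  exact ⟨i, by rw [hf, hi]⟩

lemma exists_y (u : Fin n) : ∃ i, y i = Sum.inr u := by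
  have h : ∀ i, ∃ u : Fin n, y i = Sum.inr u := fun i => by
    have := hxy.y_left i
    cases hx : y i with
    | inr a => exact ⟨a, rfl⟩
    | inl a => rw [hx] at this; cases this
  choose f hf using h
  have hinj : Function.Injective f := fun a b hab => hxy.y_inj (by rw [hf, hf, hab])
  obtain ⟨i, hi⟩ := (Finite.injective_iff_surjective.1 hinj) u
  exact ⟨i, by rw [hf, hi]⟩

lemma cases (v : Team n) : (∃ i, v = x i) ∨ ∃ j, v = y j := by
  rcases v with u | u
  · obtain ⟨i, hi⟩ := hxy.exists_x u
    exact Or.inl ⟨i, hi.symm⟩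
  · obtain ⟨i, hi⟩ := hxy.exists_y u
    exact Or.inr ⟨i, hi.symm⟩

/-- The entry for a day and a team is read off from a game that exists; uniqueness shows that no
other game claims the same entry. -/
lemma exists_schedule (H : Admissible n d) : ∃ S : Schedule n, IsThreePathSchedule d x y S := by
  have key : ∀ (t : Fin (2 * n)) (v : Team n), ∃ o : Team n × Bool, ∀ (i j : Fin n) (h : Bool),
      (v = x i → (o = (y j, h) ↔ Game n d t i j h)) ∧
      (v = y j → (o = (x i, !h) ↔ Game n d t i j h)) := by
    intro t v
    rcases hxy.cases v with ⟨i, rfl⟩ | ⟨j, rfl⟩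
    · obtain ⟨L, hL⟩ := exists_game_of_label_X H i.2
      obtain ⟨j, hj, g⟩ := hL t t.2
      refine ⟨(y ⟨j, hj⟩, homePattern n d L (i % 3) t), fun i' j' h => ⟨fun hi => ?_, fun hi => ?_⟩⟩
      · obtain rfl := hxy.x_inj hi
        constructor
        · intro e
          rw [Prod.mk.injEq] at e
          obtain rfl := hxy.y_inj e.1
          rw [← e.2]; exact g
        · intro g'
          obtain ⟨e1, e2⟩ := g.unique_X H g'
          rw [← e2]
          subst e1
          rfl
      · exact absurd hi (hxy.x_ne_y _ _)
    · obtain ⟨L, hL⟩ := exists_game_of_label_Y H j.2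
      obtain ⟨i, hi, g⟩ := hL t t.2
      refine ⟨(x ⟨i, hi⟩, !homePattern n d L (j % 3) t),
        fun i' j' h => ⟨fun hi => ?_, fun hi => ?_⟩⟩
      · exact absurd hi.symm (hxy.x_ne_y _ _)
      · obtain rfl := hxy.y_inj hi
        constructor
        · intro e
          rw [Prod.mk.injEq] at e
          obtain rfl := hxy.x_inj e.1
          rw [← Bool.not_inj e.2]; exact g
        · intro g'
          obtain ⟨e1, e2⟩ := g.unique_Y H g'
          rw [← e2]
          subst e1
          rfl
  choose S hS using key
  exact ⟨S, fun t i j h => ⟨(hS t (x i) i j h).1 rfl, (hS t (y j) i j h).2 rfl⟩⟩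

end LeagueLabels

namespace IsThreePathSchedule

variable {x y : Fin n → Team n} {S : Schedule n}

lemma apply_x (hS : IsThreePathSchedule d x y S) {t : Fin (2 * n)} {i j : Fin n} {h : Bool}
    (g : Game n d t i j h) : S t (x i) = (y j, h) := (hS t i j h).1.2 g

lemma apply_y (hS : IsThreePathSchedule d x y S) {t : Fin (2 * n)} {i j : Fin n} {h : Bool}
    (g : Game n d t i j h) : S t (y j) = (x i, !h) := (hS t i j h).2.2 g

lemma feasible (hS : IsThreePathSchedule d x y S) (hxy : LeagueLabels x y) (H : Admissible n d) :
    Feasible S := by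
  have hX : ∀ i : Fin n, ∃ L : ℕ → Bool, ∀ t : Fin (2 * n), ∃ j : Fin n,
      Game n d t i j (homePattern n d L (i % 3) t) := fun i => by
    obtain ⟨L, hL⟩ := exists_game_of_label_X H i.2
    refine ⟨L, fun t => ?_⟩
    obtain ⟨j, hj, g⟩ := hL t t.2
    exact ⟨⟨j, hj⟩, g⟩
  have hY : ∀ j : Fin n, ∃ L : ℕ → Bool, ∀ t : Fin (2 * n), ∃ i : Fin n,
      Game n d t i j (homePattern n d L (j % 3) t) := fun i => by
    obtain ⟨L, hL⟩ := exists_game_of_label_Y H i.2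
    refine ⟨L, fun t => ?_⟩
    obtain ⟨j, hj, g⟩ := hL t t.2
    exact ⟨⟨j, hj⟩, g⟩
  have cases_v : ∀ (t : Fin (2 * n)) (v : Team n), ∃ (i j : Fin n) (h : Bool), Game n d t i j h ∧
      (v = x i ∨ v = y j) := by
    intro t v
    rcases hxy.cases v with ⟨i, rfl⟩ | ⟨j, rfl⟩
    · obtain ⟨L, hL⟩ := hX i
      obtain ⟨j, g⟩ := hL t
      exact ⟨i, j, _, g, Or.inl rfl⟩
    · obtain ⟨L, hL⟩ := hY j
      obtain ⟨i, g⟩ := hL t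
      exact ⟨i, j, _, g, Or.inr rfl⟩
  refine ⟨fun t v => ?_, fun t v => ?_, fun t v => ?_, fun u v h => ?_, fun t t' v htt => ?_,
    fun v t ht h hall => ?_⟩
  · obtain ⟨i, j, h, g, rfl | rfl⟩ := cases_v t v
    · rw [hS.apply_x g, hxy.x_left, hxy.y_left]; simp
    · rw [hS.apply_y g, hxy.x_left, hxy.y_left]; simp
  · obtain ⟨i, j, h, g, rfl | rfl⟩ := cases_v t v
    · rw [hS.apply_x g, hS.apply_y g]
    · rw [hS.apply_y g, hS.apply_x g]
  · obtain ⟨i, j, h, g, rfl | rfl⟩ := cases_v t v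
    · rw [hS.apply_x g, hS.apply_y g]
    · rw [hS.apply_y g, hS.apply_x g]; simp
  · obtain ⟨i, hi⟩ := hxy.exists_x u
    obtain ⟨j, hj⟩ := hxy.exists_y v
    obtain ⟨D, hD, -⟩ := exists_days H i.2 j.2
    rw [← hi, ← hj]
    refine ⟨⟨D h, ((hD h).bounds H).1⟩, hS.apply_x (hD h), fun t ht => ?_⟩
    exact Fin.ext (((hS t i j h).1.1 ht).unique_day H (hD h))
  · obtain ⟨i, j, h, g, rfl | rfl⟩ := cases_v t v
    · obtain ⟨L, hL⟩ := hX i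
      obtain ⟨j', g'⟩ := hL t'
      rw [hS.apply_x g, hS.apply_x g']
      intro e
      obtain rfl := hxy.y_inj e
      rw [htt] at g'
      exact g.not_consecutive H g'
    · obtain ⟨L, hL⟩ := hY j
      obtain ⟨j', g'⟩ := hL t'
      rw [hS.apply_y g, hS.apply_y g']
      intro e
      obtain rfl := hxy.x_inj e
      rw [htt] at g'
      exact g.not_consecutive H g'
  · rcases hxy.cases v with ⟨i, rfl⟩ | ⟨j, rfl⟩
    · obtain ⟨L, hL⟩ := hX i
      refine homePattern_bounded H L (t := t) (c := i % 3) (Nat.mod_lt _ (by norm_num)) h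
        fun k hk => ?_
      have hk' := hall ⟨k, hk⟩
      obtain ⟨j, g⟩ := hL ⟨t + k, by omega⟩
      rw [hS.apply_x g] at hk'
      exact hk'
    · obtain ⟨L, hL⟩ := hY j
      refine homePattern_bounded H L (t := t) (c := j % 3) (Nat.mod_lt _ (by norm_num)) (!h)
        fun k hk => ?_
      have hk' := hall ⟨k, hk⟩
      obtain ⟨i, g⟩ := hL ⟨t + k, by omega⟩
      rw [hS.apply_y g] at hk'
      rw [← hk']
      simp

end IsThreePathSchedule

end

/-! ### A lower bound for the weight of a feasible schedule -/

/-- Here f k is the distance from home at stage k and s k the length of the next step. Between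
successive zeros in the induction there are at most three stages, and each f-value there is at most
half of the length of the trip by `h₁` and `h₂`. So twice their sum is at most three times this
length, and the trips add up by induction. -/
lemma two_mul_sum_le_of_zeros {f s : ℕ → ℝ} {N : ℕ} (h₁ : ∀ k, f k - f (k + 1) ≤ s k)
    (h₂ : ∀ k, f (k + 1) - f k ≤ s k) (h₀ : f 0 = 0)
    (hz : ∀ k, k + 4 ≤ N → ∃ j < 4, f (k + j) = 0) (z : ℕ) (hzN : z ≤ N) (hfz : f z = 0) :
    2 * ∑ k ∈ Finset.range z, f k ≤ 3 * ∑ k ∈ Finset.range z, s k := by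
  induction z using Nat.strong_induction_on with
  | _ z ih =>
    rcases Nat.eq_zero_or_pos z with rfl | hpos
    · simp
    have hprev : ∃ y, f y = 0 ∧ (z = y + 1 ∨ z = y + 2 ∨ z = y + 3 ∨ z = y + 4) := by
      rcases Nat.lt_or_ge z 4 with h4 | h4
      · exact ⟨0, h₀, by omega⟩
      -- The window z − 4, …, z − 1 contains a zero, so the last trip has at most four steps.
      · obtain ⟨j, hj, hfj⟩ := hz (z - 4) (by omega)
        exact ⟨_, hfj, by omega⟩
    obtain ⟨y, hfy, hzy⟩ := hprev
    have ihy := ih y (by omega) (by omega) hfy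
    have a0 := h₁ y; have a1 := h₁ (y + 1); have a2 := h₁ (y + 2); have a3 := h₁ (y + 3)
    have b0 := h₂ y; have b1 := h₂ (y + 1); have b2 := h₂ (y + 2); have b3 := h₂ (y + 3)
    rcases hzy with rfl | rfl | rfl | rfl <;>
      simp only [Finset.sum_range_succ] <;>
      simp only [add_assoc, Nat.reduceAdd] at * <;> linarith

section

variable {n : ℕ} (I : Inst n)

lemma place_zero (S : Schedule n) (v : Team n) : place S v 0 = v := rfl

lemma place_last (S : Schedule n) (v : Team n) : place S v (2 * n + 1) = v := by
  simp [place]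

lemma place_home {S : Schedule n} {v : Team n} {t : Fin (2 * n)} (h : (S t v).2 = true) :
    place S v (t + 1) = v := by
  simp [place, h]

lemma place_away {S : Schedule n} {v u : Team n} {t : Fin (2 * n)} (h : S t v = (u, false)) :
    place S v (t + 1) = u := by
  simp [place, h]

lemma Feasible.two_mul_sum_le_itinerary {S : Schedule n} (hS : Feasible S) (v : Team n) :
    2 * ∑ t ∈ Finset.range (2 * n), I.w v (place S v (t + 1)) ≤ 3 * I.itinerary S v := by
  have h := two_mul_sum_le_of_zeros (f := fun k => I.w v (place S v k))
    (s := fun k => I.w (place S v k) (place S v (k + 1))) (N := 2 * n + 1)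
    (fun k => by
      have := I.w_triangle v (place S v (k + 1)) (place S v k)
      rw [I.w_symm (place S v (k + 1)) (place S v k)] at this
      linarith)
    (fun k => by
      have := I.w_triangle v (place S v k) (place S v (k + 1))
      linarith)
    (by simp [place_zero, I.w_self]) ?_ (2 * n + 1) le_rfl (by simp [place_last, I.w_self])
  · rw [Finset.sum_range_succ' _ (2 * n), place_zero, I.w_self, add_zero] at h
    exact h
  · intro k hk
    rcases k with _ | t
    -- A window from stage 0 contains the start at home. Any other window begins at stage t + 1, the
    -- venue of day t, and without a zero it would consist of four consecutive away games.
    · exact ⟨0, by norm_num, by simp [place_zero, I.w_self]⟩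
    · by_contra hne
      push Not at hne
      refine hS.bounded_by_three v t (by omega) false fun k => ?_
      by_contra hk
      refine hne k k.2 ?_
      have := place_home (S := S) (v := v) (t := ⟨t + k, by have := k.2; omega⟩) (by simpa using hk)
      rw [show t + 1 + (k : ℕ) = t + k + 1 by omega, this, I.w_self]

lemma sum_opponents_le {S : Schedule n} {v : Team n} {o : Fin n → Team n}
    (ho : Function.Injective o) (h : ∀ j, ∃ t, S t v = (o j, false)) :
    ∑ j, I.w v (o j) ≤ ∑ t ∈ Finset.range (2 * n), I.w v (place S v (t + 1)) := by
  choose day hday using h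
  have hinj : Function.Injective day := fun a b hab => ho (by
    have h1 := hday a
    rw [hab, hday b] at h1
    exact (Prod.mk.inj h1).1.symm)
  rw [Finset.sum_range]
  calc ∑ j, I.w v (o j) = ∑ j, I.w v (place S v (day j + 1)) :=
        Finset.sum_congr rfl fun j _ => by rw [place_away (hday j)]
    _ = ∑ t ∈ Finset.univ.image day, I.w v (place S v (t + 1)) := by
        rw [Finset.sum_image fun a _ b _ hab => hinj hab]
    _ ≤ _ := Finset.sum_le_sum_of_subset_of_nonneg (Finset.subset_univ _)
        fun _ _ _ => I.w_nonneg _ _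

/-- The total weight of the edges between the leagues. -/
noncomputable def Inst.total : ℝ := ∑ i : Fin n, ∑ j : Fin n, I.w (Sum.inl i) (Sum.inr j)

lemma Inst.total_nonneg : 0 ≤ I.total :=
  Finset.sum_nonneg fun _ _ => Finset.sum_nonneg fun _ _ => I.w_nonneg _ _

/-- Each league contributes half: its teams visit all their opponents, so their itineraries together
have at least two thirds of the total edge weight. -/
lemma Feasible.total_le_weight {S : Schedule n} (hS : Feasible S) :
    4 * I.total ≤ 3 * I.weight S := by
  have hX : ∀ i : Fin n, 2 * ∑ j : Fin n, I.w (Sum.inl i) (Sum.inr j) ≤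
      3 * I.itinerary S (Sum.inl i) := fun i => by
    refine le_trans (mul_le_mul_of_nonneg_left (sum_opponents_le I Sum.inr_injective fun j => ?_)
      (by norm_num)) (hS.two_mul_sum_le_itinerary I (Sum.inl i))
    obtain ⟨t, ht, -⟩ := hS.double_round i j false
    exact ⟨t, ht⟩
  have hY : ∀ j : Fin n, 2 * ∑ i : Fin n, I.w (Sum.inr j) (Sum.inl i) ≤
      3 * I.itinerary S (Sum.inr j) := fun j => by
    refine le_trans (mul_le_mul_of_nonneg_left (sum_opponents_le I Sum.inl_injective fun i => ?_)
      (by norm_num)) (hS.two_mul_sum_le_itinerary I (Sum.inr j))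
    obtain ⟨t, ht, -⟩ := hS.double_round i j true
    refine ⟨t, Prod.ext ?_ ?_⟩
    · have := hS.mutual_opp t (Sum.inl i)
      rwa [ht] at this
    · have := hS.mutual_venue t (Sum.inl i)
      rw [ht] at this
      simpa using this
  have h1 := Finset.sum_le_sum fun i (_ : i ∈ Finset.univ) => hX i
  have h2 := Finset.sum_le_sum fun i (_ : i ∈ Finset.univ) => hY i
  rw [← Finset.mul_sum, ← Finset.mul_sum] at h1 h2
  have hcomm : ∑ j : Fin n, ∑ i : Fin n, I.w (Sum.inr j) (Sum.inl i) = I.total := by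
    rw [Finset.sum_comm]
    exact Finset.sum_congr rfl fun i _ => Finset.sum_congr rfl fun j _ => I.w_symm _ _
  rw [hcomm] at h2
  rw [Inst.weight, Fintype.sum_sum_type]
  change 2 * I.total ≤ _ at h1
  linarith

/-- A feasible schedule is required because the infimum of the empty set is 0 by convention. -/
lemma Inst.total_le_opt (h : ∃ S : Schedule n, Feasible S) : 4 / 3 * I.total ≤ I.opt := by
  obtain ⟨S, hS⟩ := h
  refine le_csInf ⟨_, S, hS, rfl⟩ ?_
  rintro c ⟨S', hS', rfl⟩
  have := hS'.total_le_weight I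
  linarith

/-! ### An upper bound for the length of an itinerary -/

open Classical in
/-- If the opponents of the away games of `v` are listed as `o 0, o 1, …` and each opponent `o j`
with `g j` is visited immediately after `o (j - 1)`, then the itinerary is not longer than that
of a team which returns home between any other two games. -/
lemma Inst.itinerary_le {S : Schedule n} {v : Team n} {o : ℕ → Team n} {day : ℕ → ℕ}
    (hday : ∀ j < n, ∃ h : day j < 2 * n, S ⟨day j, h⟩ v = (o j, false))
    (hex : ∀ t : Fin (2 * n), (S t v).2 = false → ∃ j < n, day j = t)
    (hinj : ∀ j < n, ∀ j' < n, day j = day j' → j = j') {g : ℕ → Prop}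
    (hg : ∀ j, g j → j < n ∧ 1 ≤ j ∧ day j = day (j - 1) + 1) :
    I.itinerary S v ≤ ∑ j ∈ Finset.range n,
      ((if g j then I.w (o (j - 1)) (o j) else I.w v (o j)) +
        (if g (j + 1) then 0 else I.w v (o j))) := by
  set G : ℕ → Prop := fun t => ∃ j, g j ∧ day j = t with hG
  set pl := place S v with hpl
  have hplace : ∀ j < n, pl (day j + 1) = o j := fun j hj => by
    obtain ⟨h, hS⟩ := hday j hj
    exact place_away hS
  -- `G t` says that the venue of day t is reached directly from that of day t − 1. `A t` pays for
  -- the arrival at the venue of day t, and `B t` for the return from the venue of day t − 1, which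
  -- is free in the case `G t`.
  let A : ℕ → ℝ := fun t => if G t then I.w (pl t) (pl (t + 1)) else I.w v (pl (t + 1))
  let B : ℕ → ℝ := fun t => if G t then 0 else I.w v (pl t)
  have hstep : ∀ t, I.w (pl t) (pl (t + 1)) ≤ A t + B t := fun t => by
    simp only [A, B]
    split_ifs
    · simp
    · have := I.w_triangle (pl t) v (pl (t + 1))
      rw [I.w_symm (pl t) v] at this
      linarith
  have hG0 : B 0 = 0 := by
    simp only [B, hpl, place_zero, I.w_self, ite_self]
  have hGlast : A (2 * n) = 0 := by
    have : ¬ G (2 * n) := by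
      rintro ⟨j, hj, hd⟩
      obtain ⟨h, -⟩ := hday j (hg j hj).1
      omega
    simp only [A, if_neg this, hpl, place_last, I.w_self]
  have hhome : ∀ t ∈ Finset.range (2 * n), t ∉ (Finset.range n).image day →
      A t + B (t + 1) = 0 := by
    intro t ht ht'
    have hnot : ∀ j < n, day j ≠ t := fun j hj e =>
      ht' (Finset.mem_image.2 ⟨j, Finset.mem_range.2 hj, e⟩)
    have hv : pl (t + 1) = v := by
      refine place_home (t := ⟨t, Finset.mem_range.1 ht⟩) ?_
      by_contra hf
      obtain ⟨j, hj, e⟩ := hex ⟨t, Finset.mem_range.1 ht⟩ (by simpa using hf)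
      exact hnot j hj e
    have hGt : ¬ G t := by
      rintro ⟨j, hj, e⟩
      exact hnot j (hg j hj).1 e
    simp only [A, B, if_neg hGt, hv, I.w_self, ite_self, add_zero]
  calc I.itinerary S v = ∑ t ∈ Finset.range (2 * n + 1), I.w (pl t) (pl (t + 1)) := rfl
    _ ≤ ∑ t ∈ Finset.range (2 * n + 1), (A t + B t) := Finset.sum_le_sum fun t _ => hstep t
    -- The returns are shifted by one day, so that both summands concern the venue of day t. The
    -- boundary terms vanish since the itinerary begins and ends at home.
    _ = ∑ t ∈ Finset.range (2 * n), (A t + B (t + 1)) := by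
        rw [Finset.sum_add_distrib, Finset.sum_range_succ, hGlast, Finset.sum_range_succ' B, hG0,
          Finset.sum_add_distrib]
        ring
    _ = ∑ t ∈ (Finset.range n).image day, (A t + B (t + 1)) := by
        refine (Finset.sum_subset (fun t ht => ?_) hhome).symm
        obtain ⟨j, hj, rfl⟩ := Finset.mem_image.1 ht
        obtain ⟨h, -⟩ := hday j (Finset.mem_range.1 hj)
        exact Finset.mem_range.2 h
    _ = ∑ j ∈ Finset.range n, (A (day j) + B (day j + 1)) :=
        Finset.sum_image fun a ha b hb e =>
          hinj a (Finset.mem_range.1 ha) b (Finset.mem_range.1 hb) e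
    _ ≤ _ := by
        refine Finset.sum_le_sum fun j hj => ?_
        rw [Finset.mem_range] at hj
        refine add_le_add (le_of_eq ?_) ?_
        · by_cases hgj : g j
          · have hGj : G (day j) := ⟨j, hgj, rfl⟩
            obtain ⟨-, h1, h2⟩ := hg j hgj
            simp only [A, if_pos hGj, if_pos hgj, hplace j hj]
            rw [h2, hplace (j - 1) (by omega)]
          · have hGj : ¬ G (day j) := by
              rintro ⟨j', hj', e⟩
              exact hgj (hinj j' (hg j' hj').1 j hj e ▸ hj')
            simp only [A, if_neg hGj, if_neg hgj, hplace j hj]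
        · by_cases hgj : g (j + 1)
          · have hGj : G (day j + 1) := ⟨j + 1, hgj, (hg _ hgj).2.2⟩
            simp only [B, if_pos hGj, if_pos hgj, le_refl]
          · simp only [B, if_neg hgj, hplace j hj]
            split_ifs
            · exact I.w_nonneg _ _
            · exact le_rfl

end

/-! ### The weight of a schedule of the construction -/

/-- The pairs of paths whose super-teams meet in a left super-game, or which meet at the end of a
normal super-game. -/
def IsBadPair (n d u v : ℕ) : Prop :=
  meetPos (numSuper n d) (u / d) (v / d) < numPairs n d ∨ (u % d + v % d) % d = d - 1

/-- The pairs of labels in the core whose paths do not form a bad pair. -/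
def Glued (n d i j : ℕ) : Prop :=
  i < coreSize n d ∧ j < coreSize n d ∧ ¬ IsBadPair n d (i / 3) (j / 3)

lemma six_mul_add_mod {d c e : ℕ} (h : 6 * (c % d) + e < 6 * d) :
    (6 * c + e) % (6 * d) = 6 * (c % d) + e := by
  conv_lhs => rw [← Nat.div_add_mod c d]
  rw [show 6 * (d * (c / d) + c % d) + e = 6 * d * (c / d) + (6 * (c % d) + e) by ring,
    Nat.mul_add_mod, Nat.mod_eq_of_lt h]

/-! ### Visits to the teams of a path on consecutive days -/

section

variable {n d : ℕ} (H : Admissible n d)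

lemma core_label_div {i k : ℕ} (hk : k < 3 * d) :
    (3 * d * i + k) / 3 / d = i ∧ (3 * d * i + k) / 3 % d = k / 3 := by
  have h1 : (3 * d * i + k) / 3 = d * i + k / 3 := by
    rw [mul_assoc]; omega
  have h2 : k / 3 < d := by omega
  rw [h1, Nat.mul_add_div (by omega), Nat.div_eq_of_lt h2, Nat.mul_add_mod, Nat.mod_eq_of_lt h2]
  exact ⟨rfl, rfl⟩

include H

lemma Glued.exists_eq {i j : ℕ} (hg : Glued n d i j) : ∃ r < numSuper n d, ∃ p,
    numPairs n d ≤ p ∧ p < numSuper n d ∧ ∃ a < d, ∃ a' < 3, ∃ b < d, ∃ b' < 3,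
      i = 3 * d * superX n d p r + (3 * a + a') ∧ j = 3 * d * superY n d p r + (3 * b + b') ∧
      i % 3 = a' ∧ j % 3 = b' ∧ (a + b) % d ≠ d - 1 := by
  obtain ⟨hi, hj, hb⟩ := hg
  rw [coreSize_eq] at hi hj
  obtain ⟨i0, hi0, k, hk, rfl⟩ := exists_mul_add hi
  obtain ⟨j0, hj0, k', hk', rfl⟩ := exists_mul_add hj
  rw [IsBadPair, (core_label_div hk).1, (core_label_div hk).2, (core_label_div hk').1,
    (core_label_div hk').2] at hb
  push Not at hb
  have hm := H.odd_m
  refine ⟨meetSlot (numSuper n d) i0 j0, Nat.mod_lt _ (by omega), meetPos (numSuper n d) i0 j0,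
    hb.1, Nat.mod_lt _ (by omega), k / 3, by omega, k % 3, by omega, k' / 3, by omega, k' % 3,
    by omega, ?_, ?_, ?_, ?_, hb.2⟩
  · rw [superX, meetPos_add_slot hi0 hj0, Nat.div_add_mod]
  · rw [superY, meetPos_add_two_slot hi0 hj0, Nat.div_add_mod]
  · rw [mul_assoc, Nat.mul_add_mod]
  · rw [mul_assoc, Nat.mul_add_mod]

/-- The games of one team with the vertices of the other path are on the days 6((a + b) mod d) + a'
+ b' of the slot. They do not wrap around, so b' − 1 and b' give adjacent days. -/
lemma Glued.exists_consecutive_away {i j : ℕ} (hg : Glued n d i j) (hj : j % 3 ≠ 0) :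
    ∃ t, Game n d t i (j - 1) false ∧ Game n d (t + 1) i j false := by
  obtain ⟨r, hr, p, hp, hp', a, ha, a', ha', b, hb, b', hb', hi, hj', hi3, hj3, hab⟩ :=
    hg.exists_eq H
  have hd : (a + b) % d < d := Nat.mod_lt _ (by omega)
  have e : ∀ c < 3, (6 * (a + b) + a' + c) % (6 * d) = 6 * ((a + b) % d) + (a' + c) :=
    fun c hc => by rw [add_assoc]; exact six_mul_add_mod (by omega)
  have g := Game.normalAway r p a a' b b' hr hp hp' ha ha' hb hb'
  have g' := Game.normalAway r p a a' b (b' - 1) hr hp hp' ha ha' hb (by omega)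
  rw [e _ (by omega)] at g g'
  exact ⟨_, g'.cast rfl hi.symm (by omega) rfl, g.cast (by omega) hi.symm hj'.symm rfl⟩

/-- The offset a' + b' + 3 can be as large as 7 and thus exceed a block of six days. In the last
block this could pass the end of the slot, which is why pairs with (a + b) mod d = d − 1 count as
bad. -/
lemma Glued.exists_consecutive_home {i j : ℕ} (hg : Glued n d i j) (hi : i % 3 ≠ 0) :
    ∃ t, Game n d t (i - 1) j true ∧ Game n d (t + 1) i j true := by
  obtain ⟨r, hr, p, hp, hp', a, ha, a', ha', b, hb, b', hb', hi', hj, hi3, hj3, hab⟩ :=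
    hg.exists_eq H
  have hd : (a + b) % d < d := Nat.mod_lt _ (by omega)
  have e : ∀ c < 3, (6 * (a + b) + c + b' + 3) % (6 * d) = 6 * ((a + b) % d) + (c + b' + 3) :=
    fun c hc => by
      rw [show 6 * (a + b) + c + b' + 3 = 6 * (a + b) + (c + b' + 3) by ring]
      exact six_mul_add_mod (by omega)
  have g := Game.normalHome r p a a' b b' hr hp hp' ha ha' hb hb'
  have g' := Game.normalHome r p a (a' - 1) b b' hr hp hp' ha (by omega) hb hb'
  rw [e _ (by omega)] at g g'
  exact ⟨_, g'.cast rfl (by omega) hj.symm rfl, g.cast (by omega) hi'.symm hj.symm rfl⟩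

end

/-- A labeling as a function on all natural numbers. -/
def extendLabels {n : ℕ} (hn : 0 < n) (x : Fin n → Team n) (i : ℕ) : Team n :=
  x ⟨i % n, Nat.mod_lt _ hn⟩

lemma extendLabels_of_lt {n : ℕ} (hn : 0 < n) (x : Fin n → Team n) {i : ℕ} (hi : i < n) :
    extendLabels hn x i = x ⟨i, hi⟩ := by
  simp only [extendLabels, Nat.mod_eq_of_lt hi]

/-! ### Charging the weight of a schedule to its games -/

section

variable {n : ℕ} (I : Inst n)

open Classical in
/-- The part of the weight which is caused by the game of two labels at the home of `Y j`. -/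
noncomputable def chargeX (d : ℕ) (X Y : ℕ → Team n) (i j : ℕ) : ℝ :=
  (if Glued n d i j ∧ j % 3 ≠ 0 then I.w (Y (j - 1)) (Y j) else I.w (X i) (Y j)) +
    (if Glued n d i (j + 1) ∧ (j + 1) % 3 ≠ 0 then 0 else I.w (X i) (Y j))

open Classical in
/-- The part of the weight which is caused by the game of two labels at the home of `X i`. -/
noncomputable def chargeY (d : ℕ) (X Y : ℕ → Team n) (i j : ℕ) : ℝ :=
  (if Glued n d i j ∧ i % 3 ≠ 0 then I.w (X (i - 1)) (X i) else I.w (X i) (Y j)) +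
    (if Glued n d (i + 1) j ∧ (i + 1) % 3 ≠ 0 then 0 else I.w (X i) (Y j))

variable {d : ℕ} {x y : Fin n → Team n} {S : Schedule n}

lemma IsThreePathSchedule.itinerary_X_le (hS : IsThreePathSchedule d x y S)
    (H : Admissible n d) (hn : 0 < n) {i : ℕ} (hi : i < n) :
    I.itinerary S (extendLabels hn x i) ≤
      ∑ j ∈ Finset.range n, chargeX I d (extendLabels hn x) (extendLabels hn y) i j := by
  have hD : ∀ j, ∃ t, j < n → Game n d t i j false := fun j => by
    by_cases hj : j < n
    · obtain ⟨D, hD, -⟩ := exists_days H hi hj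
      exact ⟨_, fun _ => hD false⟩
    · exact ⟨0, fun h => absurd h hj⟩
  choose day hday using hD
  have := I.itinerary_le (S := S) (v := extendLabels hn x i) (o := extendLabels hn y) (day := day)
    (g := fun j => Glued n d i j ∧ j % 3 ≠ 0) ?_ ?_ ?_ ?_
  · simp only [chargeX]
    convert this
  · intro j hj
    have g := hday j hj
    refine ⟨(g.bounds H).1, ?_⟩
    rw [extendLabels_of_lt hn x hi, extendLabels_of_lt hn y hj]
    exact hS.apply_x (t := ⟨day j, (g.bounds H).1⟩) (i := ⟨i, hi⟩) (j := ⟨j, hj⟩) g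
  · intro t ht
    obtain ⟨L, hL⟩ := exists_game_of_label_X H hi
    obtain ⟨j, hj, g⟩ := hL t t.2
    refine ⟨j, hj, ?_⟩
    rw [extendLabels_of_lt hn x hi,
      hS.apply_x (i := ⟨i, hi⟩) (j := ⟨j, hj⟩) g] at ht
    simp only at ht
    rw [ht] at g
    exact (hday j hj).unique_day H g
  · intro j hj j' hj' e
    have g := hday j hj
    rw [e] at g
    exact (g.unique_X H (hday j' hj')).1
  · rintro j ⟨hg, hj3⟩
    obtain ⟨t, g, g'⟩ := hg.exists_consecutive_away H hj3
    have hj := (g'.bounds H).2.2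
    exact ⟨hj, by omega, by
      rw [(hday j hj).unique_day H g', (hday (j - 1) (by omega)).unique_day H g]⟩

lemma IsThreePathSchedule.itinerary_Y_le (hS : IsThreePathSchedule d x y S)
    (H : Admissible n d) (hn : 0 < n) {j : ℕ} (hj : j < n) :
    I.itinerary S (extendLabels hn y j) ≤
      ∑ i ∈ Finset.range n, chargeY I d (extendLabels hn x) (extendLabels hn y) i j := by
  have hD : ∀ i, ∃ t, i < n → Game n d t i j true := fun i => by
    by_cases hi : i < n
    · obtain ⟨D, hD, -⟩ := exists_days H hi hj
      exact ⟨_, fun _ => hD true⟩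
    · exact ⟨0, fun h => absurd h hi⟩
  choose day hday using hD
  have := I.itinerary_le (S := S) (v := extendLabels hn y j) (o := extendLabels hn x) (day := day)
    (g := fun i => Glued n d i j ∧ i % 3 ≠ 0) ?_ ?_ ?_ ?_
  · simp only [I.w_symm (extendLabels hn y j)] at this
    simp only [chargeY]
    convert this
  · intro i hi
    have g := hday i hi
    refine ⟨(g.bounds H).1, ?_⟩
    rw [extendLabels_of_lt hn x hi, extendLabels_of_lt hn y hj]
    exact hS.apply_y (t := ⟨day i, (g.bounds H).1⟩) (i := ⟨i, hi⟩) (j := ⟨j, hj⟩) g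
  · intro t ht
    obtain ⟨L, hL⟩ := exists_game_of_label_Y H hj
    obtain ⟨i, hi, g⟩ := hL t t.2
    refine ⟨i, hi, ?_⟩
    rw [extendLabels_of_lt hn y hj,
      hS.apply_y (i := ⟨i, hi⟩) (j := ⟨j, hj⟩) g] at ht
    simp only [Bool.not_eq_false'] at ht
    rw [ht] at g
    exact (hday i hi).unique_day H g
  · intro i hi i' hi' e
    have g := hday i hi
    rw [e] at g
    exact (g.unique_Y H (hday i' hi')).1
  · rintro i ⟨hg, hi3⟩
    obtain ⟨t, g, g'⟩ := hg.exists_consecutive_home H hi3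
    have hi := (g'.bounds H).2.1
    exact ⟨hi, by omega, by
      rw [(hday i hi).unique_day H g', (hday (i - 1) (by omega)).unique_day H g]⟩

lemma LeagueLabels.sum_team (hxy : LeagueLabels x y) (f : Team n → ℝ) :
    ∑ v, f v = ∑ i, f (x i) + ∑ j, f (y j) := by
  have hb : Function.Bijective (Sum.elim x y) := by
    constructor
    · rintro (a | a) (b | b) h
      · rw [hxy.x_inj h]
      · exact absurd h (hxy.x_ne_y _ _)
      · exact absurd h.symm (hxy.x_ne_y _ _)
      · rw [hxy.y_inj h]
    · intro v
      rcases hxy.cases v with ⟨i, rfl⟩ | ⟨j, rfl⟩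
      · exact ⟨Sum.inl i, rfl⟩
      · exact ⟨Sum.inr j, rfl⟩
  rw [← (Equiv.ofBijective _ hb).sum_comp, Fintype.sum_sum_type]
  rfl

lemma sum_extendLabels (hn : 0 < n) (x : Fin n → Team n) (f : Team n → ℝ) :
    ∑ i ∈ Finset.range n, f (extendLabels hn x i) = ∑ i, f (x i) := by
  rw [Finset.sum_range]
  exact Finset.sum_congr rfl fun i _ => by rw [extendLabels_of_lt hn x i.2]

lemma IsThreePathSchedule.weight_le (hS : IsThreePathSchedule d x y S)
    (hxy : LeagueLabels x y) (H : Admissible n d) (hn : 0 < n) :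
    I.weight S ≤ ∑ i ∈ Finset.range n, ∑ j ∈ Finset.range n,
      (chargeX I d (extendLabels hn x) (extendLabels hn y) i j +
        chargeY I d (extendLabels hn x) (extendLabels hn y) i j) := by
  rw [Inst.weight, hxy.sum_team, ← sum_extendLabels hn x, ← sum_extendLabels hn y]
  simp only [Finset.sum_add_distrib]
  refine add_le_add ?_ ?_
  · exact Finset.sum_le_sum fun i hi => hS.itinerary_X_le I H hn (Finset.mem_range.1 hi)
  · rw [Finset.sum_comm]
    exact Finset.sum_le_sum fun i hi => hS.itinerary_Y_le I H hn (Finset.mem_range.1 hi)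

/-- Each of the two games of the pair pays for at most one trip from home and one back. -/
lemma charge_le_of_not_glued {X Y : ℕ → Team n} {i j : ℕ} (h : ¬ Glued n d i j) :
    chargeX I d X Y i j + chargeY I d X Y i j ≤ 4 * I.w (X i) (Y j) := by
  have h0 := I.w_nonneg (X i) (Y j)
  have h1 : ∀ p : Prop, ¬ (Glued n d i j ∧ p) := fun p h' => h h'.1
  rw [chargeX, chargeY, if_neg (h1 _), if_neg (h1 _)]
  split_ifs <;> linarith

/-- The cost of the itineraries between two paths, if each path is visited in one trip. -/
noncomputable def mainCharge (p q : Fin 3 → Team n) : ℝ :=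
  ∑ c, (I.w (p c) (q 0) + I.w (p c) (q 2)) + 3 * (I.w (q 0) (q 1) + I.w (q 1) (q 2)) +
    (∑ c, (I.w (q c) (p 0) + I.w (q c) (p 2)) + 3 * (I.w (p 0) (p 1) + I.w (p 1) (p 2)))

/-- The weight of the edges between two paths. -/
noncomputable def crossWeight (p q : Fin 3 → Team n) : ℝ := ∑ c, ∑ e, I.w (p c) (q e)

lemma mainCharge_nonneg (p q : Fin 3 → Team n) : 0 ≤ mainCharge I p q := by
  have := I.w_nonneg
  unfold mainCharge
  have h1 := this (q 0) (q 1)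
  have h2 := this (q 1) (q 2)
  have h3 := this (p 0) (p 1)
  have h4 := this (p 1) (p 2)
  have h5 : 0 ≤ ∑ c, (I.w (p c) (q 0) + I.w (p c) (q 2)) :=
    Finset.sum_nonneg fun c _ => add_nonneg (this _ _) (this _ _)
  have h6 : 0 ≤ ∑ c, (I.w (q c) (p 0) + I.w (q c) (p 2)) :=
    Finset.sum_nonneg fun c _ => add_nonneg (this _ _) (this _ _)
  linarith

-- For a good pair every team of one path visits the other path in one trip: the first vertex is
-- charged the arrival, the second one the first edge, the third one the second edge and the return.
-- This is exactly `mainCharge`. For a bad pair the main charge is kept as nonnegative slack, so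
-- that the sum of the main charges runs over all pairs and does not depend on the labeling.
open Classical in
lemma sum_charge_le {X Y : ℕ → Team n} {K u v : ℕ} (hK : coreSize n d = 3 * K) (hu : u < K)
    (hv : v < K) :
    ∑ c : Fin 3, ∑ e : Fin 3, (chargeX I d X Y (3 * u + c) (3 * v + e) +
      chargeY I d X Y (3 * u + c) (3 * v + e)) ≤
      mainCharge I (fun c => X (3 * u + c)) (fun e => Y (3 * v + e)) +
        (if IsBadPair n d u v then
          4 * crossWeight I (fun c => X (3 * u + c)) (fun e => Y (3 * v + e)) else 0) := by
  have hdiv : ∀ w c : ℕ, c < 3 → (3 * w + c) / 3 = w := by omega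
  have hmod : ∀ w c : ℕ, c < 3 → (3 * w + c) % 3 = c := by omega
  have hglue : ∀ c e : ℕ, c < 3 → e < 3 →
      (Glued n d (3 * u + c) (3 * v + e) ↔ ¬ IsBadPair n d u v) := fun c e hc he => by
    rw [Glued, hdiv _ _ hc, hdiv _ _ he, hK]
    exact ⟨fun h => h.2.2, fun h => ⟨by omega, by omega, h⟩⟩
  by_cases hb : IsBadPair n d u v
  · rw [if_pos hb, crossWeight]
    simp only [Finset.mul_sum]
    refine le_trans (Finset.sum_le_sum fun c _ => Finset.sum_le_sum fun e _ =>
      charge_le_of_not_glued I (by rw [hglue c e c.2 e.2]; exact not_not.2 hb)) ?_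
    have := mainCharge_nonneg I (fun c : Fin 3 => X (3 * u + c)) (fun e : Fin 3 => Y (3 * v + e))
    linarith
  · rw [if_neg hb, add_zero]
    have g : ∀ c e : ℕ, c < 3 → e < 3 → Glued n d (3 * u + c) (3 * v + e) :=
      fun c e hc he => (hglue c e hc he).2 hb
    have cX0 : ∀ c < 3, chargeX I d X Y (3 * u + c) (3 * v) = I.w (X (3 * u + c)) (Y (3 * v)) :=
      fun c hc => by
        have := g c 1 hc (by norm_num)
        rw [chargeX, if_neg (by omega), if_pos ⟨this, by omega⟩, add_zero]
    have cX1 : ∀ c < 3, chargeX I d X Y (3 * u + c) (3 * v + 1) =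
        I.w (Y (3 * v)) (Y (3 * v + 1)) := fun c hc => by
      rw [chargeX, if_pos ⟨g c 1 hc (by norm_num), by omega⟩,
        if_pos ⟨g c 2 hc (by norm_num), by omega⟩, add_zero, Nat.add_sub_cancel]
    have cX2 : ∀ c < 3, chargeX I d X Y (3 * u + c) (3 * v + 2) =
        I.w (Y (3 * v + 1)) (Y (3 * v + 2)) + I.w (X (3 * u + c)) (Y (3 * v + 2)) :=
      fun c hc => by
        rw [chargeX, if_pos ⟨g c 2 hc (by norm_num), by omega⟩, if_neg (by omega)]
        rfl
    have cY0 : ∀ c < 3, chargeY I d X Y (3 * u) (3 * v + c) = I.w (X (3 * u)) (Y (3 * v + c)) :=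
      fun c hc => by
        have := g 1 c (by norm_num) hc
        rw [chargeY, if_neg (by omega), if_pos ⟨this, by omega⟩, add_zero]
    have cY1 : ∀ c < 3, chargeY I d X Y (3 * u + 1) (3 * v + c) =
        I.w (X (3 * u)) (X (3 * u + 1)) := fun c hc => by
      rw [chargeY, if_pos ⟨g 1 c (by norm_num) hc, by omega⟩,
        if_pos ⟨g 2 c (by norm_num) hc, by omega⟩, add_zero, Nat.add_sub_cancel]
    have cY2 : ∀ c < 3, chargeY I d X Y (3 * u + 2) (3 * v + c) =
        I.w (X (3 * u + 1)) (X (3 * u + 2)) + I.w (X (3 * u + 2)) (Y (3 * v + c)) :=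
      fun c hc => by
        rw [chargeY, if_pos ⟨g 2 c (by norm_num) hc, by omega⟩, if_neg (by omega)]
        rfl
    refine le_of_eq ?_
    simp only [Finset.sum_add_distrib, mainCharge]
    rw [Finset.sum_comm (f := fun c e : Fin 3 => chargeY I d X Y _ _)]
    simp only [Fin.sum_univ_three, Fin.val_zero, Fin.val_one, Fin.val_two, add_zero]
    have z := cX0 0 (by norm_num)
    have z' := cY0 0 (by norm_num)
    have z1 := cX1 0 (by norm_num)
    have z1' := cY1 0 (by norm_num)
    have z2 := cX2 0 (by norm_num)
    have z2' := cY2 0 (by norm_num)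
    rw [add_zero] at z z' z1 z1' z2 z2'
    rw [z, z', z1, z1', z2, z2', cX0 1 (by norm_num), cX0 2 (by norm_num), cX1 1 (by norm_num),
      cX1 2 (by norm_num), cX2 1 (by norm_num), cX2 2 (by norm_num),
      cY0 1 (by norm_num), cY0 2 (by norm_num), cY1 1 (by norm_num),
      cY1 2 (by norm_num), cY2 1 (by norm_num), cY2 2 (by norm_num)]
    simp only [I.w_symm (Y _) (X _)]
    ring

end

/-! ### The expected weight -/

section

variable {n : ℕ}

lemma leagueX_eq (n : ℕ) : leagueX n = Finset.univ.image Sum.inl := by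
  ext v; cases v <;> simp [leagueX]

lemma leagueY_eq (n : ℕ) : leagueY n = Finset.univ.image Sum.inr := by
  ext v; cases v <;> simp [leagueY]

lemma card_leagueX (n : ℕ) : (leagueX n).card = n := by
  rw [leagueX_eq, Finset.card_image_of_injective _ Sum.inl_injective, Finset.card_univ,
    Fintype.card_fin]

lemma card_leagueY (n : ℕ) : (leagueY n).card = n := by
  rw [leagueY_eq, Finset.card_image_of_injective _ Sum.inr_injective, Finset.card_univ,
    Fintype.card_fin]

lemma sum_of_labels {L : Finset (Team n)} (hL : L.card = n) {x : Fin n → Team n}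
    (hinj : Function.Injective x) (hmem : ∀ i, x i ∈ L) (f : Team n → ℝ) :
    ∑ i, f (x i) = ∑ v ∈ L, f v := by
  have : Finset.univ.image x = L := by
    refine Finset.eq_of_subset_of_card_le (fun v hv => ?_) ?_
    · obtain ⟨i, -, rfl⟩ := Finset.mem_image.1 hv
      exact hmem i
    · rw [Finset.card_image_of_injective _ hinj, Finset.card_univ, Fintype.card_fin, hL]
  rw [← this, Finset.sum_image fun a _ b _ h => hinj h]

lemma Packing.sum_eq {k : ℕ} {A : Finset (Team n)} (P : Packing k A) (f : Team n → ℝ) :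
    ∑ p, ∑ c, f (P.vtx p c) = ∑ v ∈ A, f v := by
  have : Finset.univ.image (fun a : Fin k × Fin 3 => P.vtx a.1 a.2) = A := by
    ext v
    rw [P.covers v]
    simp
  have e : ∑ v ∈ A, f v = ∑ v ∈ Finset.univ.image (fun a : Fin k × Fin 3 => P.vtx a.1 a.2), f v := by
    rw [this]
  rw [e, Finset.sum_image, ← Finset.univ_product_univ, Finset.sum_product]
  rintro ⟨a, b⟩ _ ⟨a', b'⟩ _ h
  obtain ⟨h1, h2⟩ := P.disjoint _ _ _ _ h
  exact Prod.ext h1 h2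

/-- The average cost outside of A is at most the average cost in A: summing `cost b ≤ cost a` over
all pairs gives k · out ≤ (n − k) · in, and (n − k) · out is added to both sides. -/
lemma IsTop.mul_sum_sub_le {L A : Finset (Team n)} {cost : Team n → ℝ} {k : ℕ}
    (h : IsTop L cost k A) (hL : L.card = n) :
    n * (∑ v ∈ L, cost v - ∑ v ∈ A, cost v) ≤ (n - k) * ∑ v ∈ L, cost v := by
  obtain ⟨hsub, hcard, htop⟩ := h
  have hsd : ∑ v ∈ L \ A, cost v + ∑ v ∈ A, cost v = ∑ v ∈ L, cost v :=
    Finset.sum_sdiff hsub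
  have hc : ((L \ A).card : ℝ) = n - k := by
    rw [Finset.card_sdiff_of_subset hsub, hL, hcard, Nat.cast_sub]
    rw [← hL, ← hcard]; exact Finset.card_le_card hsub
  have key : ∑ b ∈ L \ A, ∑ _a ∈ A, cost b ≤ ∑ _b ∈ L \ A, ∑ a ∈ A, cost a :=
    Finset.sum_le_sum fun b hb => Finset.sum_le_sum fun a ha =>
      htop a ha b (Finset.mem_sdiff.1 hb).1 (Finset.mem_sdiff.1 hb).2
  simp only [Finset.sum_const, nsmul_eq_mul, hcard, hc] at key
  rw [← Finset.mul_sum] at key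
  rw [← hsd]
  nlinarith [key]

/-- Composing with the swap of two points shows that the sum over σ is the same at each point;
summed over all points, every σ contributes the full sum of f. -/
lemma sum_perm_apply {K : ℕ} (f : Fin K → ℝ) (u : Fin K) :
    K * ∑ σ : Equiv.Perm (Fin K), f (σ u) = Fintype.card (Equiv.Perm (Fin K)) * ∑ a, f a := by
  have hc : ∀ u', ∑ σ : Equiv.Perm (Fin K), f (σ u') = ∑ σ : Equiv.Perm (Fin K), f (σ u) :=
    fun u' => by
      rw [← Equiv.sum_comp (Equiv.mulRight (Equiv.swap u u'))]
      exact Finset.sum_congr rfl fun σ _ => by simp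
  calc (K : ℝ) * ∑ σ : Equiv.Perm (Fin K), f (σ u)
      = ∑ u', ∑ σ : Equiv.Perm (Fin K), f (σ u') := by
        rw [Finset.sum_congr rfl fun u' _ => hc u']
        simp
    _ = ∑ σ : Equiv.Perm (Fin K), ∑ u', f (σ u') := Finset.sum_comm
    _ = ∑ σ : Equiv.Perm (Fin K), ∑ a, f a :=
        Finset.sum_congr rfl fun σ _ => Equiv.sum_comp σ f
    _ = _ := by simp

lemma sum_perms_apply {K : ℕ} (f : Fin K → Fin K → ℝ) (u v : Fin K) :
    (K : ℝ) ^ 2 * ∑ ω : Perms K, f (ω.1 u) (ω.2 v) =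
      Fintype.card (Perms K) * ∑ a, ∑ b, f a b := by
  rw [Fintype.sum_prod_type]
  have h1 : ∀ σ : Equiv.Perm (Fin K), (K : ℝ) * ∑ τ : Equiv.Perm (Fin K), f (σ u) (τ v) =
      Fintype.card (Equiv.Perm (Fin K)) * ∑ b, f (σ u) b := fun σ => sum_perm_apply _ v
  have h2 := sum_perm_apply (fun a => ∑ b, f a b) u
  rw [pow_two, mul_assoc, Finset.mul_sum Finset.univ _ (K : ℝ),
    Finset.sum_congr rfl fun σ _ => h1 σ, ← Finset.mul_sum, mul_left_comm, h2, Fintype.card_prod]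
  push_cast
  ring

end

/-! ### The number of bad pairs of paths -/

section

variable {n d : ℕ}

lemma meetPos_inj {m i j j' : ℕ} (hj : j < m) (hj' : j' < m)
    (h : meetPos m i j = meetPos m i j') : j = j' := by
  have e : ∀ j < m, (meetPos m i j + j) ≡ 2 * i + m [MOD m] := fun j hj => by
    rw [meetPos, Nat.ModEq, Nat.mod_add_mod, show 2 * i + m - j + j = 2 * i + m by omega]
  have h2 := (e j hj).trans (e j' hj').symm
  rw [h] at h2
  have := Nat.ModEq.add_left_cancel' _ h2
  rwa [Nat.ModEq, Nat.mod_eq_of_lt hj, Nat.mod_eq_of_lt hj'] at this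

-- For a fixed X-super-team the meeting position determines the Y-super-team, so left meetings
-- concern at most l super-teams of d paths. The condition on the end of the slot fixes a remainder
-- modulo d, which leaves at most one path in each of the m super-teams.
open Classical in
lemma card_bad_le (H : Admissible n d) (u : ℕ) :
    (Finset.univ.filter fun v : Fin (numSuper n d * d) => IsBadPair n d u v).card ≤
      numPairs n d * d + numSuper n d := by
  have hd := H.six_le
  have hdiv : ∀ w < numSuper n d * d, w / d < numSuper n d := fun w hw =>
    Nat.div_lt_of_lt_mul (by rwa [mul_comm])
  refine le_trans (Finset.card_le_card (t := (Finset.univ.filter fun v : Fin (numSuper n d * d) =>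
    meetPos (numSuper n d) (u / d) (v / d) < numPairs n d) ∪
    (Finset.univ.filter fun v : Fin (numSuper n d * d) => (u % d + v % d) % d = d - 1))
    fun v hv => by simpa [IsBadPair] using hv) ?_
  refine le_trans (Finset.card_union_le _ _) (add_le_add ?_ ?_)
  · have e : numPairs n d * d = (Finset.range (numPairs n d) ×ˢ Finset.range d).card := by simp
    rw [e]
    refine Finset.card_le_card_of_injOn
      (fun v => (meetPos (numSuper n d) (u / d) (v / d), (v : ℕ) % d)) (fun v hv => ?_) ?_
    · simp only [Finset.coe_filter, Finset.mem_univ, true_and, Set.mem_ofPred_eq] at hv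
      simp only [Finset.coe_product, Finset.coe_range, Set.mem_prod, Set.mem_Iio]
      exact ⟨hv, Nat.mod_lt _ (by omega)⟩
    · intro v _ v' _ h
      simp only [Prod.mk.injEq] at h
      have := meetPos_inj (hdiv v v.2) (hdiv v' v'.2) h.1
      exact Fin.ext (by rw [← Nat.div_add_mod (v : ℕ) d, ← Nat.div_add_mod (v' : ℕ) d, this, h.2])
  · conv_rhs => rw [← Finset.card_range (numSuper n d)]
    refine Finset.card_le_card_of_injOn (fun v => (v : ℕ) / d) (fun v _ => ?_) ?_
    · simpa using hdiv v v.2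
    · intro v hv v' hv' h
      simp only [Finset.coe_filter, Finset.mem_univ, true_and, Set.mem_ofPred_eq] at hv hv'
      have h2 : u % d + v % d ≡ u % d + v' % d [MOD d] := by rw [Nat.ModEq, hv, hv']
      have h3 := Nat.ModEq.add_left_cancel' _ h2
      rw [Nat.ModEq, Nat.mod_mod, Nat.mod_mod] at h3
      simp only at h
      exact Fin.ext (by rw [← Nat.div_add_mod (v : ℕ) d, ← Nat.div_add_mod (v' : ℕ) d, h, h3])

end

/-! ### Averaging over the random orders -/

section

variable {n d : ℕ} (I : Inst n)

lemma mainCharge_comm (p q : Fin 3 → Team n) : mainCharge I p q = mainCharge I q p := by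
  rw [mainCharge, mainCharge, add_comm]

/-- The directions of the paths may depend on the random orders; invariance of the main charge and
of the cross weight under reversal removes them from the estimate. -/
lemma mainCharge_rev (p q : Fin 3 → Team n) :
    mainCharge I (fun c => p c.rev) q = mainCharge I p q := by
  have h0 : Fin.rev (0 : Fin 3) = 2 := rfl
  have h1 : Fin.rev (1 : Fin 3) = 1 := rfl
  have h2 : Fin.rev (2 : Fin 3) = 0 := rfl
  simp only [mainCharge, Fin.sum_univ_three, h0, h1, h2]
  rw [I.w_symm (p 2) (p 1), I.w_symm (p 1) (p 0)]
  ring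

lemma crossWeight_rev_left (p q : Fin 3 → Team n) :
    crossWeight I (fun c => p c.rev) q = crossWeight I p q := by
  rw [crossWeight, crossWeight]
  exact Equiv.sum_comp Fin.revPerm (fun c => ∑ e, I.w (p c) (q e))

lemma crossWeight_rev_right (p q : Fin 3 → Team n) :
    crossWeight I p (fun c => q c.rev) = crossWeight I p q := by
  rw [crossWeight, crossWeight]
  exact Finset.sum_congr rfl fun c _ => Equiv.sum_comp Fin.revPerm (fun e => I.w (p c) (q e))

lemma IsLabeling.path_eq {k : ℕ} {A L : Finset (Team n)} {P : Packing k A}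
    {σ : Equiv.Perm (Fin k)} {x : Fin n → Team n} (h : IsLabeling L P σ x) (hk : 3 * k ≤ n)
    (hn : 0 < n) (u : Fin k) :
    (fun c : Fin 3 => extendLabels hn x (3 * u + c)) = P.vtx (σ u) ∨
    (fun c : Fin 3 => extendLabels hn x (3 * u + c)) = fun c => P.vtx (σ u) c.rev := by
  have hlt : ∀ c : Fin 3, 3 * (u : ℕ) + c < n := fun c => by have := c.2; have := u.2; omega
  refine (h.paths u).imp (fun h => funext fun c => ?_) (fun h => funext fun c => ?_) <;>
    rw [extendLabels_of_lt hn x (hlt c)] <;> exact h c _ rfl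

/-- The total of the main charges is the main term of the bound on the expected weight. -/
lemma sum_mainCharge {k : ℕ} {A B : Finset (Team n)} (P : Packing k A) (Q : Packing k B) :
    ∑ p, ∑ q, mainCharge I (P.vtx p) (Q.vtx q) =
      P.delta I B + ((3 * k : ℕ) : ℝ) * P.weight I + Q.delta I A +
        ((3 * k : ℕ) : ℝ) * Q.weight I := by
  have hdelta : ∀ {A B : Finset (Team n)} (P : Packing k A) (Q : Packing k B),
      ∑ p, ∑ q, ∑ c, (I.w (Q.vtx q c) (P.vtx p 0) + I.w (Q.vtx q c) (P.vtx p 2)) =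
        P.delta I B := by
    intro A B P Q
    refine Finset.sum_congr rfl fun p _ => ?_
    rw [Q.sum_eq (fun v => I.w v (P.vtx p 0) + I.w v (P.vtx p 2)), Finset.sum_add_distrib,
      Inst.delta, Inst.delta]
    simp only [I.w_symm _ (P.vtx p _)]
  have e1 := hdelta P Q
  have e2 := hdelta Q P
  rw [Finset.sum_comm] at e2
  simp only [mainCharge, Finset.sum_add_distrib] at e1 e2 ⊢
  simp only [← Finset.mul_sum, Finset.sum_const, Finset.card_univ, Fintype.card_fin, nsmul_eq_mul,
    Packing.weight, Finset.sum_add_distrib] at e1 e2 ⊢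
  push_cast
  rw [← e1, ← e2]
  ring

lemma sum_range_three_mul (f : ℕ → ℝ) (K : ℕ) :
    ∑ i ∈ Finset.range (3 * K), f i = ∑ u ∈ Finset.range K, ∑ c : Fin 3, f (3 * u + c) := by
  induction K with
  | zero => simp
  | succ K ih =>
    rw [Finset.sum_range_succ, ← ih, show 3 * (K + 1) = 3 * K + 1 + 1 + 1 by ring]
    simp [Finset.sum_range_succ, Fin.sum_univ_three, add_assoc]

lemma sum_range_core (H : Admissible n d) (f : ℕ → ℝ) :
    ∑ i ∈ Finset.range n, f i = ∑ i ∈ Finset.range (coreSize n d), f i +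
      ∑ p ∈ Finset.range (numPairs n d), f (coreSize n d + p) := by
  rw [← Finset.sum_range_add, H.core_add]

lemma IsLabeling.sum_core {k : ℕ} {A L : Finset (Team n)} {P : Packing k A}
    {σ : Equiv.Perm (Fin k)} {x : Fin n → Team n} (h : IsLabeling L P σ x) (hk : 3 * k ≤ n)
    (hn : 0 < n) (f : Team n → ℝ) :
    ∑ i ∈ Finset.range (3 * k), f (extendLabels hn x i) = ∑ v ∈ A, f v := by
  rw [sum_range_three_mul, Finset.sum_range, ← P.sum_eq,
    ← Equiv.sum_comp σ (fun p => ∑ c, f (P.vtx p c))]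
  refine Finset.sum_congr rfl fun u _ => ?_
  rcases h.path_eq hk hn u with e | e
  · exact Finset.sum_congr rfl fun c _ => congrArg f (congrFun e c)
  · rw [← Equiv.sum_comp Fin.revPerm (fun c => f (P.vtx (σ u) c))]
    exact Finset.sum_congr rfl fun c _ => congrArg f (congrFun e c)

lemma coreSize_eq_three_mul (n d : ℕ) : coreSize n d = 3 * (numSuper n d * d) := by
  rw [coreSize, mul_assoc]

lemma IsLabeling.leagueLabels {k : ℕ} {A B : Finset (Team n)} {P : Packing k A} {Q : Packing k B}
    {σ τ : Equiv.Perm (Fin k)} {x y : Fin n → Team n} (hx : IsLabeling (leagueX n) P σ x)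
    (hy : IsLabeling (leagueY n) Q τ y) : LeagueLabels x y :=
  ⟨hx.inj, hx.mem, hy.inj, hy.mem⟩

open Classical in
/-- The weight of a schedule of the construction: the main term does not depend on the labeling. -/
lemma IsThreePathSchedule.weight_le_main {A B : Finset (Team n)} {K : ℕ}
    (hK : K = numSuper n d * d) {P : Packing K A} {Q : Packing K B}
    {σ τ : Equiv.Perm (Fin K)} {x y : Fin n → Team n} {S : Schedule n}
    (hS : IsThreePathSchedule d x y S) (H : Admissible n d) (hn : 0 < n)
    (hx : IsLabeling (leagueX n) P σ x) (hy : IsLabeling (leagueY n) Q τ y) :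
    I.weight S ≤ ∑ p, ∑ q, mainCharge I (P.vtx p) (Q.vtx q) +
      ∑ u : Fin K, ∑ v : Fin K,
        (if IsBadPair n d u v then 4 * crossWeight I (P.vtx (σ u)) (Q.vtx (τ v)) else 0) +
      (4 * (∑ v ∈ leagueX n, I.delta (leagueY n) v - ∑ v ∈ A, I.delta (leagueY n) v) +
       4 * (∑ v ∈ leagueY n, I.delta (leagueX n) v - ∑ v ∈ B, I.delta (leagueX n) v)) := by
  set X := extendLabels hn x with hX
  set Y := extendLabels hn y with hY
  have hcore : coreSize n d = 3 * K := by rw [hK, coreSize_eq_three_mul]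
  have hKn : 3 * K ≤ n := by rw [← hcore]; have := H.core_add; omega
  have hXcore : ∀ f : Team n → ℝ, ∑ p ∈ Finset.range (numPairs n d), f (X (coreSize n d + p)) =
      ∑ v ∈ leagueX n, f v - ∑ v ∈ A, f v := fun f => by
    rw [← hx.sum_core hKn hn f, ← sum_of_labels (card_leagueX n) hx.inj hx.mem f,
      ← sum_extendLabels hn x f, sum_range_core H, hcore]
    ring
  have hYcore : ∀ f : Team n → ℝ, ∑ p ∈ Finset.range (numPairs n d), f (Y (coreSize n d + p)) =
      ∑ v ∈ leagueY n, f v - ∑ v ∈ B, f v := fun f => by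
    rw [← hy.sum_core hKn hn f, ← sum_of_labels (card_leagueY n) hy.inj hy.mem f,
      ← sum_extendLabels hn y f, sum_range_core H, hcore]
    ring
  set F : ℕ → ℕ → ℝ := fun i j => chargeX I d X Y i j + chargeY I d X Y i j with hF
  have hout : ∀ i j, coreSize n d ≤ i ∨ coreSize n d ≤ j → F i j ≤ 4 * I.w (X i) (Y j) :=
    fun i j h => charge_le_of_not_glued I fun hg => by
      have h1 := hg.1
      have h2 := hg.2.1
      omega
  have hdY : ∀ v, ∑ j ∈ Finset.range n, I.w v (Y j) = I.delta (leagueY n) v := fun v => by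
    rw [sum_extendLabels hn y (fun u => I.w v u), sum_of_labels (card_leagueY n) hy.inj hy.mem]
    rfl
  have hdX : ∀ v, ∑ i ∈ Finset.range n, I.w (X i) v = I.delta (leagueX n) v := fun v => by
    rw [sum_extendLabels hn x (fun u => I.w u v),
      sum_of_labels (card_leagueX n) hx.inj hx.mem (fun u => I.w u v)]
    exact Finset.sum_congr rfl fun u _ => I.w_symm _ _
  -- No game of a team outside of the core is glued. The X-teams outside are charged for all
  -- opponents, so that the Y-teams outside remain to be charged only for opponents in the core.
  have h1 : ∑ p ∈ Finset.range (numPairs n d), ∑ j ∈ Finset.range n, F (coreSize n d + p) j ≤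
      4 * (∑ v ∈ leagueX n, I.delta (leagueY n) v - ∑ v ∈ A, I.delta (leagueY n) v) := by
    rw [← hXcore, Finset.mul_sum]
    refine Finset.sum_le_sum fun p _ => ?_
    rw [← hdY, Finset.mul_sum]
    exact Finset.sum_le_sum fun j _ => hout _ _ (Or.inl (by omega))
  have h2 : ∑ i ∈ Finset.range (coreSize n d), ∑ p ∈ Finset.range (numPairs n d),
      F i (coreSize n d + p) ≤
      4 * (∑ v ∈ leagueY n, I.delta (leagueX n) v - ∑ v ∈ B, I.delta (leagueX n) v) := by
    rw [← hYcore, Finset.mul_sum, Finset.sum_comm]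
    refine Finset.sum_le_sum fun p _ => ?_
    rw [← hdX, Finset.mul_sum]
    refine le_trans (Finset.sum_le_sum fun i _ => hout _ _ (Or.inr (by omega))) ?_
    exact Finset.sum_le_sum_of_subset_of_nonneg
      (Finset.range_subset_range.2 (by have := H.core_add; omega))
      fun _ _ _ => mul_nonneg (by norm_num) (I.w_nonneg _ _)
  have hmain : ∀ u v : Fin K, mainCharge I (fun c : Fin 3 => X (3 * u + c))
      (fun c : Fin 3 => Y (3 * v + c)) = mainCharge I (P.vtx (σ u)) (Q.vtx (τ v)) := by
    intro u v
    have h1 : ∀ q, mainCharge I (fun c : Fin 3 => X (3 * u + c)) q =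
        mainCharge I (P.vtx (σ u)) q := fun q => by
      rcases hx.path_eq hKn hn u with e | e
      · rw [e]
      · rw [e, mainCharge_rev]
    rw [h1]
    rcases hy.path_eq hKn hn v with e | e
    · rw [e]
    · rw [e, mainCharge_comm, mainCharge_rev, mainCharge_comm]
  have hcross : ∀ u v : Fin K, crossWeight I (fun c : Fin 3 => X (3 * u + c))
      (fun c : Fin 3 => Y (3 * v + c)) = crossWeight I (P.vtx (σ u)) (Q.vtx (τ v)) := by
    intro u v
    rcases hx.path_eq hKn hn u with e | e <;> rcases hy.path_eq hKn hn v with e' | e' <;>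
      rw [e, e'] <;> simp only [crossWeight_rev_left, crossWeight_rev_right]
  have h3 : ∑ i ∈ Finset.range (coreSize n d), ∑ j ∈ Finset.range (coreSize n d), F i j ≤
      ∑ p, ∑ q, mainCharge I (P.vtx p) (Q.vtx q) +
      ∑ u : Fin K, ∑ v : Fin K,
        (if IsBadPair n d u v then 4 * crossWeight I (P.vtx (σ u)) (Q.vtx (τ v)) else 0) := by
    -- A sum over all pairs of paths is not changed by the orders σ and τ, so the main term is the
    -- same for every outcome.
    have e : ∑ p, ∑ q, mainCharge I (P.vtx p) (Q.vtx q) =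
        ∑ u, ∑ v, mainCharge I (P.vtx (σ u)) (Q.vtx (τ v)) := by
      rw [← Equiv.sum_comp σ]
      exact Finset.sum_congr rfl fun u _ => (Equiv.sum_comp τ _).symm
    rw [e, hcore, ← Finset.sum_add_distrib, sum_range_three_mul, Finset.sum_range]
    refine Finset.sum_le_sum fun u _ => ?_
    have : ∀ c : Fin 3, ∑ j ∈ Finset.range (3 * K), F (3 * u + c) j =
        ∑ v : Fin K, ∑ e : Fin 3, F (3 * u + c) (3 * v + e) := fun c => by
      rw [sum_range_three_mul, Finset.sum_range]
    rw [Finset.sum_congr rfl fun c _ => this c, Finset.sum_comm, ← Finset.sum_add_distrib]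
    refine Finset.sum_le_sum fun v _ => ?_
    rw [← hmain, ← hcross]
    exact sum_charge_le I hcore u.2 v.2
  refine le_trans (hS.weight_le I (hx.leagueLabels hy) H hn) ?_
  have h4 : ∑ i ∈ Finset.range n, ∑ j ∈ Finset.range n, F i j =
      ∑ i ∈ Finset.range (coreSize n d), ∑ j ∈ Finset.range (coreSize n d), F i j +
      ∑ i ∈ Finset.range (coreSize n d), ∑ p ∈ Finset.range (numPairs n d),
        F i (coreSize n d + p) +
      ∑ p ∈ Finset.range (numPairs n d), ∑ j ∈ Finset.range n, F (coreSize n d + p) j := by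
    rw [sum_range_core H, ← Finset.sum_add_distrib]
    congr 1
    exact Finset.sum_congr rfl fun i _ => sum_range_core H _
  change ∑ i ∈ Finset.range n, ∑ j ∈ Finset.range n, F i j ≤ _
  rw [h4]
  linarith

lemma sum_delta_leagueX : ∑ v ∈ leagueX n, I.delta (leagueY n) v = I.total := by
  rw [leagueX_eq, leagueY_eq, Finset.sum_image fun a _ b _ h => Sum.inl_injective h]
  refine Finset.sum_congr rfl fun i _ => ?_
  rw [Inst.delta, Finset.sum_image fun a _ b _ h => Sum.inr_injective h]

lemma sum_delta_leagueY : ∑ v ∈ leagueY n, I.delta (leagueX n) v = I.total := by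
  rw [leagueX_eq, leagueY_eq, Finset.sum_image fun a _ b _ h => Sum.inr_injective h, Inst.total,
    Finset.sum_comm]
  refine Finset.sum_congr rfl fun i _ => ?_
  rw [Inst.delta, Finset.sum_image fun a _ b _ h => Sum.inl_injective h]
  exact Finset.sum_congr rfl fun j _ => I.w_symm _ _

lemma sum_crossWeight_le {k : ℕ} {A B : Finset (Team n)} (hA : A ⊆ leagueX n)
    (hB : B ⊆ leagueY n) (P : Packing k A) (Q : Packing k B) :
    ∑ p, ∑ q, crossWeight I (P.vtx p) (Q.vtx q) ≤ I.total := by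
  have e : ∑ p, ∑ q, crossWeight I (P.vtx p) (Q.vtx q) = ∑ v ∈ A, I.delta B v := by
    rw [← P.sum_eq]
    refine Finset.sum_congr rfl fun p _ => ?_
    simp only [crossWeight]
    rw [Finset.sum_comm]
    exact Finset.sum_congr rfl fun c _ => Q.sum_eq (fun u => I.w (P.vtx p c) u)
  rw [e, ← sum_delta_leagueX]
  have h : ∀ v, I.delta B v ≤ I.delta (leagueY n) v := fun v =>
    Finset.sum_le_sum_of_subset_of_nonneg hB fun _ _ _ => I.w_nonneg _ _
  refine le_trans (Finset.sum_le_sum fun v _ => h v) ?_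
  exact Finset.sum_le_sum_of_subset_of_nonneg hA fun _ _ _ =>
    Finset.sum_nonneg fun _ _ => I.w_nonneg _ _

open Classical in
/-- The expected cost of the bad pairs. -/
lemma sum_bad_le (H : Admissible n d) {K : ℕ} (hK : K = numSuper n d * d) {A B : Finset (Team n)}
    (hA : A ⊆ leagueX n) (hB : B ⊆ leagueY n) (P : Packing K A) (Q : Packing K B) :
    ∑ ω : Perms K, ∑ u : Fin K, ∑ v : Fin K, (if IsBadPair n d u v then
      4 * crossWeight I (P.vtx (ω.1 u)) (Q.vtx (ω.2 v)) else 0) ≤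
      K * ((numPairs n d * d + numSuper n d : ℝ) *
        (4 * (((Fintype.card (Perms K) : ℕ) : ℝ) / (K : ℝ) ^ 2 * I.total))) := by
  set T := I.total with hT
  have hT0 : 0 ≤ T := I.total_nonneg
  set N : ℝ := ((Fintype.card (Perms K) : ℕ) : ℝ) with hN
  have hN0 : 0 ≤ N := Nat.cast_nonneg _
  -- The labels u and v carry a uniformly random pair out of K² pairs of paths, whose cross weights
  -- add up to at most T.
  have hbad : ∀ u v : Fin K, ∑ ω : Perms K, 4 * crossWeight I (P.vtx (ω.1 u)) (Q.vtx (ω.2 v)) ≤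
      4 * (N / (K : ℝ) ^ 2 * T) := fun u v => by
    have hK0 : (0 : ℝ) < K := by exact_mod_cast lt_of_le_of_lt (Nat.zero_le _) u.2
    rw [← Finset.mul_sum]
    have e := sum_perms_apply (fun a b => crossWeight I (P.vtx a) (Q.vtx b)) u v
    have h := sum_crossWeight_le I hA hB P Q
    refine mul_le_mul_of_nonneg_left ?_ (by norm_num)
    rw [div_mul_eq_mul_div, le_div_iff₀ (by positivity), mul_comm, e]
    exact mul_le_mul_of_nonneg_left h hN0
  rw [Finset.sum_comm]
  have : ∀ u : Fin K, ∑ ω : Perms K, ∑ v : Fin K, (if IsBadPair n d u v then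
      4 * crossWeight I (P.vtx (ω.1 u)) (Q.vtx (ω.2 v)) else 0) ≤
      (numPairs n d * d + numSuper n d : ℝ) * (4 * (N / (K : ℝ) ^ 2 * T)) := fun u => by
    rw [Finset.sum_comm]
    calc ∑ v : Fin K, ∑ ω : Perms K, (if IsBadPair n d u v then
          4 * crossWeight I (P.vtx (ω.1 u)) (Q.vtx (ω.2 v)) else 0)
        ≤ ∑ v : Fin K, (if IsBadPair n d u v then 4 * (N / (K : ℝ) ^ 2 * T) else 0) := by
          refine Finset.sum_le_sum fun v _ => ?_
          split_ifs
          · exact hbad u v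
          · simp
      _ = ((Finset.univ.filter fun v : Fin K => IsBadPair n d u v).card : ℝ) *
            (4 * (N / (K : ℝ) ^ 2 * T)) := by
          rw [← Finset.sum_filter, Finset.sum_const, nsmul_eq_mul]
      _ ≤ _ := by
          refine mul_le_mul_of_nonneg_right ?_ (by positivity)
          subst hK
          exact_mod_cast card_bad_le H u
  refine le_trans (Finset.sum_le_sum fun u _ => this u) ?_
  simp

-- In units of T/d the bad pairs cost at most 16/3 and the teams outside of the core at most 1. The
-- sum stays below 8, the value for which εd ≥ 6 and OPT ≥ 4T/3 give the error term.
open Classical in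
lemma expectedWeight_le {ε : ℝ} (hε : 0 < ε) (hd : d = pathsPerSuperTeam ε) (H : Admissible n d)
    {A B : Finset (Team n)}
    (hA : IsTop (leagueX n) (I.delta (leagueY n)) (coreSize n d) A)
    (hB : IsTop (leagueY n) (I.delta (leagueX n)) (coreSize n d) B)
    {K : ℕ} (hK : K = numSuper n d * d) {P : Packing K A} {Q : Packing K B}
    {S : Perms K → Schedule n} {x y : Perms K → Fin n → Team n}
    (hxy : LabelingChoice P Q x y) (hS : ∀ ω, IsThreePathSchedule d (x ω) (y ω) (S ω)) :
    I.expectedWeight S ≤ P.delta I B + (coreSize n d : ℝ) * P.weight I + Q.delta I A +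
      (coreSize n d : ℝ) * Q.weight I + ε * I.opt := by
  have h6 := H.six_le
  have hd0 : (0 : ℝ) < d := by exact_mod_cast (by omega : 0 < d)
  have hm0 : (0 : ℝ) < numSuper n d := by
    exact_mod_cast (by have := H.odd_m; omega : 0 < numSuper n d)
  have hKr : (K : ℝ) = numSuper n d * d := by rw [hK]; push_cast; ring
  have hK0 : (0 : ℝ) < K := by rw [hKr]; positivity
  have hn : 0 < n := by have := H.core_add; have := H.le_pairs; omega
  have hn0 : (0 : ℝ) < n := by exact_mod_cast hn
  set T := I.total with hT
  have hT0 : 0 ≤ T := I.total_nonneg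
  set M := ∑ p, ∑ q, mainCharge I (P.vtx p) (Q.vtx q) with hM
  have hcore : coreSize n d = 3 * K := by rw [hK, coreSize_eq_three_mul]
  have hMeq : M = P.delta I B + (coreSize n d : ℝ) * P.weight I + Q.delta I A +
      (coreSize n d : ℝ) * Q.weight I := by
    rw [hM, sum_mainCharge, hcore]
  set N : ℝ := ((Fintype.card (Perms K) : ℕ) : ℝ) with hN
  have hN0 : 0 < N := by rw [hN]; exact_mod_cast Fintype.card_pos
  -- the teams outside of the core
  have hl : ((n : ℝ) - (coreSize n d : ℕ)) = numPairs n d := by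
    rw [sub_eq_iff_eq_add']; exact_mod_cast H.core_add.symm
  have outX := hA.mul_sum_sub_le (card_leagueX n)
  have outY := hB.mul_sum_sub_le (card_leagueY n)
  rw [hl, sum_delta_leagueX] at outX
  rw [hl, sum_delta_leagueY] at outY
  have hbadsum := sum_bad_le I H hK hA.1 hB.1 P Q
  rw [← hT, ← hN] at hbadsum
  have hsum : ∑ ω, I.weight (S ω) ≤ N * M +
      K * ((numPairs n d * d + numSuper n d : ℝ) * (4 * (N / (K : ℝ) ^ 2 * T))) +
      N * (8 * (numPairs n d / n * T)) := by
    have hω : ∀ ω, I.weight (S ω) ≤ M + ∑ u : Fin K, ∑ v : Fin K, (if IsBadPair n d u v then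
        4 * crossWeight I (P.vtx (ω.1 u)) (Q.vtx (ω.2 v)) else 0) +
        8 * (numPairs n d / n * T) := fun ω => by
      have h := (hS ω).weight_le_main I hK H hn (hxy ω).1 (hxy ω).2
      have e : ∀ s : ℝ, n * s ≤ numPairs n d * T → s ≤ numPairs n d / n * T := fun s hs => by
        rw [div_mul_eq_mul_div, le_div_iff₀ hn0, mul_comm]; exact hs
      rw [sum_delta_leagueX, sum_delta_leagueY] at h
      have h1 := e _ outX
      have h2 := e _ outY
      linarith
    refine le_trans (Finset.sum_le_sum fun ω _ => hω ω) ?_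
    rw [Finset.sum_add_distrib, Finset.sum_add_distrib]
    simp only [Finset.sum_const, Finset.card_univ, nsmul_eq_mul]
    linarith
  have hopt := I.total_le_opt ⟨S 1, (hS 1).feasible ((hxy 1).1.leagueLabels (hxy 1).2) H⟩
  have hεd : 6 ≤ ε * d := by
    have := Nat.le_ceil (1 / ε)
    rw [div_le_iff₀ hε] at this
    rw [hd, pathsPerSuperTeam]
    push_cast
    linarith
  -- numerical estimates
  have hl9 : (numPairs n d : ℝ) ≤ 9 * d := by exact_mod_cast H.pairs_lt.le
  -- From l ≤ 9d one gets 3ld ≤ 27d² ≤ 36d² − 1 ≤ m. So ld + m ≤ 4m/3, the source of 16/3 below.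
  have hld : 3 * (numPairs n d * d : ℝ) ≤ numSuper n d := by
    have h1 : (36 : ℝ) * d ^ 2 ≤ numSuper n d + 1 := by exact_mod_cast H.large
    have h2 : (6 : ℝ) ≤ d := by exact_mod_cast h6
    nlinarith
  have hnd : 8 * (numPairs n d : ℝ) * d ≤ n := by
    have h1 : (108 : ℝ) * d ^ 3 ≤ n := by exact_mod_cast H.cube_le
    have h2 : (6 : ℝ) ≤ d := by exact_mod_cast h6
    have h3 : (d : ℝ) ^ 2 ≤ d ^ 3 := pow_le_pow_right₀ (by linarith) (by norm_num)
    nlinarith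
  have hout : 8 * (numPairs n d / n * T) ≤ T / d := by
    rw [le_div_iff₀ hd0, show 8 * (numPairs n d / n * T) * (d : ℝ) =
      (8 * (numPairs n d : ℝ) * d) / n * T by ring]
    exact mul_le_of_le_one_left hT0 ((div_le_one hn0).2 hnd)
  have hin : (numPairs n d * d + numSuper n d : ℝ) * (4 * T) ≤ K * (16 / 3 * (T / d)) := by
    rw [hKr, show (numSuper n d * d : ℝ) * (16 / 3 * (T / d)) = 4 / 3 * numSuper n d * (4 * T) by
      field_simp; ring]
    exact mul_le_mul_of_nonneg_right (by linarith) (by linarith)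
  have hin' : K * ((numPairs n d * d + numSuper n d : ℝ) * (4 * (N / (K : ℝ) ^ 2 * T))) ≤
      N * (16 / 3 * (T / d)) := by
    rw [show K * ((numPairs n d * d + numSuper n d : ℝ) * (4 * (N / (K : ℝ) ^ 2 * T))) =
      N * (((numPairs n d * d + numSuper n d : ℝ) * (4 * T)) / K) by field_simp]
    refine mul_le_mul_of_nonneg_left ?_ hN0.le
    rw [div_le_iff₀ hK0]
    linarith
  -- The inequality 8/d ≤ 4ε/3 is equivalent to εd ≥ 6, the reason for the factor 6 in d.
  have hfin : 8 * (T / d) ≤ ε * I.opt := by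
    have h1 : ε * (4 / 3 * T) ≤ ε * I.opt := mul_le_mul_of_nonneg_left hopt hε.le
    have h2 : 8 * (T / d) ≤ ε * (4 / 3 * T) := by
      rw [← mul_div_assoc, div_le_iff₀ hd0]
      nlinarith
    linarith
  have hTd : 0 ≤ T / d := by positivity
  rw [Inst.expectedWeight, ← hMeq, div_le_iff₀ hN0]
  have h5 : N * (8 * (numPairs n d / n * T)) ≤ N * (T / d) := mul_le_mul_of_nonneg_left hout hN0.le
  have h6 : N * (8 * (T / d)) ≤ N * (ε * I.opt) := mul_le_mul_of_nonneg_left hfin hN0.le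
  have h7 : 0 ≤ N * (T / d) := by positivity
  have h8 : (M + ε * I.opt) * N = N * M + N * (ε * I.opt) := by ring
  have h9 : N * (16 / 3 * (T / d)) = 16 / 3 * (N * (T / d)) := by ring
  have h10 : N * (8 * (T / d)) = 8 * (N * (T / d)) := by ring
  linarith

end

/-! ### Reasoning about programs -/

/-- Program `p`, started in state `s`, terminates with certainty in a state which satisfies `R`. -/
def Does (p : Prog) (s : MState) (R : MState → Prop) : Prop :=
  ∃ s', p.run s = PMF.pure s' ∧ R s'

/-- The final state of program `p`, started in state `s`, is a function of a uniformly random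
element `ω` of `Ω`, and satisfies `R ω`. -/
def Sim (p : Prog) (s : MState) (Ω : Type) [Fintype Ω] [Nonempty Ω] (R : Ω → MState → Prop) :
    Prop :=
  ∃ Φ : Ω → MState, p.run s = (PMF.uniformOfFintype Ω).map Φ ∧ ∀ ω, R ω (Φ ω)

attribute [simp] NExp.eval NExp.cost RExp.eval RExp.cost Test.eval Test.cost

section States

variable (s : MState)

@[simp] lemma MState.tick_nreg (k : ℕ) : (s.tick k).nreg = s.nreg := rfl
@[simp] lemma MState.tick_narr (k : ℕ) : (s.tick k).narr = s.narr := rfl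
@[simp] lemma MState.tick_rreg (k : ℕ) : (s.tick k).rreg = s.rreg := rfl
@[simp] lemma MState.tick_rarr (k : ℕ) : (s.tick k).rarr = s.rarr := rfl
@[simp] lemma MState.tick_time (k : ℕ) : (s.tick k).time = s.time + k := rfl

@[simp] lemma MState.setN_nreg (v k w : ℕ) :
    (s.setN v k).nreg w = if w = v then k else s.nreg w := by
  simp [MState.setN, Function.update_apply]
@[simp] lemma MState.setN_narr (v k : ℕ) : (s.setN v k).narr = s.narr := rfl
@[simp] lemma MState.setN_rreg (v k : ℕ) : (s.setN v k).rreg = s.rreg := rfl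
@[simp] lemma MState.setN_rarr (v k : ℕ) : (s.setN v k).rarr = s.rarr := rfl
@[simp] lemma MState.setN_time (v k : ℕ) : (s.setN v k).time = s.time := rfl

@[simp] lemma MState.setR_nreg (v : ℕ) (x : ℝ) : (s.setR v x).nreg = s.nreg := rfl
@[simp] lemma MState.setR_narr (v : ℕ) (x : ℝ) : (s.setR v x).narr = s.narr := rfl
@[simp] lemma MState.setR_rreg (v w : ℕ) (x : ℝ) :
    (s.setR v x).rreg w = if w = v then x else s.rreg w := by
  simp [MState.setR, Function.update_apply]
@[simp] lemma MState.setR_rarr (v : ℕ) (x : ℝ) : (s.setR v x).rarr = s.rarr := rfl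
@[simp] lemma MState.setR_time (v : ℕ) (x : ℝ) : (s.setR v x).time = s.time := rfl

@[simp] lemma MState.setNArr_nreg (a i j k : ℕ) : (s.setNArr a i j k).nreg = s.nreg := rfl
@[simp] lemma MState.setNArr_narr (a i j k a' i' j' : ℕ) : (s.setNArr a i j k).narr a' i' j' =
    if a' = a ∧ i' = i ∧ j' = j then k else s.narr a' i' j' := rfl
@[simp] lemma MState.setNArr_rreg (a i j k : ℕ) : (s.setNArr a i j k).rreg = s.rreg := rfl
@[simp] lemma MState.setNArr_rarr (a i j k : ℕ) : (s.setNArr a i j k).rarr = s.rarr := rfl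
@[simp] lemma MState.setNArr_time (a i j k : ℕ) : (s.setNArr a i j k).time = s.time := rfl

@[simp] lemma MState.setRArr_nreg (a i j : ℕ) (x : ℝ) : (s.setRArr a i j x).nreg = s.nreg := rfl
@[simp] lemma MState.setRArr_narr (a i j : ℕ) (x : ℝ) : (s.setRArr a i j x).narr = s.narr := rfl
@[simp] lemma MState.setRArr_rreg (a i j : ℕ) (x : ℝ) : (s.setRArr a i j x).rreg = s.rreg := rfl
@[simp] lemma MState.setRArr_rarr (a i j a' i' j' : ℕ) (x : ℝ) :
    (s.setRArr a i j x).rarr a' i' j' =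
      if a' = a ∧ i' = i ∧ j' = j then x else s.rarr a' i' j' := rfl
@[simp] lemma MState.setRArr_time (a i j : ℕ) (x : ℝ) : (s.setRArr a i j x).time = s.time := rfl

end States

/-! ### Deterministic programs -/

section Does

variable {p q : Prog} {s : MState} {R R' : MState → Prop}

lemma Does.mono (h : Does p s R) (hR : ∀ s', R s' → R' s') : Does p s R' := by
  obtain ⟨s', h1, h2⟩ := h
  exact ⟨s', h1, hR s' h2⟩

lemma does_pure {s' : MState} (h : p.run s = PMF.pure s') : Does p s R ↔ R s' := by
  constructor
  · rintro ⟨s'', h1, h2⟩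
    rw [h] at h1
    have := congrArg PMF.support h1
    rw [PMF.support_pure, PMF.support_pure, Set.singleton_eq_singleton_iff] at this
    rwa [this]
  · exact fun hR => ⟨s', h, hR⟩

@[simp] lemma does_skip : Does .skip s R ↔ R (s.tick 1) := does_pure rfl

@[simp] lemma does_setN {v : ℕ} {e : NExp} :
    Does (.setN v e) s R ↔ R ((s.setN v (e.eval s)).tick (e.cost + 1)) := does_pure rfl

@[simp] lemma does_setR {v : ℕ} {e : RExp} :
    Does (.setR v e) s R ↔ R ((s.setR v (e.eval s)).tick (e.cost + 1)) := does_pure rfl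

@[simp] lemma does_setNArr {a : ℕ} {i j e : NExp} : Does (.setNArr a i j e) s R ↔
    R ((s.setNArr a (i.eval s) (j.eval s) (e.eval s)).tick (i.cost + j.cost + e.cost + 1)) :=
  does_pure rfl

@[simp] lemma does_setRArr {a : ℕ} {i j : NExp} {e : RExp} : Does (.setRArr a i j e) s R ↔
    R ((s.setRArr a (i.eval s) (j.eval s) (e.eval s)).tick (i.cost + j.cost + e.cost + 1)) :=
  does_pure rfl

lemma Does.seq (h : Does p s fun s' => Does q s' R) : Does (.seq p q) s R := by
  obtain ⟨s', h1, s'', h2, hR⟩ := h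
  refine ⟨s'', ?_, hR⟩
  rw [Prog.run, h1, PMF.pure_bind, h2]

lemma Does.ite {b : Test} (h1 : b.eval s → Does p (s.tick (b.cost + 1)) R)
    (h2 : ¬ b.eval s → Does q (s.tick (b.cost + 1)) R) : Does (.ite b p q) s R := by
  by_cases h : b.eval s
  · obtain ⟨s', h3, h4⟩ := h1 h
    exact ⟨s', by rw [Prog.run, if_pos h, h3], h4⟩
  · obtain ⟨s', h3, h4⟩ := h2 h
    exact ⟨s', by rw [Prog.run, if_neg h, h3], h4⟩

lemma Does.loop {v : ℕ} {e : NExp} {N : ℕ} (Inv : ℕ → MState → Prop) (hN : e.eval s = N)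
    (h0 : Inv 0 (s.tick (e.cost + 1)))
    (hstep : ∀ k < N, ∀ s', Inv k s' → Does p ((s'.setN v k).tick 1) (Inv (k + 1)))
    (hR : ∀ s', Inv N s' → R s') : Does (.loop v e p) s R := by
  have key : ∀ k ≤ N, ∃ s', iterate (fun k s' => p.run ((s'.setN v k).tick 1)) k
      (s.tick (e.cost + 1)) = PMF.pure s' ∧ Inv k s' := by
    intro k
    induction k with
    | zero => exact fun _ => ⟨_, rfl, h0⟩
    | succ k ih =>
      intro hk
      obtain ⟨s', h1, h2⟩ := ih (by omega)
      obtain ⟨s'', h3, h4⟩ := hstep k (by omega) s' h2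
      exact ⟨s'', by rw [iterate, h1, PMF.pure_bind, h3], h4⟩
  obtain ⟨s', h1, h2⟩ := key N le_rfl
  exact ⟨s', by rw [Prog.run, hN, h1], hR s' h2⟩

/-- An assignment which depends on a test, where both cases take the same time. -/
def Prog.cond (b : Test) (v : ℕ) (e f : NExp) : Prog := .ite b (.setN v e) (.setN v f)

-- Since both branches take the same time, the result is a single state with a conditional value,
-- and code with such assignments can be evaluated by rewriting. Expressions are padded with zeros
-- where their costs would differ.
open Classical in
lemma run_cond {b : Test} {v : ℕ} {e f : NExp} (hc : e.cost = f.cost) :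
    (Prog.cond b v e f).run s = PMF.pure
      ((s.setN v (if b.eval s then e.eval s else f.eval s)).tick (b.cost + 1 + e.cost + 1)) := by
  have heval : ∀ (e : NExp) k, e.eval (s.tick k) = e.eval s := fun e k => by
    induction e with
    | lit => rfl
    | reg => rfl
    | arr a i j hi hj => simp only [NExp.eval, hi, hj, MState.tick_narr]
    | add e f he hf => simp only [NExp.eval, he, hf]
    | sub e f he hf => simp only [NExp.eval, he, hf]
  have htick : ∀ k c c', ((s.tick c).setN v k).tick c' = (s.setN v k).tick (c + c') :=
    fun k c c' => by simp only [MState.tick, MState.setN, add_assoc]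
  rw [Prog.cond, Prog.run]
  split_ifs
  · rw [Prog.run, heval, htick, ← add_assoc]
  · rw [Prog.run, heval, htick, ← add_assoc, hc]

open Classical in
@[simp] lemma does_cond {b : Test} {v : ℕ} {e f : NExp} (hc : e.cost = f.cost) :
    Does (.cond b v e f) s R ↔
      R ((s.setN v (if b.eval s then e.eval s else f.eval s)).tick (b.cost + 1 + e.cost + 1)) :=
  does_pure (run_cond hc)

lemma does_seq_pure {s' : MState} (h : p.run s = PMF.pure s') :
    Does (.seq p q) s R ↔ Does q s' R := by
  simp only [Does, Prog.run, h, PMF.pure_bind]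

open Classical in
@[simp] lemma does_seq_cond {b : Test} {v : ℕ} {e f : NExp} (hc : e.cost = f.cost) :
    Does (.seq (.cond b v e f) q) s R ↔ Does q
      ((s.setN v (if b.eval s then e.eval s else f.eval s)).tick (b.cost + 1 + e.cost + 1)) R :=
  does_seq_pure (run_cond hc)

@[simp] lemma does_seq_setN {v : ℕ} {e : NExp} : Does (.seq (.setN v e) q) s R ↔
    Does q ((s.setN v (e.eval s)).tick (e.cost + 1)) R := does_seq_pure rfl

@[simp] lemma does_seq_setR {v : ℕ} {e : RExp} : Does (.seq (.setR v e) q) s R ↔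
    Does q ((s.setR v (e.eval s)).tick (e.cost + 1)) R := does_seq_pure rfl

@[simp] lemma does_seq_setNArr {a : ℕ} {i j e : NExp} : Does (.seq (.setNArr a i j e) q) s R ↔
    Does q ((s.setNArr a (i.eval s) (j.eval s) (e.eval s)).tick
      (i.cost + j.cost + e.cost + 1)) R := does_seq_pure rfl

/-- Subtract register `w` from register `v`, if possible. -/
def Prog.reduce (v w : ℕ) : Prog :=
  .cond (.nle (.reg w) (.reg v)) v (.sub (.reg v) (.reg w)) (.sub (.reg v) (.lit 0))

/-- The effect of `Prog.reduce`. -/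
def reduceBy (x M : ℕ) : ℕ := if M ≤ x then x - M else x

/-- The machine has no division. One conditional subtraction yields the residue below 2M, and two of
them below 3M, which is what p + 2r needs. -/
lemma reduceBy_eq {x M : ℕ} (h : x < 2 * M) : reduceBy x M = x % M := by
  rw [reduceBy]
  split_ifs with h1
  · rw [Nat.mod_eq_sub_mod h1, Nat.mod_eq_of_lt (by omega)]
  · rw [Nat.mod_eq_of_lt (by omega)]

lemma reduceBy_reduceBy {x M : ℕ} (h : x < 3 * M) : reduceBy (reduceBy x M) M = x % M := by
  by_cases h1 : M ≤ x
  · have e : reduceBy x M = x - M := if_pos h1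
    rw [e, Nat.mod_eq_sub_mod h1]
    exact reduceBy_eq (by omega)
  · rw [reduceBy, reduceBy, if_neg h1, if_neg h1, Nat.mod_eq_of_lt (by omega)]

lemma run_reduce {v w : ℕ} : (Prog.reduce v w).run s =
    PMF.pure ((s.setN v (reduceBy (s.nreg v) (s.nreg w))).tick 8) := by
  rw [Prog.reduce, run_cond (e := .sub (.reg v) (.reg w)) (f := .sub (.reg v) (.lit 0)) rfl,
    reduceBy]
  by_cases hle : s.nreg w ≤ s.nreg v
  · have : (Test.nle (.reg w) (.reg v)).eval s := hle
    rw [if_pos hle, if_pos this]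
    rfl
  · have : ¬ (Test.nle (.reg w) (.reg v)).eval s := hle
    rw [if_neg hle, if_neg this]
    rfl

@[simp] lemma does_seq_reduce {v w : ℕ} : Does (.seq (.reduce v w) q) s R ↔
    Does q ((s.setN v (reduceBy (s.nreg v) (s.nreg w))).tick 8) R := does_seq_pure run_reduce

end Does

/-! ### Programs with random choices -/

section Sim

variable {p q : Prog} {s : MState} {Ω Ω' : Type} [Fintype Ω] [Nonempty Ω] [Fintype Ω']
  [Nonempty Ω']

lemma uniform_prod : PMF.uniformOfFintype (Ω × Ω') =
    (PMF.uniformOfFintype Ω).bind fun a => (PMF.uniformOfFintype Ω').map fun b => (a, b) := by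
  classical
  ext ⟨a, b⟩
  rw [PMF.uniformOfFintype_apply, PMF.bind_apply, tsum_eq_single a]
  · rw [PMF.map_apply, tsum_eq_single b]
    · simp only [PMF.uniformOfFintype_apply, if_true, Fintype.card_prod, Nat.cast_mul]
      rw [ENNReal.mul_inv (Or.inl (by simp)) (Or.inl (by simp))]
    · intro b' hb'
      rw [if_neg]
      simpa using Ne.symm hb'
  · intro a' ha'
    rw [PMF.map_apply, mul_eq_zero]
    right
    refine ENNReal.tsum_eq_zero.2 fun b' => if_neg ?_
    intro h
    exact ha' (Prod.mk.inj h).1.symm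

lemma uniform_map_equiv (e : Ω' ≃ Ω) :
    (PMF.uniformOfFintype Ω').map e = PMF.uniformOfFintype Ω := by
  classical
  ext a
  rw [PMF.map_apply, tsum_eq_single (e.symm a)]
  · simp [Fintype.card_congr e]
  · intro b hb
    rw [if_neg]
    rintro rfl
    simp at hb

lemma Sim.seq_does {R R' : Ω → MState → Prop} (h : Sim p s Ω R)
    (hq : ∀ ω s', R ω s' → Does q s' (R' ω)) : Sim (.seq p q) s Ω R' := by
  obtain ⟨Φ, h1, h2⟩ := h
  choose Φ' h3 h4 using fun ω => hq ω _ (h2 ω)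
  refine ⟨Φ', ?_, h4⟩
  rw [Prog.run, h1, PMF.bind_map, ← PMF.bind_pure_comp]
  congr 1
  exact funext fun ω => h3 ω

lemma Does.seq_sim {R : Ω → MState → Prop} (h : Does p s fun s' => Sim q s' Ω R) :
    Sim (.seq p q) s Ω R := by
  obtain ⟨s', h1, Φ, h2, h3⟩ := h
  exact ⟨Φ, by rw [Prog.run, h1, PMF.pure_bind, h2], h3⟩

lemma bind_map_uniform {α : Type} (Φ : Ω → Ω' → α) :
    ((PMF.uniformOfFintype Ω).bind fun ω => (PMF.uniformOfFintype Ω').map (Φ ω)) =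
      (PMF.uniformOfFintype (Ω × Ω')).map fun ω => Φ ω.1 ω.2 := by
  rw [uniform_prod, PMF.map_bind]
  congr 1
  funext ω
  rw [PMF.map_comp]
  rfl

lemma Sim.seq {R : Ω → MState → Prop} {R' : Ω → Ω' → MState → Prop} (h : Sim p s Ω R)
    (hq : ∀ ω s', R ω s' → Sim q s' Ω' (R' ω)) :
    Sim (.seq p q) s (Ω × Ω') fun ω => R' ω.1 ω.2 := by
  obtain ⟨Φ, h1, h2⟩ := h
  choose Φ' h3 h4 using fun ω => hq ω _ (h2 ω)
  refine ⟨fun ω => Φ' ω.1 ω.2, ?_, fun ω => h4 ω.1 ω.2⟩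
  rw [Prog.run, h1, PMF.bind_map, ← bind_map_uniform]
  congr 1
  exact funext fun ω => h3 ω

lemma sim_rand {v : ℕ} {e : NExp} {N : ℕ} (hN : e.eval s = N) {R : Fin (N + 1) → MState → Prop}
    (h : ∀ k, R k ((s.setN v (k : ℕ)).tick (e.cost + 1))) :
    Sim (.rand v e) s (Fin (N + 1)) R := by
  subst hN
  refine ⟨_, ?_, h⟩
  rw [Prog.run]
  have e' : ((PMF.uniformOfFintype (Fin (e.eval s + 1))).bind fun a => PMF.pure (a : ℕ)) =
      PMF.map Fin.val (PMF.uniformOfFintype (Fin (e.eval s + 1))) := PMF.bind_pure_comp _ _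
  exact (congrArg (PMF.map _) e').trans (PMF.map_comp _ _ _)

/-! ### Random permutations -/

/-- The permutation of `Fin (k + 1)` that extends a permutation of `Fin k` and fixes the last
element. -/
def extendPerm {k : ℕ} (σ : Equiv.Perm (Fin k)) : Equiv.Perm (Fin (k + 1)) :=
  finSuccEquivLast.symm.permCongr (Equiv.optionCongr σ)

lemma extendPerm_castSucc {k : ℕ} (σ : Equiv.Perm (Fin k)) (i : Fin k) :
    extendPerm σ i.castSucc = (σ i).castSucc := by
  simp [extendPerm, Equiv.permCongr_apply]

lemma extendPerm_last {k : ℕ} (σ : Equiv.Perm (Fin k)) :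
    extendPerm σ (Fin.last k) = Fin.last k := by
  simp [extendPerm, Equiv.permCongr_apply]

/-- The place a is recovered as the preimage of the last element, and then the swap cancels.
Equality of the cardinalities, k! · (k + 1) = (k + 1)!, does the rest. -/
lemma insertLast_bijective (k : ℕ) : Function.Bijective
    fun a : Equiv.Perm (Fin k) × Fin (k + 1) => extendPerm a.1 * Equiv.swap (Fin.last k) a.2 := by
  rw [Fintype.bijective_iff_injective_and_card]
  constructor
  · rintro ⟨σ, a⟩ ⟨τ, b⟩ h
    simp only at h
    have hab : a = b := by
      have h1 : (extendPerm σ * Equiv.swap (Fin.last k) a) a = Fin.last k := by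
        simp [extendPerm_last]
      have h2 : (extendPerm τ * Equiv.swap (Fin.last k) b) b = Fin.last k := by
        simp [extendPerm_last]
      rw [← h] at h2
      exact Equiv.injective _ (h1.trans h2.symm)
    subst hab
    have hστ := mul_right_cancel h
    refine Prod.ext (Equiv.ext fun i => ?_) rfl
    have := congrArg (fun f => f i.castSucc) hστ
    simp only [extendPerm_castSucc] at this
    exact Fin.castSucc_injective _ this
  · rw [Fintype.card_prod, Fintype.card_perm, Fintype.card_perm, Fintype.card_fin, Fintype.card_fin,
      Nat.factorial_succ, mul_comm]

/-- One step of the shuffle: choose the place of the new element. -/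
noncomputable def insertLast (k : ℕ) :
    Equiv.Perm (Fin k) × Fin (k + 1) ≃ Equiv.Perm (Fin (k + 1)) :=
  Equiv.ofBijective _ (insertLast_bijective k)

/-- This is the step in terms of the array: f holds the old entries, the entry at a moves to place
k, and k is put at a. The case i = a comes first, so for a = k the undefined entry f k is
irrelevant. -/
lemma insertLast_apply {k : ℕ} (σ : Equiv.Perm (Fin k)) (a : Fin (k + 1)) {f : ℕ → ℕ}
    (hf : ∀ i : Fin k, f i = σ i) (i : Fin (k + 1)) :
    ((insertLast k (σ, a) i : Fin (k + 1)) : ℕ) =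
      if (i : ℕ) = a then k else if (i : ℕ) = k then f a else f i := by
  change (((extendPerm σ * Equiv.swap (Fin.last k) a) i : Fin (k + 1)) : ℕ) = _
  rw [Equiv.Perm.mul_apply]
  by_cases hia : i = a
  · subst hia
    simp [extendPerm_last]
  · rw [if_neg (fun h => hia (Fin.ext h))]
    by_cases hil : i = Fin.last k
    · subst hil
      rw [Equiv.swap_apply_left, if_pos (by simp)]
      obtain ⟨b, rfl⟩ := Fin.exists_castSucc_eq.2 (Ne.symm hia)
      rw [extendPerm_castSucc, Fin.val_castSucc, Fin.val_castSucc, hf]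
    · rw [Equiv.swap_apply_of_ne_of_ne hil hia, if_neg (fun h => hil (Fin.ext (by simpa using h)))]
      obtain ⟨b, rfl⟩ := Fin.exists_castSucc_eq.2 hil
      rw [extendPerm_castSucc, Fin.val_castSucc, Fin.val_castSucc, hf]

/-- Write a uniformly random permutation of `0, …, K - 1` into row `a` of array `6`, where `K` is
the content of register `3`. -/
def Prog.shuffle (a : ℕ) : Prog :=
  .loop 10 (.reg 3) (.seq (.rand 11 (.reg 10)) (.seq
    (.setNArr 6 (.lit a) (.reg 10) (.arr 6 (.lit a) (.reg 11)))
    (.setNArr 6 (.lit a) (.reg 11) (.reg 10))))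

/-- The relation between the states before and after `Prog.shuffle`. -/
structure Shuffled (a K : ℕ) (s : MState) (σ : Equiv.Perm (Fin K)) (s' : MState) : Prop where
  perm : ∀ i : Fin K, s'.narr 6 a i = σ i
  nreg : ∀ v < 10, s'.nreg v = s.nreg v
  narr : ∀ b i j, ¬ (b = 6 ∧ i = a) → s'.narr b i j = s.narr b i j
  time : s'.time ≤ s.time + 2 + 14 * K

/-- By induction, k rounds give a uniform permutation of `Fin k`. The next draw is independent of
it, so the pair is uniform on `Perm k × Fin (k + 1)`, and `insertLast` carries it to a uniform
permutation of `Fin (k + 1)`. -/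
lemma sim_shuffle (a : ℕ) {K : ℕ} (hK : s.nreg 3 = K) :
    Sim (.shuffle a) s (Equiv.Perm (Fin K)) (Shuffled a K s) := by
  have key : ∀ k, ∃ Φ : Equiv.Perm (Fin k) → MState,
      iterate (fun k s' => Prog.run (.seq (.rand 11 (.reg 10)) (.seq
        (.setNArr 6 (.lit a) (.reg 10) (.arr 6 (.lit a) (.reg 11)))
        (.setNArr 6 (.lit a) (.reg 11) (.reg 10)))) ((s'.setN 10 k).tick 1)) k (s.tick 2) =
        (PMF.uniformOfFintype (Equiv.Perm (Fin k))).map Φ ∧ ∀ σ, Shuffled a k s σ (Φ σ) := by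
    intro k
    induction k with
    | zero =>
      refine ⟨fun _ => s.tick 2, ?_, fun σ => ⟨fun i => i.elim0, fun _ _ => rfl, fun _ _ _ _ => rfl,
        by simp⟩⟩
      exact (PMF.map_const _ _).symm
    | succ k ih =>
      obtain ⟨Φ, h1, h2⟩ := ih
      have hbody : ∀ σ, Sim (.seq (.rand 11 (.reg 10)) (.seq
          (.setNArr 6 (.lit a) (.reg 10) (.arr 6 (.lit a) (.reg 11)))
          (.setNArr 6 (.lit a) (.reg 11) (.reg 10)))) (((Φ σ).setN 10 k).tick 1) (Fin (k + 1))
          fun b s' => Shuffled a (k + 1) s (insertLast k (σ, b)) s' := by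
        intro σ
        refine Sim.seq_does (sim_rand (N := k) (by simp [NExp.eval])
          (R := fun b s' => s' = (((((Φ σ).setN 10 k).tick 1).setN 11 (b : ℕ)).tick 2))
          fun b => rfl) ?_
        rintro b s' rfl
        refine Does.seq ?_
        rw [does_setNArr, does_setNArr]
        have hσ := h2 σ
        refine ⟨fun i => ?_, fun v hv => ?_, fun c i j hc => ?_, ?_⟩
        · rw [insertLast_apply σ b hσ.perm i]
          simp [NExp.eval]
        · have h10 : v ≠ 10 := by omega
          have h11 : v ≠ 11 := by omega
          simp [h10, h11, hσ.nreg v hv]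
        · have h3 : ∀ x, ¬ (c = 6 ∧ i = a ∧ j = x) := fun x h => hc ⟨h.1, h.2.1⟩
          simp [NExp.eval, h3, hσ.narr c i j hc]
        · have := hσ.time
          simp [NExp.cost]
          omega
      choose Ψ h3 h4 using hbody
      refine ⟨fun τ => Ψ ((insertLast k).symm τ).1 ((insertLast k).symm τ).2, ?_, fun τ => ?_⟩
      · rw [iterate, h1, PMF.bind_map]
        have : ((fun s' => Prog.run (.seq (.rand 11 (.reg 10)) (.seq
          (.setNArr 6 (.lit a) (.reg 10) (.arr 6 (.lit a) (.reg 11)))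
          (.setNArr 6 (.lit a) (.reg 11) (.reg 10)))) ((s'.setN 10 k).tick 1)) ∘ Φ) =
          fun σ => (PMF.uniformOfFintype (Fin (k + 1))).map (Ψ σ) := funext h3
        rw [this, bind_map_uniform, ← uniform_map_equiv (insertLast k).symm, PMF.map_comp]
        rfl
      · have := h4 ((insertLast k).symm τ).1 ((insertLast k).symm τ).2
        simp only [Prod.mk.eta, Equiv.apply_symm_apply] at this
        exact this
  obtain ⟨Φ, h1, h2⟩ := key K
  refine ⟨Φ, ?_, h2⟩
  rw [← h1, Prog.shuffle, Prog.run]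
  simp only [NExp.eval, NExp.cost, hK]

end Sim

/-! ### Computation of the parameters -/

/-- Compute the parameters from `n` and `d`: register `2` gets the number of super-teams, `3` the
number of paths in a league, `4` the size of the core, `5` the number of team-pairs, and `6` and
`7` get `3 * d` and `6 * d`. -/
def Prog.params : Prog :=
  .seq (.setN 6 (.add (.reg 1) (.add (.reg 1) (.reg 1)))) <|
  .seq (.setN 7 (.add (.reg 6) (.reg 6))) <|
  .seq (.setN 8 (.reg 0)) <|
  .seq (.setN 9 (.lit 0)) <|
  .seq (.loop 10 (.reg 0) (.ite (.nle (.reg 7) (.reg 8))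
    (.seq (.setN 8 (.sub (.reg 8) (.reg 7))) (.setN 9 (.add (.reg 9) (.lit 1)))) .skip)) <|
  .seq (.setN 2 (.sub (.add (.reg 9) (.reg 9)) (.lit 1))) <|
  .seq (.setN 3 (.lit 0)) <|
  .seq (.loop 10 (.reg 2) (.setN 3 (.add (.reg 3) (.reg 1)))) <|
  .seq (.setN 4 (.add (.reg 3) (.add (.reg 3) (.reg 3)))) <|
  .setN 5 (.sub (.reg 0) (.reg 4))

/-- The registers `0, …, 7` contain the parameters. -/
structure HasParams (n d : ℕ) (s : MState) : Prop where
  r0 : s.nreg 0 = n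
  r1 : s.nreg 1 = d
  r2 : s.nreg 2 = numSuper n d
  r3 : s.nreg 3 = numSuper n d * d
  r4 : s.nreg 4 = coreSize n d
  r5 : s.nreg 5 = numPairs n d
  r6 : s.nreg 6 = 3 * d
  r7 : s.nreg 7 = 6 * d

lemma HasParams.of_frame {n d : ℕ} {s s' : MState} (h : HasParams n d s)
    (hs : ∀ v < 8, s'.nreg v = s.nreg v) : HasParams n d s' := by
  constructor <;> rw [hs _ (by norm_num)]
  exacts [h.r0, h.r1, h.r2, h.r3, h.r4, h.r5, h.r6, h.r7]

lemma numSuper_le {n d : ℕ} (hd : 0 < d) : numSuper n d ≤ n := by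
  have h1 : n / (6 * d) * 2 ≤ n :=
    le_trans (Nat.mul_le_mul_left _ (by omega)) (Nat.div_mul_le_self n (6 * d))
  rw [numSuper]
  omega

lemma does_params {n d : ℕ} {s : MState} (hn : s.nreg 0 = n) (hd : s.nreg 1 = d) (hd0 : 0 < d) :
    Does .params s fun s' => HasParams n d s' ∧ s'.narr = s.narr ∧ s'.rarr = s.rarr ∧
      s'.time ≤ s.time + 20 * n + 50 := by
  rw [Prog.params]
  simp only [does_seq_setN]
  -- Registers 8 and 9 hold the remainder and the quotient of n by 6d. After k rounds either the
  -- division is finished or there have been at least k subtractions; n rounds always suffice, and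
  -- surplus rounds do nothing.
  refine Does.seq (Does.loop (N := n) (fun k s' => s'.nreg 0 = n ∧ s'.nreg 1 = d ∧
    s'.nreg 6 = 3 * d ∧ s'.nreg 7 = 6 * d ∧ n = s'.nreg 8 + 6 * d * s'.nreg 9 ∧
    (s'.nreg 8 < 6 * d ∨ k ≤ s'.nreg 9) ∧ s'.narr = s.narr ∧ s'.rarr = s.rarr ∧
    s'.time ≤ s.time + 20 + 14 * k) (by simp [hn]) ?_ ?_ ?_)
  · simp [hn, hd]
    omega
  · rintro k - s' ⟨h0, h1, h6, h7, h8, h9, ha, hr, ht⟩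
    refine Does.ite (fun hb => ?_) fun hb => ?_
    · simp only [Test.eval, NExp.eval, MState.tick_nreg, MState.setN_nreg] at hb
      norm_num [h7] at hb
      have e : 6 * d * (s'.nreg 9 + 1) = 6 * d * s'.nreg 9 + 6 * d := by ring
      simp [h0, h1, h6, h7, ha, hr]
      refine ⟨by omega, by omega, by omega⟩
    · simp only [Test.eval, NExp.eval, MState.tick_nreg, MState.setN_nreg] at hb
      norm_num [h7] at hb
      simp [h0, h1, h6, h7, ha, hr]
      refine ⟨by omega, by omega, by omega⟩
  · rintro s' ⟨h0, h1, h6, h7, h8, h9, ha, hr, ht⟩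
    have hlt : s'.nreg 8 < 6 * d := by
      rcases h9 with h9 | h9
      · exact h9
      · by_contra hge
        have : n * 1 ≤ s'.nreg 9 * (6 * d) := Nat.mul_le_mul h9 (by omega)
        rw [mul_comm (s'.nreg 9)] at this
        omega
    have hq : n / (6 * d) = s'.nreg 9 := by
      conv_lhs => rw [h8]
      rw [Nat.add_mul_div_left _ _ (by omega), Nat.div_eq_of_lt hlt, zero_add]
    have hm : s'.nreg 9 + s'.nreg 9 - 1 = numSuper n d := by rw [numSuper, hq, two_mul]
    simp only [does_seq_setN]
    refine Does.seq (Does.loop (N := numSuper n d) (fun k s'' => s''.nreg 0 = n ∧ s''.nreg 1 = d ∧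
      s''.nreg 6 = 3 * d ∧ s''.nreg 7 = 6 * d ∧ s''.nreg 2 = numSuper n d ∧ s''.nreg 3 = k * d ∧
      s''.narr = s.narr ∧ s''.rarr = s.rarr ∧
      s''.time ≤ s'.time + 20 + 5 * k) (by simp [hm]) ?_ ?_ ?_)
    · simp [h0, h1, h6, h7, hm, ha, hr]
    · rintro k - s'' ⟨h0, h1, h6, h7, h2, h3, ha, hr, ht⟩
      simp [h0, h1, h6, h7, h2, h3, ha, hr]
      exact ⟨by ring, by omega⟩
    · rintro s'' ⟨h0, h1, h6, h7, h2, h3, ha, hr, ht'⟩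
      have e : numSuper n d * d + (numSuper n d * d + numSuper n d * d) = coreSize n d := by
        rw [coreSize]; ring
      have hle := numSuper_le (n := n) hd0
      simp only [does_seq_setN, does_setN]
      refine ⟨⟨?_, ?_, ?_, ?_, ?_, ?_, ?_, ?_⟩, ha, hr, ?_⟩
      all_goals simp [h0, h1, h2, h3, h6, h7, e, numPairs]
      omega

/-! ### Selection of the core -/

/-- `j` comes before `i` in the order by decreasing cost. -/
def Before (c : ℕ → ℝ) (j i : ℕ) : Prop := c i < c j ∨ c j = c i ∧ j < i

open Classical in
/-- The number of elements before `i`. -/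
noncomputable def rank (c : ℕ → ℝ) (n i : ℕ) : ℕ :=
  ((Finset.range n).filter fun j => Before c j i).card

section Rank

variable {c : ℕ → ℝ} {n : ℕ}

lemma rank_lt_of_before {a b : ℕ} (ha : a < n) (h : Before c a b) : rank c n a < rank c n b := by
  classical
  refine Finset.card_lt_card (Finset.ssubset_iff_of_subset (fun j hj => ?_) |>.2 ⟨a, ?_, ?_⟩)
  · rw [Finset.mem_filter] at hj ⊢
    refine ⟨hj.1, ?_⟩
    rcases hj.2 with h1 | ⟨h1, h2⟩ <;> rcases h with h3 | ⟨h3, h4⟩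
    · exact Or.inl (h3.trans h1)
    · exact Or.inl (h3 ▸ h1)
    · exact Or.inl (h1 ▸ h3)
    · exact Or.inr ⟨h1.trans h3, h2.trans h4⟩
  · exact Finset.mem_filter.2 ⟨Finset.mem_range.2 ha, h⟩
  · intro h'
    rcases (Finset.mem_filter.1 h').2 with h1 | h1
    · exact lt_irrefl _ h1
    · exact lt_irrefl _ h1.2

lemma before_trichotomy (a b : ℕ) : Before c a b ∨ a = b ∨ Before c b a := by
  rcases lt_trichotomy (c a) (c b) with h | h | h
  · exact Or.inr (Or.inr (Or.inl h))
  · rcases lt_trichotomy a b with h' | h' | h'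
    · exact Or.inl (Or.inr ⟨h, h'⟩)
    · exact Or.inr (Or.inl h')
    · exact Or.inr (Or.inr (Or.inr ⟨h.symm, h'⟩))
  · exact Or.inl (Or.inl h)

lemma rank_injOn : Set.InjOn (rank c n) (Finset.range n) := by
  intro a ha b hb h
  simp only [Finset.coe_range, Set.mem_Iio] at ha hb
  rcases before_trichotomy (c := c) a b with h' | h' | h'
  · exact absurd h (rank_lt_of_before ha h').ne
  · exact h'
  · exact absurd h (rank_lt_of_before hb h').ne'

lemma rank_lt {a : ℕ} (ha : a < n) : rank c n a < n := by
  classical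
  conv_rhs => rw [← Finset.card_range n]
  refine Finset.card_lt_card (Finset.filter_ssubset.2 ⟨a, Finset.mem_range.2 ha, ?_⟩)
  rintro (h | h)
  · exact lt_irrefl _ h
  · exact lt_irrefl _ h.2

/-- As ties are broken by index, `Before` is a strict total order. The ranks are therefore a
permutation of 0, …, n − 1, and exactly k of them are below k. -/
lemma card_rank_lt {k : ℕ} (hk : k ≤ n) :
    ((Finset.range n).filter fun i => rank c n i < k).card = k := by
  have himg : (Finset.range n).image (rank c n) = Finset.range n := by
    refine Finset.eq_of_subset_of_card_le (fun x hx => ?_) ?_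
    · obtain ⟨a, ha, rfl⟩ := Finset.mem_image.1 hx
      exact Finset.mem_range.2 (rank_lt (Finset.mem_range.1 ha))
    · rw [Finset.card_image_of_injOn rank_injOn]
  rw [← Finset.card_image_of_injOn (rank_injOn.mono (Finset.coe_subset.2 (Finset.filter_subset _ _)))]
  have : ((Finset.range n).filter fun i => rank c n i < k).image (rank c n) =
      ((Finset.range n).image (rank c n)).filter fun x => x < k := by
    rw [Finset.filter_image]
  rw [this, himg]
  have h2 : (Finset.range n).filter (fun x => x < k) = Finset.range k := by
    ext x; simp; omega
  rw [h2, Finset.card_range]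

lemma le_of_rank_lt {a b : ℕ} (hb : b < n) (h : rank c n a < rank c n b) : c b ≤ c a := by
  rcases before_trichotomy (c := c) a b with h' | h' | h'
  · rcases h' with h' | h'
    · exact h'.le
    · exact h'.1.ge
  · rw [h']
  · exact absurd h (rank_lt_of_before hb h').not_gt

end Rank

/-- Mark the elements of the core of a league in row `0` of array `2`; the codes of the teams of
the league start at the content of register `20`, those of the other league at that of `21`. -/
def Prog.selectLeague : Prog :=
  .seq
    (.loop 10 (.reg 0) <|
      .seq (.setN 12 (.add (.reg 20) (.reg 10))) <|
      .seq (.setR 0 .zero) <|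
      .seq (.loop 11 (.reg 0)
        (.setR 0 (.add (.reg 0) (.arr 0 (.reg 12) (.add (.reg 21) (.reg 11)))))) <|
      .setRArr 1 (.lit 0) (.reg 10) (.reg 0))
    (.loop 10 (.reg 0) <|
      .seq (.setN 13 (.lit 0)) <|
      .seq (.loop 11 (.reg 0) <|
        .ite (.rle (.arr 1 (.lit 0) (.reg 11)) (.arr 1 (.lit 0) (.reg 10)))
          (.ite (.rle (.arr 1 (.lit 0) (.reg 10)) (.arr 1 (.lit 0) (.reg 11)))
            (.ite (.nle (.add (.reg 11) (.lit 1)) (.reg 10))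
              (.setN 13 (.add (.reg 13) (.lit 1))) .skip)
            .skip)
          (.setN 13 (.add (.reg 13) (.lit 1)))) <|
      .ite (.nle (.add (.reg 13) (.lit 1)) (.reg 4))
        (.setNArr 2 (.lit 0) (.add (.reg 20) (.reg 10)) (.lit 1)) .skip)

-- Comparing every team with all others gives the ranks in quadratic time without sorting. Marks
-- outside of the league are preserved, so that the program can be run once for each league.
open Classical in
lemma does_selectLeague {n k off off' : ℕ} {s : MState} (h0 : s.nreg 0 = n) (h4 : s.nreg 4 = k)
    (h20 : s.nreg 20 = off) (h21 : s.nreg 21 = off') :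
    Does .selectLeague s fun s' =>
      s'.nreg 0 = n ∧ s'.nreg 4 = k ∧ s'.rarr 0 = s.rarr 0 ∧
      (∀ z, s'.narr 2 0 z = if off ≤ z ∧ z < off + n ∧
        rank (fun i => ∑ j ∈ Finset.range n, s.rarr 0 (off + i) (off' + j)) n (z - off) < k
          then 1 else s.narr 2 0 z) ∧
      s'.time ≤ s.time + 100 * (n + 1) * (n + 1) := by
  set c : ℕ → ℝ := fun i => ∑ j ∈ Finset.range n, s.rarr 0 (off + i) (off' + j) with hc
  have bound1 : ∀ j k : ℕ, (k + 1) * (30 + 10 * n) = k * (30 + 10 * n) + 30 + 10 * n := by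
    intros; ring
  have bound2 : ∀ j k : ℕ, (k + 1) * (30 + 30 * n) = k * (30 + 30 * n) + 30 + 30 * n := by
    intros; ring
  rw [Prog.selectLeague]
  refine Does.seq (Does.loop (N := n) (fun i s' => s'.nreg 0 = n ∧ s'.nreg 4 = k ∧
    s'.nreg 20 = off ∧ s'.nreg 21 = off' ∧ s'.rarr 0 = s.rarr 0 ∧ s'.narr = s.narr ∧
    (∀ a < i, s'.rarr 1 0 a = c a) ∧ s'.time ≤ s.time + 2 + i * (30 + 10 * n)) (by simp [h0]) ?_ ?_ ?_)
  · simp [h0, h4, h20, h21]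
  · rintro i - s' ⟨h0, h4, h20, h21, hr, hn, h1, ht⟩
    simp only [does_seq_setN, does_seq_setR]
    refine Does.seq (Does.loop (N := n) (fun j s'' => s''.nreg 0 = n ∧ s''.nreg 4 = k ∧
      s''.nreg 20 = off ∧ s''.nreg 21 = off' ∧ s''.rarr 0 = s.rarr 0 ∧ s''.narr = s.narr ∧
      s''.nreg 10 = i ∧ s''.nreg 12 = off + i ∧
      (∀ a < i, s''.rarr 1 0 a = c a) ∧
      s''.rreg 0 = ∑ j ∈ Finset.range j, s.rarr 0 (off + i) (off' + j) ∧
      s''.time ≤ s'.time + 10 + 10 * j) (by simp [h0]) ?_ ?_ ?_)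
    · simp [h0, h4, h20, h21, hr, hn]
      exact h1
    · rintro j - s'' ⟨h0, h4, h20, h21, hr, hn, h10, h12, h1, hsum, ht⟩
      rw [does_setR]
      simp [h0, h4, h20, h21, hr, hn, h10, h12, hsum, Finset.sum_range_succ]
      exact ⟨h1, by omega⟩
    · rintro s'' ⟨h0, h4, h20, h21, hr, hn, h10, h12, h1, hsum, ht'⟩
      rw [does_setRArr]
      refine ⟨by simp [h0], by simp [h4], by simp [h20], by simp [h21], ?_, by simp [hn], ?_, ?_⟩
      · funext x y
        simp [hr]
      · intro a ha
        simp only [MState.tick_rarr, MState.setRArr_rarr, NExp.eval, h10, RExp.eval, hsum]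
        split_ifs with h
        · rw [hc, h.2.2]
        · exact h1 a (by have h' : a ≠ i := fun e => h ⟨trivial, trivial, e⟩; omega)
      · have := bound1 0 i
        simp
        omega
  · rintro s1 ⟨h0, h4, h20, h21, hr, hn, h1, ht⟩
    refine Does.loop (N := n) (fun i s' => s'.nreg 0 = n ∧ s'.nreg 4 = k ∧
      s'.nreg 20 = off ∧ s'.rarr 0 = s.rarr 0 ∧ (∀ a < n, s'.rarr 1 0 a = c a) ∧
      (∀ z, s'.narr 2 0 z = if off ≤ z ∧ z < off + i ∧ rank c n (z - off) < k
          then 1 else s.narr 2 0 z) ∧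
      s'.time ≤ s1.time + 2 + i * (30 + 30 * n)) (by simp [h0]) ?_ ?_ ?_
    · refine ⟨by simp [h0], by simp [h4], by simp [h20], by simp [hr], by simpa using h1, ?_, by simp⟩
      intro z
      rw [if_neg (by omega)]
      simp [hn]
    · rintro i hi s' ⟨h0, h4, h20, hr, h1, h2, ht⟩
      simp only [does_seq_setN]
      refine Does.seq (Does.loop (N := n) (fun j s'' => s''.nreg 0 = n ∧ s''.nreg 4 = k ∧
        s''.nreg 20 = off ∧ s''.rarr 0 = s.rarr 0 ∧ s''.nreg 10 = i ∧
        (∀ a < n, s''.rarr 1 0 a = c a) ∧ s''.narr 2 = s'.narr 2 ∧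
        s''.nreg 13 = ((Finset.range j).filter fun j => Before c j i).card ∧
        s''.time ≤ s'.time + 10 + 30 * j) (by simp [h0]) ?_ ?_ ?_)
      · refine ⟨by simp [h0], by simp [h4], by simp [h20], by simp [hr], by simp, by simpa using h1,
          by simp, by simp, by simp⟩
      · rintro j hj s'' ⟨h0, h4, h20, hr, h10, h1, h2, h13, ht⟩
        have hcard : ((Finset.range (j + 1)).filter fun j => Before c j i).card =
            (if Before c j i then s''.nreg 13 + 1 else s''.nreg 13) := by
          rw [Finset.range_add_one, Finset.filter_insert, h13]
          split_ifs
          · rw [Finset.card_insert_of_notMem (by simp)]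
          · rfl
        have hyes : ∀ (_ : Before c j i) (m : ℕ), m ≤ 23 →
            Does (.setN 13 (.add (.reg 13) (.lit 1))) (((s''.setN 11 j).tick 1).tick m)
            fun s'' => s''.nreg 0 = n ∧ s''.nreg 4 = k ∧
              s''.nreg 20 = off ∧ s''.rarr 0 = s.rarr 0 ∧ s''.nreg 10 = i ∧
              (∀ a < n, s''.rarr 1 0 a = c a) ∧ s''.narr 2 = s'.narr 2 ∧
              s''.nreg 13 = ((Finset.range (j + 1)).filter fun j => Before c j i).card ∧
              s''.time ≤ s'.time + 10 + 30 * (j + 1) := by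
          intro hb m hm
          rw [does_setN]
          refine ⟨by simp [h0], by simp [h4], by simp [h20], by simp [hr], by simp [h10],
            by simpa using h1, by simp [h2], ?_, ?_⟩
          · rw [hcard, if_pos hb]; simp
          · simp; omega
        have hno : ∀ (_ : ¬ Before c j i) (m : ℕ), m ≤ 26 →
            Does .skip (((s''.setN 11 j).tick 1).tick m)
            fun s'' => s''.nreg 0 = n ∧ s''.nreg 4 = k ∧
              s''.nreg 20 = off ∧ s''.rarr 0 = s.rarr 0 ∧ s''.nreg 10 = i ∧
              (∀ a < n, s''.rarr 1 0 a = c a) ∧ s''.narr 2 = s'.narr 2 ∧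
              s''.nreg 13 = ((Finset.range (j + 1)).filter fun j => Before c j i).card ∧
              s''.time ≤ s'.time + 10 + 30 * (j + 1) := by
          intro hb m hm
          rw [does_skip]
          refine ⟨by simp [h0], by simp [h4], by simp [h20], by simp [hr], by simp [h10],
            by simpa using h1, by simp [h2], ?_, ?_⟩
          · rw [hcard, if_neg hb]; simp
          · simp; omega
        have e1 : s''.rarr 1 0 j = c j := h1 j hj
        have e2 : s''.rarr 1 0 i = c i := h1 i hi
        have htick : ∀ (s : MState) a b, (s.tick a).tick b = s.tick (a + b) := fun s a b => by
          simp only [MState.tick, add_assoc]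
        -- Comparing the costs in both directions distinguishes larger, equal and smaller; the index
        -- is consulted only for equal costs.
        refine Does.ite (fun hb => ?_) fun hb => ?_
        · simp [e1, e2, h10] at hb
          refine Does.ite (fun hb2 => ?_) fun hb2 => ?_
          · simp [e1, e2, h10] at hb2
            refine Does.ite (fun hb3 => ?_) fun hb3 => ?_
            · simp [h10] at hb3
              rw [htick, htick]
              exact hyes (Or.inr ⟨le_antisymm hb hb2, by omega⟩) _ (by norm_num)
            · simp [h10] at hb3
              rw [htick, htick]
              refine hno ?_ _ (by norm_num)
              rintro (h | h)
              · linarith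
              · omega
          · simp [e1, e2, h10] at hb2
            rw [htick]
            refine hno ?_ _ (by norm_num)
            rintro (h | h)
            · linarith
            · linarith [h.1]
        · simp [e1, e2, h10] at hb
          exact hyes (Or.inl hb) _ (by norm_num)
      · rintro s'' ⟨h0, h4, h20, hr, h10, h1, h2', h13, ht'⟩
        have h13' : s''.nreg 13 = rank c n i := h13
        have hb2 := bound2 0 i
        refine Does.ite (fun hb => ?_) fun hb => ?_
        · simp [h13', h4] at hb
          rw [does_setNArr]
          refine ⟨by simp [h0], by simp [h4], by simp [h20], by simp [hr], by simpa using h1, ?_, ?_⟩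
          · intro z
            simp only [MState.tick_narr, MState.setNArr_narr, NExp.eval, MState.tick_nreg, h20, h10,
              true_and, h2', h2]
            by_cases hz : z = off + i
            · subst hz
              simp
              intro h; omega
            · rw [if_neg hz]
              exact if_congr (by omega) rfl rfl
          · simp; omega
        · simp [h13', h4] at hb
          rw [does_skip]
          refine ⟨by simp [h0], by simp [h4], by simp [h20], by simp [hr], by simpa using h1, ?_, ?_⟩
          · intro z
            simp only [MState.tick_narr, h2', h2]
            refine if_congr ⟨fun h => ⟨h.1, by omega, h.2.2⟩, fun h => ⟨h.1, ?_, h.2.2⟩⟩ rfl rfl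
            by_contra hz
            have : z - off = i := by omega
            rw [this] at h
            omega
          · simp; omega
    · rintro s' ⟨h0, h4, h20, hr, h1', h2, ht'⟩
      refine ⟨h0, h4, hr, h2, ?_⟩
      nlinarith

/-- Mark the elements of the core. -/
def Prog.select : Prog :=
  .seq .params <|
  .seq (.setN 20 (.lit 0)) <| .seq (.setN 21 (.reg 0)) <| .seq .selectLeague <|
  .seq (.setN 20 (.reg 0)) <| .seq (.setN 21 (.lit 0)) <| .selectLeague

lemma code_injective (n : ℕ) : Function.Injective (code (n := n)) := by
  rintro (⟨a, ha⟩ | ⟨a, ha⟩) (⟨b, hb⟩ | ⟨b, hb⟩) h <;> simp [code] at h ⊢ <;> omega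

lemma Inst.table_code {n : ℕ} (I : Inst n) (u v : Team n) : I.table (code u) (code v) = I.w u v := by
  classical
  rw [Inst.table, Finset.sum_eq_single u, Finset.sum_eq_single v]
  · simp
  · intro b _ hb
    rw [if_neg fun h => hb (code_injective n h.2)]
  · simp
  · intro b _ hb
    exact Finset.sum_eq_zero fun x _ => if_neg fun h => hb (code_injective n h.1)
  · simp

open Classical in
lemma isTop_of_rank {n k : ℕ} (hk : k ≤ n) {L : Finset (Team n)} {f : Fin n → Team n}
    (hf : Function.Injective f) (hL : L = Finset.univ.image f) {cost : Team n → ℝ} {c : ℕ → ℝ}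
    (hc : ∀ i, cost (f i) = c i) :
    IsTop L cost k ((Finset.univ.filter fun i : Fin n => rank c n i < k).image f) := by
  subst hL
  refine ⟨Finset.image_subset_image (Finset.filter_subset _ _), ?_, ?_⟩
  · rw [Finset.card_image_of_injective _ hf]
    refine Eq.trans ?_ (card_rank_lt (c := c) hk)
    refine Finset.card_bij (fun i _ => (i : ℕ)) (fun i hi => ?_) (fun i _ j _ h => Fin.ext h)
      fun b hb => ?_
    · simpa using hi
    · rw [Finset.mem_filter, Finset.mem_range] at hb
      exact ⟨⟨b, hb.1⟩, by simpa using hb.2, rfl⟩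
  · intro a ha b hb hba
    obtain ⟨i, hi, rfl⟩ := Finset.mem_image.1 ha
    obtain ⟨j, -, rfl⟩ := Finset.mem_image.1 hb
    rw [hc, hc]
    rw [Finset.mem_filter] at hi
    refine le_of_rank_lt j.2 (lt_of_lt_of_le hi.2 ?_)
    by_contra hlt
    exact hba (Finset.mem_image_of_mem f (Finset.mem_filter.2 ⟨Finset.mem_univ j, by omega⟩))

lemma exists_select {n d : ℕ} (H : Admissible n d) (I : Inst n) : ∃ Xε Yε : Finset (Team n),
    IsTop (leagueX n) (I.delta (leagueY n)) (coreSize n d) Xε ∧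
    IsTop (leagueY n) (I.delta (leagueX n)) (coreSize n d) Yε ∧
    Does .select (coreInput d I) fun s => s.time ≤ 1000 * n ^ 2 ∧ ShowsSet s (Xε ∪ Yε) := by
  classical
  have hk : coreSize n d ≤ n := by have := H.core_add; omega
  have hn : 3 ≤ n := by have := H.core_add; have := H.le_pairs; have := H.six_le; omega
  set cX : ℕ → ℝ := fun i => ∑ j ∈ Finset.range n, I.table (0 + i) (n + j) with hcX
  set cY : ℕ → ℝ := fun i => ∑ j ∈ Finset.range n, I.table (n + i) (0 + j) with hcY
  have hX : ∀ i : Fin n, I.delta (leagueY n) (Sum.inl i) = cX i := fun i => by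
    rw [leagueY_eq, Inst.delta, Finset.sum_image fun a _ b _ h => Sum.inr_injective h, hcX]
    simp only [Finset.sum_range, zero_add]
    exact Finset.sum_congr rfl fun j _ => (I.table_code (Sum.inl i) (Sum.inr j)).symm
  have hY : ∀ i : Fin n, I.delta (leagueX n) (Sum.inr i) = cY i := fun i => by
    rw [leagueX_eq, Inst.delta, Finset.sum_image fun a _ b _ h => Sum.inl_injective h, hcY]
    simp only [Finset.sum_range, zero_add]
    exact Finset.sum_congr rfl fun j _ => (I.table_code (Sum.inr i) (Sum.inl j)).symm
  refine ⟨_, _, isTop_of_rank hk Sum.inl_injective (leagueX_eq n) hX,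
    isTop_of_rank hk Sum.inr_injective (leagueY_eq n) hY, ?_⟩
  rw [Prog.select]
  refine Does.seq ((does_params (n := n) (d := d) (by simp [coreInput]) (by simp [coreInput])
    (by have := H.six_le; omega)).mono ?_)
  rintro s ⟨hp, ha, hr, ht⟩
  simp only [does_seq_setN]
  refine Does.seq ((does_selectLeague (n := n) (k := coreSize n d) (off := 0) (off' := n)
    (by simp [hp.r0]) (by simp [hp.r4]) (by simp) (by simp [hp.r0])).mono ?_)
  rintro s' ⟨h0, h4, hr', h2, ht'⟩
  simp only [does_seq_setN]
  refine (does_selectLeague (n := n) (k := coreSize n d) (off := n) (off' := 0)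
    (by simp [h0]) (by simp [h4]) (by simp [h0]) (by simp)).mono ?_
  rintro s'' ⟨h0', h4', hr'', h2', ht''⟩
  have htab : ∀ i j, s.rarr 0 i j = I.table i j := fun i j => by rw [hr]; simp [coreInput]
  have hzero : ∀ i j, s.narr 2 i j = 0 := fun i j => by rw [ha]; simp [coreInput]
  constructor
  · simp [coreInput] at ht ht' ht''
    nlinarith
  · simp only [MState.tick_rarr, MState.setN_rarr, MState.tick_narr, MState.setN_narr, hr', htab,
      hzero] at h2 h2'
    change ∀ z, s'.narr 2 0 z = if 0 ≤ z ∧ z < 0 + n ∧ rank cX n (z - 0) < coreSize n d then 1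
      else 0 at h2
    change ∀ z, s''.narr 2 0 z = if n ≤ z ∧ z < n + n ∧ rank cY n (z - n) < coreSize n d then 1
      else s'.narr 2 0 z at h2'
    rintro (i | i)
    · rw [h2', h2]
      have hi := i.2
      simp only [code, zero_le, true_and, zero_add, Nat.sub_zero]
      rw [if_neg (by omega)]
      simp
    · rw [h2', h2]
      have hi := i.2
      simp only [code, zero_le, true_and, zero_add, Nat.sub_zero]
      rw [if_neg (c := n + (i : ℕ) < n ∧ _) (by omega)]
      simp

/-! ### Tables -/

/-- Tabulate the multiples of `3 * d` in row `0` of array `5`, and the parities in row `1`. -/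
def Prog.tables : Prog :=
  .seq (.setN 11 (.lit 0)) <|
  .seq (.loop 10 (.add (.reg 2) (.lit 1)) <|
    .seq (.setNArr 5 (.lit 0) (.reg 10) (.reg 11)) (.setN 11 (.add (.reg 11) (.reg 6)))) <|
  .seq (.setN 11 (.lit 0)) <|
  .loop 10 (.add (.reg 0) (.reg 0)) <|
    .seq (.setNArr 5 (.lit 1) (.reg 10) (.reg 11)) (.setN 11 (.sub (.lit 1) (.reg 11)))

/-- Array `5` contains the multiples of `3 * d` and the parities. -/
structure HasTables (n d : ℕ) (s : MState) : Prop where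
  mult : ∀ i ≤ numSuper n d, s.narr 5 0 i = 3 * d * i
  parity : ∀ t < 2 * n, s.narr 5 1 t = t % 2

lemma does_tables {n d : ℕ} {s : MState} (hp : HasParams n d s) (hd : 0 < d) :
    Does .tables s fun s' => HasParams n d s' ∧ HasTables n d s' ∧
      (∀ a ≠ 5, s'.narr a = s.narr a) ∧ s'.time ≤ s.time + 40 * n + 50 := by
  have hm := numSuper_le (n := n) hd
  rw [Prog.tables]
  simp only [does_seq_setN]
  refine Does.seq (Does.loop (N := numSuper n d + 1) (fun k s' => (∀ v < 8, s'.nreg v = s.nreg v) ∧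
    s'.nreg 11 = 3 * d * k ∧ (∀ i < k, s'.narr 5 0 i = 3 * d * i) ∧
    (∀ a ≠ 5, s'.narr a = s.narr a) ∧ s'.time ≤ s.time + 6 + 10 * k) (by simp [hp.r2]) ?_ ?_ ?_)
  · refine ⟨fun v hv => ?_, by simp, by simp, by simp, by simp⟩
    have : v ≠ 11 := by omega
    simp [this]
  · rintro k - s' ⟨hr, h11, hA, hn, ht⟩
    simp only [does_seq_setNArr, does_setN]
    refine ⟨fun v hv => ?_, ?_, fun i hi => ?_, fun a ha => ?_, ?_⟩
    · have h1 : v ≠ 11 := by omega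
      have h2 : v ≠ 10 := by omega
      simp [h1, h2, hr v hv]
    · simp [h11, hr 6, hp.r6]
      ring
    · rcases Nat.lt_succ_iff_lt_or_eq.1 hi with h | rfl
      · simp [h.ne, hA i h]
      · simp [h11]
    · funext i j
      simp [ha, hn a ha]
    · simp
      omega
  · rintro s1 ⟨hr, h11, hA, hn, ht⟩
    rw [does_seq_setN]
    refine Does.loop (N := n + n) (fun k s' => (∀ v < 8, s'.nreg v = s.nreg v) ∧
      s'.nreg 11 = k % 2 ∧ (∀ t < k, s'.narr 5 1 t = t % 2) ∧ s'.narr 5 0 = s1.narr 5 0 ∧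
      (∀ a ≠ 5, s'.narr a = s.narr a) ∧ s'.time ≤ s1.time + 6 + 10 * k)
      (by simp [hr 0, hp.r0]) ?_ ?_ ?_
    · refine ⟨fun v hv => ?_, by simp, by simp, by simp, fun a ha => by simp [hn a ha], by simp⟩
      have : v ≠ 11 := by omega
      simp [this, hr v hv]
    · rintro k - s' ⟨hr, h11, hA, h0, hn, ht⟩
      simp only [does_seq_setNArr, does_setN]
      refine ⟨fun v hv => ?_, ?_, fun i hi => ?_, ?_, fun a ha => ?_, ?_⟩
      · have h1 : v ≠ 11 := by omega
        have h2 : v ≠ 10 := by omega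
        simp [h1, h2, hr v hv]
      · simp [h11]
        omega
      · rcases Nat.lt_succ_iff_lt_or_eq.1 hi with h | rfl
        · simp [h.ne, hA i h]
        · simp [h11]
      · funext j
        simp [h0]
      · funext i j
        simp [ha, hn a ha]
      · simp
        omega
    · rintro s2 ⟨hr', -, hA', h0, hn', ht'⟩
      refine ⟨hp.of_frame hr', ⟨fun i hi => ?_, fun t ht => hA' t (by omega)⟩, hn', by omega⟩
      rw [h0]
      exact hA i (by omega)

/-! ### Labels -/

/-- Write the codes of the teams of a league into row `a` of array `4`, in the order of their
labels: first the paths, in the order in row `a` of array `6`, then the remaining teams. The codes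
of the teams of the league start at the content of register `15`. -/
def Prog.labels (a : ℕ) : Prog :=
  .seq (.setN 12 (.lit 0)) <|
  .seq (.loop 10 (.reg 3) <|
    .seq (.setN 13 (.arr 6 (.lit a) (.reg 10))) <|
    .loop 11 (.lit 3) <|
      .seq (.setN 14 (.arr a (.reg 13) (.reg 11))) <|
      .seq (.setNArr 4 (.lit a) (.reg 12) (.reg 14)) <|
      .seq (.setNArr 7 (.lit a) (.reg 14) (.lit 1)) <|
      .setN 12 (.add (.reg 12) (.lit 1))) <|
  .loop 10 (.reg 0) <|
    .seq (.setN 14 (.add (.reg 10) (.reg 15))) <|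
    .ite (.neq (.arr 7 (.lit a) (.reg 14)) (.lit 1)) .skip <|
      .seq (.setNArr 4 (.lit a) (.reg 12) (.reg 14)) <|
      .setN 12 (.add (.reg 12) (.lit 1))

/-- What `Prog.labels` leaves unchanged. -/
structure LabelFrame (a : ℕ) (s s' : MState) : Prop where
  nreg : ∀ v < 10, s'.nreg v = s.nreg v
  r15 : s'.nreg 15 = s.nreg 15
  narr : ∀ b i j, ¬ ((b = 4 ∨ b = 7) ∧ i = a) → s'.narr b i j = s.narr b i j

-- Array 7 marks the codes that occur on paths, and the second loop appends the unmarked ones. In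
-- the end every code of the league is listed exactly once, so the length of the list is n.
open Classical in
lemma does_labels_raw {a n K core off : ℕ} {s : MState} (ha : a < 4) {e : ℕ → ℕ} (h0 : s.nreg 0 = n)
    (h3 : s.nreg 3 = K) (h15 : s.nreg 15 = off) (hcore : core = 3 * K)
    (he : ∀ u < K, ∀ c < 3, s.narr a (s.narr 6 a u) c = e (3 * u + c))
    (heinj : ∀ i < core, ∀ j < core, e i = e j → i = j)
    (heoff : ∀ i < core, off ≤ e i ∧ e i < off + n) (h7 : ∀ z, s.narr 7 a z = 0) :
    Does (.labels a) s fun s' => LabelFrame a s s' ∧ (∀ i < core, s'.narr 4 a i = e i) ∧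
      (∀ i < n, off ≤ s'.narr 4 a i ∧ s'.narr 4 a i < off + n) ∧
      (∀ i < n, ∀ j < n, s'.narr 4 a i = s'.narr 4 a j → i = j) ∧
      s'.time ≤ s.time + 100 * K + 40 * n + 50 := by
  have h4a : (4 : ℕ) ≠ a := by omega
  have h7a : (7 : ℕ) ≠ a := by omega
  have ha4 : a ≠ 4 := by omega
  have ha7 : a ≠ 7 := by omega
  have ha6 : a ≠ 6 := by omega
  set Inv : ℕ → MState → Prop := fun N s' => LabelFrame a s s' ∧ s'.nreg 12 = N ∧
    (∀ i < N, s'.narr 4 a i = e i) ∧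
    (∀ z, s'.narr 7 a z = if ∃ i < N, e i = z then 1 else 0) with hInv
  rw [Prog.labels]
  simp only [does_seq_setN]
  refine Does.seq (Does.loop (N := K) (fun u s' => Inv (3 * u) s' ∧
    s'.time ≤ s.time + 4 + 90 * u) (by simp [h3]) ?_ ?_ ?_)
  · refine ⟨⟨⟨fun v hv => ?_, by simp, by simp⟩, by simp, by simp, by simp [h7]⟩, by simp⟩
    have : v ≠ 12 := by omega
    simp [this]
  · rintro u hu s1 ⟨⟨hf, h12, hA, hB⟩, ht⟩
    simp only [does_seq_setN]
    refine Does.loop (N := 3) (fun c s2 => Inv (3 * u + c) s2 ∧ s2.nreg 13 = s.narr 6 a u ∧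
      s2.nreg 10 = u ∧ s2.time ≤ s1.time + 10 + 20 * c) (by simp) ?_ ?_ ?_
    · refine ⟨⟨⟨fun v hv => ?_, by simp [hf.r15], fun b i j hb => ?_⟩, by simp [h12],
        by simpa using hA, by simpa using hB⟩, ?_, by simp, by simp⟩
      · have h1 : v ≠ 13 := by omega
        have h2 : v ≠ 10 := by omega
        simp [h1, h2, hf.nreg v hv]
      · simp [hf.narr b i j hb]
      · have := hf.narr 6 a u (by omega)
        simp [this]
    · rintro c hc s2 ⟨⟨hf, h12, hA, hB⟩, h13, h10, ht⟩
      have hval : s2.narr a (s.narr 6 a u) c = e (3 * u + c) := by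
        rw [hf.narr a _ c (by omega), he u hu c hc]
      simp only [does_seq_setN, does_seq_setNArr, does_setN]
      refine ⟨⟨⟨fun v hv => ?_, ?_, fun b i j hb => ?_⟩, ?_, fun i hi => ?_, fun z => ?_⟩, ?_, ?_, ?_⟩
      · have h1 : v ≠ 14 := by omega
        have h2 : v ≠ 11 := by omega
        have h3 : v ≠ 12 := by omega
        simp [h1, h2, h3, hf.nreg v hv]
      · simp [hf.r15]
      · have h1 : ∀ z, ¬ (b = 4 ∧ i = a ∧ j = z) := by omega
        have h2 : ∀ z, ¬ (b = 7 ∧ i = a ∧ j = z) := by omega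
        simp [h1, h2, hf.narr b i j hb]
      · simp [h12]
        omega
      · rcases Nat.lt_succ_iff_lt_or_eq.1 (show i < 3 * u + c + 1 by omega) with h | rfl
        · simp [h12, h.ne, hA i h]
        · simp [h12, h13, hval]
      · by_cases hz : z = e (3 * u + c)
        · subst hz
          rw [if_pos ⟨3 * u + c, by omega, rfl⟩]
          simp [h13, hval]
        · simp [h13, hval, hz, hB]
          refine if_congr ⟨fun ⟨i, hi, h⟩ => ⟨i, by omega, h⟩, fun ⟨i, hi, h⟩ => ⟨i, ?_, h⟩⟩ rfl rfl
          by_contra hge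
          exact hz (by rw [← h]; congr 1; omega)
      · simp [h13]
      · simp [h10]
      · simp
        omega
    · rintro s2 ⟨hI, -, -, ht'⟩
      exact ⟨hI, by omega⟩
  · rintro s1 ⟨⟨hf, h12, hA, hB⟩, ht⟩
    rw [← hcore] at h12 hA hB
    -- After k rounds the codes listed so far are distinct, those beyond the core are unmarked and
    -- below off + k, and every code of the league below off + k is listed.
    refine Does.loop (N := n) (fun k s2 => LabelFrame a s s2 ∧ (∀ i < core, s2.narr 4 a i = e i) ∧
      s2.narr 7 a = s1.narr 7 a ∧ core ≤ s2.nreg 12 ∧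
      (∀ i < s2.nreg 12, core ≤ i → off ≤ s2.narr 4 a i ∧ s2.narr 4 a i < off + k ∧
        s1.narr 7 a (s2.narr 4 a i) = 0) ∧
      (∀ i < s2.nreg 12, ∀ j < s2.nreg 12, s2.narr 4 a i = s2.narr 4 a j → i = j) ∧
      (∀ z, off ≤ z → z < off + k → ∃ i < s2.nreg 12, s2.narr 4 a i = z) ∧
      s2.time ≤ s1.time + 2 + 30 * k) (by simp [hf.nreg 0, h0]) ?_ ?_ ?_
    · refine ⟨⟨by simpa using hf.nreg, by simp [hf.r15], by simpa using hf.narr⟩, by simpa using hA,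
        by simp, by simp [h12], ?_, ?_, by intros; omega, by simp⟩
      · simp only [MState.tick_nreg, h12]
        omega
      · simp only [MState.tick_nreg, h12, MState.tick_narr]
        intro i hi j hj h
        rw [hA i hi, hA j hj] at h
        exact heinj i hi j hj h
    · rintro k hk s2 ⟨hf, hA', h7', hle, hnew, hinj, hall, ht⟩
      have hused : ∀ i < core, s1.narr 7 a (s2.narr 4 a i) = 1 := fun i hi => by
        rw [hB, if_pos ⟨i, hi, (hA' i hi).symm⟩]
      have h15' : s2.nreg 15 = off := hf.r15.trans h15
      simp only [does_seq_setN]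
      refine Does.ite (fun hb => ?_) fun hb => ?_
      · simp [h15', h7', hB] at hb
        obtain ⟨i, hi, hei⟩ := hb
        rw [does_skip]
        refine ⟨⟨fun v hv => ?_, by simp [hf.r15], fun b i j hb => ?_⟩, by simpa using hA',
          by simp [h7'], by simpa using hle, ?_, by simpa using hinj, ?_, ?_⟩
        · have h1 : v ≠ 14 := by omega
          have h2 : v ≠ 10 := by omega
          simp [h1, h2, hf.nreg v hv]
        · simp [hf.narr b i j hb]
        · simp
          intro i hi hi'
          have := hnew i hi hi'
          exact ⟨this.1, by omega, this.2.2⟩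
        · simp
          intro z hz hz'
          rcases Nat.lt_succ_iff_lt_or_eq.1 (show z < off + k + 1 by omega) with h | rfl
          · exact hall z hz h
          · exact ⟨i, by omega, by rw [hA' i hi, hei, add_comm]⟩
        · simp
          omega
      · simp [h15', h7', hB] at hb
        have hz0 : s1.narr 7 a (k + off) = 0 := by
          rw [hB, if_neg]
          rintro ⟨i, hi, h⟩
          exact hb i hi h
        have hfresh : ∀ i < s2.nreg 12, s2.narr 4 a i ≠ k + off := by
          intro i hi h
          by_cases hic : i < core
          · have := hused i hic
            rw [h, hz0] at this
            omega
          · have := hnew i hi (by omega)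
            omega
        simp only [does_seq_setNArr, does_setN]
        refine ⟨⟨fun v hv => ?_, by simp [hf.r15], fun b i j hb => ?_⟩, fun i hi => ?_, ?_, ?_, ?_, ?_,
          ?_, ?_⟩
        · have h1 : v ≠ 14 := by omega
          have h2 : v ≠ 10 := by omega
          have h3 : v ≠ 12 := by omega
          simp [h1, h2, h3, hf.nreg v hv]
        · have h1 : ∀ z, ¬ (b = 4 ∧ i = a ∧ j = z) := by omega
          simp [h1, hf.narr b i j hb]
        · have h1 : i ≠ s2.nreg 12 := by omega
          simp [h1, hA' i hi]
        · funext z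
          simp [h7']
        · simp
          omega
        · simp [h15']
          intro i hi hi'
          rcases Nat.lt_succ_iff_lt_or_eq.1 (Nat.lt_succ_of_le hi) with h | rfl
          · have := hnew i h hi'
            simp [h.ne]
            exact ⟨this.1, by omega, this.2.2⟩
          · simp [hz0]
            omega
        · simp [h15']
          intro i hi j hj
          rcases Nat.lt_succ_iff_lt_or_eq.1 (Nat.lt_succ_of_le hi) with h | rfl <;>
            rcases Nat.lt_succ_iff_lt_or_eq.1 (Nat.lt_succ_of_le hj) with h' | rfl
          · simp [h.ne, h'.ne]
            exact hinj i h j h'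
          · simp [h.ne]
            exact fun h2 => absurd h2 (hfresh i h)
          · simp [h'.ne]
            exact fun h2 => absurd h2.symm (hfresh j h')
          · simp
        · simp [h15']
          intro z hz hz'
          rcases Nat.lt_succ_iff_lt_or_eq.1 (show z < off + k + 1 by omega) with h | rfl
          · obtain ⟨i, hi, rfl⟩ := hall z hz h
            exact ⟨i, by omega, by simp [hi.ne]⟩
          · exact ⟨s2.nreg 12, by omega, by simp; omega⟩
        · simp
          omega
    · rintro s2 ⟨hf, hA', h7', hle, hnew, hinj, hall, ht'⟩
      have hmem : ∀ i < s2.nreg 12, off ≤ s2.narr 4 a i ∧ s2.narr 4 a i < off + n := by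
        intro i hi
        by_cases hic : i < core
        · rw [hA' i hic]
          exact heoff i hic
        · have := hnew i hi (by omega)
          exact ⟨this.1, this.2.1⟩
      have hn : s2.nreg 12 = n := by
        have himg : (Finset.range (s2.nreg 12)).image (s2.narr 4 a) = Finset.Ico off (off + n) := by
          ext z
          rw [Finset.mem_image, Finset.mem_Ico]
          constructor
          · rintro ⟨i, hi, rfl⟩
            exact hmem i (Finset.mem_range.1 hi)
          · rintro ⟨h1, h2⟩
            obtain ⟨i, hi, h⟩ := hall z h1 h2
            exact ⟨i, Finset.mem_range.2 hi, h⟩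
        have := congrArg Finset.card himg
        rw [Finset.card_image_of_injOn, Finset.card_range, Nat.card_Ico] at this
        · omega
        · intro i hi j hj h
          exact hinj i (by simpa using hi) j (by simpa using hj) h
      rw [hn] at hmem hinj
      exact ⟨hf, hA', hmem, hinj, by omega⟩

lemma does_labels {a n d K off : ℕ} {s : MState} (H : Admissible n d) (ha : a < 4)
    (hp : HasParams n d s) (hK : K = numSuper n d * d) (h15 : s.nreg 15 = off) {L A : Finset (Team n)} (hAL : A ⊆ L)
    (hL : ∀ v, v ∈ L ↔ off ≤ code v ∧ code v < off + n)
    (hoff : ∀ z, off ≤ z → z < off + n → ∃ v : Team n, code v = z)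
    (P : Packing K A) (σ : Equiv.Perm (Fin K))
    (hP : ∀ i j, s.narr a i j = P.table i j) (hσ : ∀ i : Fin K, s.narr 6 a i = σ i)
    (h7 : ∀ z, s.narr 7 a z = 0) :
    Does (.labels a) s fun s' => LabelFrame a s s' ∧
      (∃ x, IsLabeling L P σ x ∧ ∀ i : Fin n, s'.narr 4 a i = code (x i)) ∧
      s'.time ≤ s.time + 140 * n + 50 := by
  have hcore := coreSize_eq_three_mul n d
  have hadd := H.core_add
  rw [← hK] at hcore
  set e : ℕ → ℕ := fun i => if h : i / 3 < K then
    code (P.vtx (σ ⟨i / 3, h⟩) ⟨i % 3, Nat.mod_lt _ (by norm_num)⟩) else 0 with he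
  have he' : ∀ (u : Fin K) (c : Fin 3), e (3 * u + c) = code (P.vtx (σ u) c) := by
    intro u c
    have h1 : (3 * (u : ℕ) + c) / 3 = u := by omega
    have h2 : (3 * (u : ℕ) + c) % 3 = c := by omega
    simp only [he, h1, h2, u.2, dif_pos, Fin.eta]
  have hdec : ∀ i < coreSize n d, ∃ (u : Fin K) (c : Fin 3), i = 3 * (u : ℕ) + (c : ℕ) := by
    intro i hi
    exact ⟨⟨i / 3, by omega⟩, ⟨i % 3, by omega⟩, by simp only; omega⟩
  refine (does_labels_raw (off := off) ha (e := e) hp.r0 (hp.r3.trans hK.symm) h15 hcore ?_ ?_ ?_ h7).mono ?_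
  · intro u hu c hc
    have := hσ ⟨u, hu⟩
    simp only at this
    rw [this, hP, Packing.table, dif_pos ⟨(σ ⟨u, hu⟩).2, hc⟩]
    exact (he' ⟨u, hu⟩ ⟨c, hc⟩).symm
  · intro i hi j hj h
    obtain ⟨u, c, rfl⟩ := hdec i hi
    obtain ⟨u', c', rfl⟩ := hdec j hj
    rw [he', he'] at h
    obtain ⟨h1, h2⟩ := P.disjoint _ _ _ _ (code_injective n h)
    rw [σ.injective h1, h2]
  · intro i hi
    obtain ⟨u, c, rfl⟩ := hdec i hi
    rw [he']
    exact (hL _).1 (hAL ((P.covers _).2 ⟨_, _, rfl⟩))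
  · rintro s' ⟨hf, hA, hmem, hinj, ht⟩
    refine ⟨hf, ?_, by omega⟩
    choose x hx using fun i : Fin n => hoff _ (hmem i i.2).1 (hmem i i.2).2
    -- The program always reads a path in its given direction, hence `Or.inl`.
    refine ⟨x, ⟨fun i j h => ?_, fun j => ?_, fun i => Or.inl fun c j hj => ?_⟩, fun i => (hx i).symm⟩
    · refine Fin.ext (hinj i i.2 j j.2 ?_)
      rw [← hx, ← hx, h]
    · rw [hL, hx]
      exact hmem j j.2
    · refine code_injective n ?_
      rw [hx, hA j (by omega), hj, he']

/-! ### Writing games -/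

/-- Write a game into the timetable: the day and the labels of the two teams are in the registers
`30`, `31`, `32`, and register `33` tells if the first team plays at home. -/
def Prog.write : Prog :=
  .seq (.setN 34 (.arr 4 (.lit 0) (.reg 31))) <|
  .seq (.setN 35 (.arr 4 (.lit 1) (.reg 32))) <|
  .seq (.setNArr 2 (.reg 30) (.reg 34) (.reg 35)) <|
  .seq (.setNArr 2 (.reg 30) (.reg 35) (.reg 34)) <|
  .seq (.setNArr 3 (.reg 30) (.reg 34) (.reg 33)) <|
  .setNArr 3 (.reg 30) (.reg 35) (.sub (.lit 1) (.reg 33))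

/-- The data of a game: the day, the two labels, and whether the `X`-team plays at home. -/
abbrev GameData : Type := ℕ × ℕ × ℕ × Bool

/-- The data belong to a game of the construction. -/
def IsGame (n d : ℕ) (g : GameData) : Prop := Game n d g.1 g.2.1 g.2.2.1 g.2.2.2

/-- The codes of the teams with given labels. -/
structure TeamCodes (n : ℕ) (XC YC : ℕ → ℕ) : Prop where
  injX : ∀ i < n, ∀ j < n, XC i = XC j → i = j
  injY : ∀ i < n, ∀ j < n, YC i = YC j → i = j
  ne : ∀ i < n, ∀ j < n, XC i ≠ YC j

/-- The memory contents that are used for writing the timetable. -/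
structure Ready (n d : ℕ) (XC YC : ℕ → ℕ) (s : MState) : Prop where
  params : HasParams n d s
  tables : HasTables n d s
  labX : ∀ i < n, s.narr 4 0 i = XC i
  labY : ∀ j < n, s.narr 4 1 j = YC j

/-- The game `g` is in the timetable. -/
structure Written (XC YC : ℕ → ℕ) (s : MState) (g : GameData) : Prop where
  oppX : s.narr 2 g.1 (XC g.2.1) = YC g.2.2.1
  oppY : s.narr 2 g.1 (YC g.2.2.1) = XC g.2.1
  homeX : s.narr 3 g.1 (XC g.2.1) = if g.2.2.2 then 1 else 0
  homeY : s.narr 3 g.1 (YC g.2.2.1) = if g.2.2.2 then 0 else 1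

/-- The registers below `lo` and the arrays other than the timetable are the same. -/
structure Frame (lo : ℕ) (s s' : MState) : Prop where
  nreg : ∀ v < lo, s'.nreg v = s.nreg v
  narr : ∀ a, a ≠ 2 → a ≠ 3 → s'.narr a = s.narr a

lemma Frame.refl (lo : ℕ) (s : MState) : Frame lo s s := ⟨fun _ _ => rfl, fun _ _ _ => rfl⟩

lemma Frame.trans {lo lo' : ℕ} {s s' s'' : MState} (h : Frame lo s s') (h' : Frame lo' s' s'')
    (hle : lo ≤ lo') : Frame lo s s'' :=
  ⟨fun v hv => (h'.nreg v (by omega)).trans (h.nreg v hv),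
    fun a h2 h3 => (h'.narr a h2 h3).trans (h.narr a h2 h3)⟩

lemma Frame.setN {lo v k c : ℕ} {s : MState} (hv : lo ≤ v) :
    Frame lo s ((s.setN v k).tick c) :=
  ⟨fun w hw => by simp [show w ≠ v by omega], fun _ _ _ => rfl⟩

lemma Ready.of_frame {n d lo : ℕ} {XC YC : ℕ → ℕ} {s s' : MState} (h : Ready n d XC YC s)
    (hf : Frame lo s s') (hlo : 8 ≤ lo) : Ready n d XC YC s' := by
  have h4 := hf.narr 4 (by norm_num) (by norm_num)
  have h5 := hf.narr 5 (by norm_num) (by norm_num)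
  refine ⟨h.params.of_frame fun v hv => hf.nreg v (by omega), ⟨?_, ?_⟩, ?_, ?_⟩
  · rw [h5]; exact h.tables.mult
  · rw [h5]; exact h.tables.parity
  · rw [h4]; exact h.labX
  · rw [h4]; exact h.labY

/-- The relation between the states before and after a program that writes the games in `G` in time
`T`, without changing the registers below `lo`. -/
structure Emits (n d : ℕ) (XC YC : ℕ → ℕ) (lo T : ℕ) (G : Set GameData) (s s' : MState) :
    Prop where
  frame : Frame lo s s'
  time : s'.time ≤ s.time + T
  isGame : ∀ g ∈ G, IsGame n d g
  keeps : ∀ g, IsGame n d g → Written XC YC s g → Written XC YC s' g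
  writes : ∀ g ∈ G, Written XC YC s' g

section Emits

variable {n d lo lo' T T' T'' : ℕ} {XC YC : ℕ → ℕ} {G G' : Set GameData} {s s' s'' : MState}

lemma Emits.mono (h : Emits n d XC YC lo T G s s') (hT : T ≤ T') (hG : G' ⊆ G) (hlo : lo' ≤ lo) :
    Emits n d XC YC lo' T' G' s s' :=
  ⟨(Frame.refl lo' s).trans h.frame hlo, h.time.trans (by omega), fun g hg => h.isGame g (hG hg),
    h.keeps, fun g hg => h.writes g (hG hg)⟩

lemma Emits.trans (h : Emits n d XC YC lo T G s s') (h' : Emits n d XC YC lo' T' G' s' s'')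
    (hlo : lo ≤ lo') : Emits n d XC YC lo (T + T') (G ∪ G') s s'' := by
  refine ⟨h.frame.trans h'.frame hlo, ?_, ?_, fun g hg hw => h'.keeps g hg (h.keeps g hg hw), ?_⟩
  · have := h.time
    have := h'.time
    omega
  · rintro g (hg | hg)
    · exact h.isGame g hg
    · exact h'.isGame g hg
  · rintro g (hg | hg)
    · exact h'.keeps g (h.isGame g hg) (h.writes g hg)
    · exact h'.writes g hg

lemma Emits.of_setN {v k c : ℕ} (h : Emits n d XC YC lo' T G ((s.setN v k).tick c) s')
    (hv : lo ≤ v) (hlo : lo ≤ lo') (hT : T + c ≤ T') : Emits n d XC YC lo T' G s s' := by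
  refine ⟨(Frame.setN hv).trans h.frame hlo, ?_, h.isGame, fun g hg hw => ?_, h.writes⟩
  · have := h.time
    simp at this
    omega
  · exact h.keeps g hg ⟨hw.oppX, hw.oppY, hw.homeX, hw.homeY⟩

lemma Does.emits_seq {p q : Prog} {lo₁ lo₂ : ℕ} (hp : Does p s (Emits n d XC YC lo₁ T G s))
    (hq : ∀ s', Frame lo₁ s s' → Does q s' (Emits n d XC YC lo₂ T' G' s')) (h₁ : lo ≤ lo₁)
    (h₂ : lo ≤ lo₂) (hT : T + T' ≤ T'') :
    Does (.seq p q) s (Emits n d XC YC lo T'' (G ∪ G') s) :=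
  Does.seq (hp.mono fun s' h => (hq s' h.frame).mono fun _ h' =>
    ((h.mono le_rfl subset_rfl h₁).trans h' h₂).mono hT subset_rfl le_rfl)

/-- The relation between the states before and after a program that in time `T` only changes
registers from `lo` on. -/
structure Quiet (lo T : ℕ) (s s' : MState) : Prop where
  nreg : ∀ v < lo, s'.nreg v = s.nreg v
  narr : s'.narr = s.narr
  time : s'.time ≤ s.time + T

lemma Quiet.frame (h : Quiet lo T s s') : Frame lo s s' :=
  ⟨h.nreg, fun a _ _ => by rw [h.narr]⟩

lemma Quiet.emits (h : Quiet lo T s s') (h' : Emits n d XC YC lo' T' G s' s'') (hlo : lo ≤ lo') :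
    Emits n d XC YC lo (T + T') G s s'' := by
  refine ⟨h.frame.trans h'.frame hlo, ?_, h'.isGame, fun g hg hw => ?_, h'.writes⟩
  · have := h.time
    have := h'.time
    omega
  · have e := h.narr
    exact h'.keeps g hg ⟨by rw [e]; exact hw.oppX, by rw [e]; exact hw.oppY,
      by rw [e]; exact hw.homeX, by rw [e]; exact hw.homeY⟩

/-- A program that computes some values beforehand. -/
lemma Does.emits_prefix {p q : Prog} {Q : MState → Prop} {lo₁ : ℕ}
    (hp : Does p s fun s' => Quiet lo₁ T s s' ∧ Q s')
    (hq : ∀ s', Frame lo₁ s s' → Q s' → Does q s' (Emits n d XC YC lo' T' G s')) (h₁ : lo ≤ lo₁) (h₂ : lo₁ ≤ lo')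
    (hT : T + T' ≤ T'') : Does (.seq p q) s (Emits n d XC YC lo T'' G s) :=
  Does.seq (hp.mono fun s' h => (hq s' h.1.frame h.2).mono fun _ h' =>
    (h.1.emits h' h₂).mono hT subset_rfl h₁)

/-- The body changes only registers above v, so the loop variable and all outer ones stay readable
inside. Nested loops use increasing registers for this reason. -/
lemma Does.emits_loop {v N c : ℕ} {e : NExp} {p : Prog} {G : ℕ → Set GameData}
    (hN : e.eval s = N) (hc : e.cost = c)
    (hp : ∀ k < N, ∀ s', Frame v s s' → s'.nreg v = k →
      Does p s' (Emits n d XC YC (v + 1) T (G k) s'))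
    (hT : c + 1 + N * (T + 1) ≤ T') :
    Does (.loop v e p) s (Emits n d XC YC v T' {g | ∃ k < N, g ∈ G k} s) := by
  refine Does.loop (N := N)
    (fun k s' => Emits n d XC YC v (c + 1 + k * (T + 1)) {g | ∃ j < k, g ∈ G j} s s') hN ?_ ?_ ?_
  · refine ⟨⟨fun _ _ => rfl, fun _ _ _ => rfl⟩, by simp [hc], ?_, fun g _ hw =>
      ⟨hw.oppX, hw.oppY, hw.homeX, hw.homeY⟩, ?_⟩
    · rintro g ⟨j, hj, -⟩
      omega
    · rintro g ⟨j, hj, -⟩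
      omega
  · intro k hk s' h
    refine (hp k hk _ (h.frame.trans (Frame.setN le_rfl) le_rfl) (by simp)).mono fun s'' h' => ?_
    have h2 : Emits n d XC YC v (T + 1) (G k) s' s'' := h'.of_setN le_rfl (by omega) le_rfl
    refine (h.trans h2 le_rfl).mono (by rw [add_mul]; omega) ?_ le_rfl
    rintro g ⟨j, hj, hg⟩
    rcases Nat.lt_succ_iff_lt_or_eq.1 hj with h | rfl
    · exact Or.inl ⟨j, h, hg⟩
    · exact Or.inr hg
  · exact fun s' h => h.mono hT subset_rfl le_rfl

/-- Cells are addressed by day and team. A game of the construction that already occupies one of the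
overwritten cells shares the day and a team with g, hence it is g itself by uniqueness. So no game
written earlier is lost. -/
lemma does_write (H : Admissible n d) (hC : TeamCodes n XC YC) (hs : Ready n d XC YC s)
    {t i j : ℕ} {h : Bool} (ht : s.nreg 30 = t) (hi : s.nreg 31 = i) (hj : s.nreg 32 = j)
    (hh : s.nreg 33 = if h then 1 else 0) (g : Game n d t i j h) :
    Does .write s (Emits n d XC YC 34 50 {(t, i, j, h)} s) := by
  have hb := g.bounds H
  have e1 : s.narr 4 0 i = XC i := hs.labX i hb.2.1
  have e2 : s.narr 4 1 j = YC j := hs.labY j hb.2.2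
  rw [Prog.write]
  simp only [does_seq_setN, does_seq_setNArr, does_setNArr]
  simp [ht, hi, hj, hh, e1, e2]
  have hne := hC.ne i hb.2.1 j hb.2.2
  refine ⟨⟨fun v hv => ?_, fun a h2 h3 => ?_⟩, by simp, ?_, ?_, ?_⟩
  · simp [show v ≠ 34 by omega, show v ≠ 35 by omega]
  · funext x y
    simp [h2, h3]
  · rintro g' rfl
    exact g
  · rintro ⟨t', i', j', h'⟩ hg' hw
    have hb' := Game.bounds H hg'
    simp only at hb'
    have hne1 := hC.ne i' hb'.2.1 j hb.2.2
    have hne2 := hC.ne i hb.2.1 j' hb'.2.2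
    have hne3 := hC.ne i' hb'.2.1 j' hb'.2.2
    have hX : t' = t → XC i' = XC i → j' = j ∧ h' = h := by
      rintro rfl h2
      obtain rfl := hC.injX _ hb'.2.1 _ hb.2.1 h2
      exact Game.unique_X H hg' g
    have hY : t' = t → YC j' = YC j → i' = i ∧ h' = h := by
      rintro rfl h2
      obtain rfl := hC.injY _ hb'.2.2 _ hb.2.2 h2
      exact Game.unique_Y H hg' g
    by_cases htt : t' = t
    · subst htt
      by_cases hXX : XC i' = XC i
      · obtain ⟨rfl, rfl⟩ := hX rfl hXX
        constructor <;> simp [hXX, hne, hne.symm]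
        cases h' <;> rfl
      · have hYY : YC j' ≠ YC j := fun h2 => hXX (by rw [(hY rfl h2).1])
        constructor
        · simpa [hXX, hne1] using hw.oppX
        · simpa [hYY, hne2.symm] using hw.oppY
        · simpa [hXX, hne1] using hw.homeX
        · simpa [hYY, hne2.symm] using hw.homeY
    · constructor
      · simpa [htt] using hw.oppX
      · simpa [htt] using hw.oppY
      · simpa [htt] using hw.homeX
      · simpa [htt] using hw.homeY
  · rintro g' rfl
    constructor <;> simp [hne, hne.symm]
    cases h <;> rfl

end Emits

/-! ### Writing the timetable -/

/-- For a slot in register `14` and a position in register `11`, compute the first labels of the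
super-teams and the first day of the slot. -/
def Prog.meet : Prog :=
  .seq (.setN 15 (.add (.reg 11) (.reg 14))) <|
  .seq (.reduce 15 2) <|
  .seq (.setN 15 (.arr 5 (.lit 0) (.reg 15))) <|
  .seq (.setN 16 (.add (.reg 11) (.add (.reg 14) (.reg 14)))) <|
  .seq (.reduce 16 2) <|
  .seq (.reduce 16 2) <|
  .seq (.setN 16 (.arr 5 (.lit 0) (.reg 16))) <|
  .setN 17 (.add (.arr 5 (.lit 0) (.reg 14)) (.arr 5 (.lit 0) (.reg 14)))

/-- Write the two games between two teams in a normal super-game. -/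
def Prog.normalBody : Prog :=
  .seq (
    .seq (.setN 23 (.add (.reg 18) (.reg 21))) <|
    .seq (.setN 23 (.add (.reg 23) (.add (.reg 23) (.reg 23)))) <|
    .seq (.setN 23 (.add (.add (.reg 23) (.reg 23)) (.add (.reg 19) (.reg 22)))) <|
    .seq (.setN 24 (.add (.reg 23) (.lit 3))) <|
    .seq (.reduce 23 7) <|
    .seq (.reduce 24 7) <|
    .seq (.setN 31 (.reg 20)) <|
    .seq (.setN 32 (.add (.reg 16) (.add (.add (.reg 21) (.add (.reg 21) (.reg 21))) (.reg 22)))) <|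
    .seq (.setN 30 (.add (.reg 17) (.reg 23))) <|
    .setN 33 (.lit 0)) <|
  .seq .write <|
  .seq (.seq (.setN 30 (.add (.reg 17) (.reg 24))) (.setN 33 (.lit 1))) .write

/-- Write the normal super-games. -/
def Prog.normal : Prog :=
  .loop 10 (.sub (.reg 2) (.reg 5)) <|
  .seq (.setN 11 (.add (.reg 10) (.reg 5))) <|
  .loop 14 (.reg 2) <|
  .seq .meet <|
  .loop 18 (.reg 1) <|
  .loop 19 (.lit 3) <|
  .seq (.setN 20 (.add (.reg 15) (.add (.add (.reg 18) (.add (.reg 18) (.reg 18))) (.reg 19)))) <|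
  .loop 21 (.reg 1) <|
  .loop 22 (.lit 3) .normalBody

/-- Write the left super-games. -/
def Prog.left : Prog :=
  .loop 10 (.reg 5) <|
  .seq (.setN 11 (.reg 10)) <|
  .loop 14 (.reg 2) <|
  .seq .meet <|
  .loop 18 (.reg 7) <|
  .seq (
    .seq (.setN 19 (.add (.reg 18) (.lit 1))) <|
    -- The added zeros give both alternatives the same cost.
    .seq (.cond (.nle (.reg 6) (.reg 18)) 19
      (.sub (.add (.reg 19) (.lit 1)) (.reg 6)) (.add (.add (.reg 19) (.lit 0)) (.lit 0))) <|
    .seq (.cond (.nle (.reg 7) (.add (.reg 18) (.lit 1))) 19 (.lit 1) (.reg 19)) <|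
    .seq (.setN 21 (.arr 5 (.lit 1) (.reg 19))) <|
    .cond (.nle (.reg 6) (.reg 18)) 21
      (.add (.reg 21) (.lit 0)) (.sub (.lit 1) (.reg 21))) <|
  .loop 22 (.add (.reg 6) (.lit 1)) <|
  .seq (
    .seq (.cond (.nle (.reg 6) (.reg 22)) 31 (.add (.reg 4) (.reg 11)) (.add (.reg 15) (.reg 22))) <|
    .seq (.setN 23 (.add (.reg 22) (.reg 19))) <|
    .seq (.setN 24 (.add (.reg 6) (.lit 1))) <|
    .seq (.reduce 23 24) <|
    .seq (.cond (.nle (.reg 6) (.reg 23)) 32 (.add (.reg 4) (.reg 11)) (.add (.reg 16) (.reg 23))) <|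
    .seq (.setN 30 (.add (.reg 17) (.reg 18))) <|
    .setN 33 (.reg 21))
  .write

/-- Write the last time slot. -/
def Prog.last : Prog :=
  .loop 8 (.add (.reg 5) (.reg 5)) <|
  .seq (
    .seq (.setN 11 (.reg 8)) <|
    .seq (.reduce 11 5) <|
    .seq (.setN 12 (.arr 5 (.lit 1) (.reg 11))) <|
    .seq (.cond (.nle (.reg 5) (.reg 8)) 12 (.sub (.lit 1) (.reg 12)) (.add (.reg 12) (.lit 0))) <|
    .setN 13 (.add (.add (.arr 5 (.lit 0) (.reg 2)) (.arr 5 (.lit 0) (.reg 2))) (.reg 8))) <|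
  .seq
    (.loop 14 (.reg 5) <|
      .seq (
        .seq (.setN 31 (.add (.reg 4) (.reg 14))) <|
        .seq (.setN 32 (.add (.reg 14) (.reg 11))) <|
        .seq (.reduce 32 5) <|
        .seq (.setN 32 (.add (.reg 4) (.reg 32))) <|
        .seq (.setN 30 (.reg 13)) <|
        .setN 33 (.reg 12)) <|
      .write) <|
    .loop 14 (.reg 2) <|
      .seq .meet <|
      .loop 18 (.reg 6) <|
      .seq (
        .seq (.setN 31 (.add (.reg 15) (.reg 18))) <|
        .seq (.setN 32 (.add (.reg 16) (.reg 18))) <|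
        .seq (.setN 30 (.reg 13)) <|
        .setN 33 (.reg 12)) <|
      .write

section Write

variable {n d : ℕ} {XC YC : ℕ → ℕ} {s : MState} (H : Admissible n d) (hC : TeamCodes n XC YC)

include H in
lemma does_meet (hs : Ready n d XC YC s) {r p : ℕ} (hr : s.nreg 14 = r) (hp : s.nreg 11 = p)
    (hrm : r < numSuper n d) (hpm : p < numSuper n d) :
    Does .meet s fun s' => Quiet 15 100 s s' ∧ s'.nreg 15 = 3 * d * superX n d p r ∧
      s'.nreg 16 = 3 * d * superY n d p r ∧ s'.nreg 17 = 6 * d * r := by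
  have hX : reduceBy (p + r) (numSuper n d) = superX n d p r := reduceBy_eq (by omega)
  have hY : reduceBy (reduceBy (p + (r + r)) (numSuper n d)) (numSuper n d) = superY n d p r := by
    rw [reduceBy_reduceBy (by omega), superY, two_mul]
  have eX := hs.tables.mult _ (superX_lt H p r).le
  have eY := hs.tables.mult _ (superY_lt H p r).le
  have er := hs.tables.mult r hrm.le
  have r2 := hs.params.r2
  rw [Prog.meet]
  simp only [does_seq_setN, does_seq_reduce, does_setN]
  refine ⟨⟨fun v hv => ?_, rfl, by simp⟩, ?_, ?_, ?_⟩
  · simp [show v ≠ 15 by omega, show v ≠ 16 by omega, show v ≠ 17 by omega]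
  · simp [hr, hp, r2, hX, eX]
  · simp [hr, hp, r2, hY, eY]
  · simp [hr, er]
    ring

/-- The two games between two teams in a normal super-game. -/
def normalGames (n d p r a a' b b' : ℕ) : Set GameData :=
  {(6 * d * r + (6 * (a + b) + a' + b' + 0) % (6 * d),
    3 * d * superX n d p r + (3 * a + a'), 3 * d * superY n d p r + (3 * b + b'), false)} ∪
  {(6 * d * r + (6 * (a + b) + a' + b' + 3) % (6 * d),
    3 * d * superX n d p r + (3 * a + a'), 3 * d * superY n d p r + (3 * b + b'), true)}

include H hC in
lemma does_normalBody (hs : Ready n d XC YC s) {p r a a' b b' : ℕ} (hr : r < numSuper n d)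
    (hp : numPairs n d ≤ p) (hp' : p < numSuper n d)
    (ha : a < d) (ha' : a' < 3) (hb : b < d) (hb' : b' < 3)
    (h16 : s.nreg 16 = 3 * d * superY n d p r) (h17 : s.nreg 17 = 6 * d * r) (h18 : s.nreg 18 = a)
    (h19 : s.nreg 19 = a') (h20 : s.nreg 20 = 3 * d * superX n d p r + (3 * a + a'))
    (h21 : s.nreg 21 = b) (h22 : s.nreg 22 = b') :
    Does .normalBody s (Emits n d XC YC 23 200 (normalGames n d p r a a' b b') s) := by
  have r7 := hs.params.r7
  refine Does.emits_prefix (lo₁ := 23) (T := 90) (lo' := 23) (T' := 50 + (10 + 50))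
    (Q := fun s' => s'.nreg 30 = 6 * d * r + (6 * (a + b) + a' + b' + 0) % (6 * d) ∧
      s'.nreg 24 = (6 * (a + b) + a' + b' + 3) % (6 * d) ∧
      s'.nreg 31 = 3 * d * superX n d p r + (3 * a + a') ∧
      s'.nreg 32 = 3 * d * superY n d p r + (3 * b + b') ∧ s'.nreg 33 = 0) ?_
    (fun s10 f10 h10 => ?_) le_rfl le_rfl (by norm_num)
  · simp only [does_seq_setN, does_seq_reduce, does_setN]
    have e1 : a + b + (a + b + (a + b)) + (a + b + (a + b + (a + b))) + (a' + b') =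
        6 * (a + b) + a' + b' := by ring
    have e2 : reduceBy (6 * (a + b) + a' + b') (6 * d) = (6 * (a + b) + a' + b') % (6 * d) :=
      reduceBy_eq (by omega)
    have e3 : reduceBy (6 * (a + b) + a' + b' + 3) (6 * d) = (6 * (a + b) + a' + b' + 3) % (6 * d) :=
      reduceBy_eq (by omega)
    refine ⟨⟨fun v hv => ?_, rfl, by simp⟩, ?_, ?_, ?_, ?_, ?_⟩
    · simp [show v ≠ 23 by omega, show v ≠ 24 by omega, show v ≠ 30 by omega, show v ≠ 31 by omega,
        show v ≠ 32 by omega, show v ≠ 33 by omega]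
    · simp [h17, h18, h19, h21, h22, r7, e1, e2]
    · simp [h18, h19, h21, h22, r7, e1, e3]
    · simp [h20]
    · simp [h16, h21, h22]
      ring
    · simp
  obtain ⟨h30, h24, h31, h32, h33⟩ := h10
  have hs10 := hs.of_frame f10 (by norm_num)
  refine Does.emits_seq (lo₁ := 34) (lo₂ := 24)
    (does_write H hC hs10 h30 h31 h32 (h := false) (by simp [h33])
      (normal_game hr hp hp' ha ha' hb hb' false (by simp)))
    (fun s11 f11 => ?_) (by norm_num) (by norm_num) le_rfl
  have h24 := (f11.nreg 24 (by norm_num)).trans h24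
  have h31 := (f11.nreg 31 (by norm_num)).trans h31
  have h32 := (f11.nreg 32 (by norm_num)).trans h32
  have h17 := (f11.nreg 17 (by norm_num)).trans ((f10.nreg 17 (by norm_num)).trans h17)
  have hs11 := hs10.of_frame f11 (by norm_num)
  refine Does.emits_prefix (lo₁ := 30) (T := 10) (lo' := 34) (T' := 50)
    (Q := fun s' => s'.nreg 30 = 6 * d * r + (6 * (a + b) + a' + b' + 3) % (6 * d) ∧
      s'.nreg 31 = s11.nreg 31 ∧ s'.nreg 32 = s11.nreg 32 ∧ s'.nreg 33 = 1) ?_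
    (fun s12 f12 h12 => ?_) (by norm_num) (by norm_num) le_rfl
  · simp only [does_seq_setN, does_setN]
    refine ⟨⟨fun v hv => ?_, rfl, by simp⟩, ?_, ?_, ?_, ?_⟩
    · simp [show v ≠ 30 by omega, show v ≠ 33 by omega]
    all_goals simp [h17, h24]
  · obtain ⟨h30, h31', h32', h33⟩ := h12
    exact does_write H hC (hs11.of_frame f12 (by norm_num)) h30 (h31'.trans h31) (h32'.trans h32)
      (h := true) (by simp [h33])
      (normal_game hr hp hp' ha ha' hb hb' true (by simp))

-- The loops over the normal and the left super-games have O(m²d²) rounds in total; this converts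
-- the bound to n².
include H in
lemma core_sq_le : 9 * (numSuper n d * (numSuper n d * (d * d))) ≤ n ^ 2 := by
  have hle : 3 * d * numSuper n d ≤ n := by
    have := H.core_add
    have := coreSize_eq n d
    omega
  calc 9 * (numSuper n d * (numSuper n d * (d * d)))
      = (3 * d * numSuper n d) ^ 2 := by ring
    _ ≤ n ^ 2 := Nat.pow_le_pow_left hle 2

include H in
lemma numSuper_pos : 0 < numSuper n d := by
  have := H.odd_m
  omega

-- The time bounds grow from the inside outwards, 200 for two games, then 650, 700d, 800d, 2600d and
-- so on, each leaving room for the overhead of its loop.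
include H hC in
lemma does_normal (hs : Ready n d XC YC s) : Does .normal s
    (Emits n d XC YC 10 (2000 * n ^ 2) {g | ∃ p < numSuper n d - numPairs n d,
      g ∈ {g | ∃ r < numSuper n d, g ∈ {g | ∃ a < d, g ∈ {g | ∃ a' < 3, g ∈ {g | ∃ b < d,
        g ∈ {g | ∃ b' < 3, g ∈ normalGames n d (p + numPairs n d) r a a' b b'}}}}}} s) := by
  have h6 := H.six_le
  have hm := numSuper_pos H
  have hmd : 0 < d * d := by positivity
  have hT := core_sq_le H
  refine Does.emits_loop (N := numSuper n d - numPairs n d) (c := 3)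
    (T := 3000 * (numSuper n d * (d * d)))
    (by simp [hs.params.r2, hs.params.r5]) (by simp) (fun p' hp' s1 f1 h10 => ?_) ?_
  rotate_left
  · have h1 : (numSuper n d - numPairs n d) * (3000 * (numSuper n d * (d * d)) + 1) ≤
      numSuper n d * (3000 * (numSuper n d * (d * d)) + 1) := Nat.mul_le_mul_right _ (by omega)
    nlinarith [Nat.mul_pos hm (Nat.mul_pos hm hmd), Nat.mul_pos hm hmd,
      Nat.mul_le_mul_left (numSuper n d) (Nat.mul_pos hm hmd)]
  have hs1 := hs.of_frame f1 (by norm_num)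
  refine Does.emits_prefix (lo₁ := 11) (T := 4) (lo' := 14)
    (T' := 2900 * (numSuper n d * (d * d)))
    (Q := fun s' => s'.nreg 11 = p' + numPairs n d) ?_ (fun s2 f2 h11 => ?_)
    le_rfl (by norm_num) (by nlinarith [Nat.mul_pos hm hmd])
  · rw [does_setN]
    refine ⟨⟨fun v hv => ?_, rfl, by simp⟩, by simp [h10, hs1.params.r5]⟩
    simp [show v ≠ 11 by omega]
  have hs2 := hs1.of_frame f2 (by norm_num)
  refine Does.emits_loop (N := numSuper n d) (c := 1) (T := 2800 * (d * d))
    (by simp [hs2.params.r2]) (by simp) (fun r hr s3 f3 h14 => ?_)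
    (by nlinarith [Nat.mul_pos hm hmd, Nat.mul_le_mul_left (numSuper n d) hmd])
  have hs3 := hs2.of_frame f3 (by norm_num)
  have h11 := (f3.nreg 11 (by norm_num)).trans h11
  refine Does.emits_prefix (lo' := 18) (T' := 2700 * (d * d))
    (does_meet H hs3 h14 h11 hr (by omega)) (fun s4 f4 h4 => ?_)
    le_rfl (by norm_num) (by nlinarith)
  have hs4 := hs3.of_frame f4 (by norm_num)
  obtain ⟨h15, h16, h17⟩ := h4
  refine Does.emits_loop (N := d) (c := 1) (T := 2600 * d)
    (by simp [hs4.params.r1]) (by simp) (fun a ha s5 f5 h18 => ?_) (by nlinarith)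
  refine Does.emits_loop (N := 3) (c := 1) (T := 800 * d)
    (by simp) (by simp) (fun a' ha' s6 f6 h19 => ?_) (by omega)
  have f46 := f5.trans f6 (by norm_num)
  have hs6 := hs4.of_frame f46 (by norm_num)
  have h15 := (f46.nreg 15 (by norm_num)).trans h15
  have h16 := (f46.nreg 16 (by norm_num)).trans h16
  have h17 := (f46.nreg 17 (by norm_num)).trans h17
  have h18 := (f6.nreg 18 (by norm_num)).trans h18
  refine Does.emits_prefix (lo₁ := 20) (T := 10) (lo' := 21) (T' := 700 * d)
    (Q := fun s' => s'.nreg 20 = 3 * d * superX n d (p' + numPairs n d) r + (3 * a + a')) ?_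
    (fun s7 f7 h20 => ?_) le_rfl (by norm_num) (by omega)
  · rw [does_setN]
    refine ⟨⟨fun v hv => ?_, rfl, by simp⟩, by simp [h15, h18, h19]; ring⟩
    simp [show v ≠ 20 by omega]
  refine Does.emits_loop (N := d) (c := 1) (T := 650)
    (by simp [(hs6.of_frame f7 (by norm_num)).params.r1]) (by simp) (fun b hb s8 f8 h21 => ?_)
    (by omega)
  refine Does.emits_loop (N := 3) (c := 1) (T := 200)
    (by simp) (by simp) (fun b' hb' s9 f9 h22 => ?_) (by norm_num)
  have f79 := f8.trans f9 (by norm_num)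
  have f69 := f7.trans f79 (by norm_num)
  exact does_normalBody H hC (hs6.of_frame f69 (by norm_num)) hr (by omega) (by omega) ha ha' hb hb'
    ((f69.nreg 16 (by norm_num)).trans h16) ((f69.nreg 17 (by norm_num)).trans h17)
    ((f69.nreg 18 (by norm_num)).trans h18) ((f69.nreg 19 (by norm_num)).trans h19)
    ((f79.nreg 20 (by norm_num)).trans h20) ((f9.nreg 21 (by norm_num)).trans h21) h22

/-- The register form of the round of a left super-game. -/
lemma leftRound_reg {q : ℕ} (hq : q < 6 * d) (h6 : 6 ≤ d) :
    (leftRound d q).1 = (if 6 * d ≤ q + 1 then 1 else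
      if 3 * d ≤ q then q + 1 + 1 - 3 * d else q + 1) ∧
    (if (leftRound d q).2 then 1 else 0) = if 3 * d ≤ q then (leftRound d q).1 % 2 else
      1 - (leftRound d q).1 % 2 := by
  rw [leftRound]
  split_ifs <;> simp_all <;> omega

include H hC in
lemma does_left (hs : Ready n d XC YC s) : Does .left s
    (Emits n d XC YC 10 (2000 * n ^ 2) {g | ∃ p < numPairs n d,
      g ∈ {g | ∃ r < numSuper n d, g ∈ {g | ∃ q < 6 * d, g ∈ {g | ∃ k < 3 * d + 1,
        g ∈ ({(6 * d * r + q, leftLabel n d (superX n d p r) p k,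
          leftLabel n d (superY n d p r) p ((k + (leftRound d q).1) % (3 * d + 1)),
          (leftRound d q).2)} : Set GameData)}}}} s) := by
  have h6 := H.six_le
  have hm := numSuper_pos H
  have hlm := H.pairs_le
  have hmd : 0 < d * d := by positivity
  have hT := core_sq_le H
  refine Does.emits_loop (N := numPairs n d) (c := 1)
    (T := 4500 * (numSuper n d * (d * d)))
    (by simp [hs.params.r5]) (by simp) (fun p hp s1 f1 h10 => ?_) ?_
  rotate_left
  · have h1 : numPairs n d * (4500 * (numSuper n d * (d * d)) + 1) ≤
      numSuper n d * (4500 * (numSuper n d * (d * d)) + 1) := Nat.mul_le_mul_right _ (by omega)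
    nlinarith [Nat.mul_pos hm (Nat.mul_pos hm hmd), Nat.mul_pos hm hmd,
      Nat.mul_le_mul_left (numSuper n d) (Nat.mul_pos hm hmd)]
  have hs1 := hs.of_frame f1 (by norm_num)
  refine Does.emits_prefix (lo₁ := 11) (T := 4) (lo' := 14)
    (T' := 4400 * (numSuper n d * (d * d)))
    (Q := fun s' => s'.nreg 11 = p) ?_ (fun s2 f2 h11 => ?_)
    le_rfl (by norm_num) (by nlinarith [Nat.mul_pos hm hmd])
  · rw [does_setN]
    refine ⟨⟨fun v hv => ?_, rfl, by simp⟩, by simp [h10]⟩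
    simp [show v ≠ 11 by omega]
  have hs2 := hs1.of_frame f2 (by norm_num)
  refine Does.emits_loop (N := numSuper n d) (c := 1) (T := 4300 * (d * d))
    (by simp [hs2.params.r2]) (by simp) (fun r hr s3 f3 h14 => ?_)
    (by nlinarith [Nat.mul_pos hm hmd, Nat.mul_le_mul_left (numSuper n d) hmd])
  have hs3 := hs2.of_frame f3 (by norm_num)
  have h11 := (f3.nreg 11 (by norm_num)).trans h11
  refine Does.emits_prefix (lo' := 18) (T' := 4200 * (d * d))
    (does_meet H hs3 h14 h11 hr (by omega)) (fun s4 f4 h4 => ?_)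
    le_rfl (by norm_num) (by nlinarith)
  have hs4 := hs3.of_frame f4 (by norm_num)
  obtain ⟨h15, h16, h17⟩ := h4
  have h11 := (f4.nreg 11 (by norm_num)).trans h11
  refine Does.emits_loop (N := 6 * d) (c := 1) (T := 690 * d)
    (by simp [hs4.params.r7]) (by simp) (fun q hq s5 f5 h18 => ?_) (by nlinarith)
  have hs5 := hs4.of_frame f5 (by norm_num)
  obtain ⟨hc, hv⟩ := leftRound_reg hq h6
  have hcle := leftRound_le H hq
  refine Does.emits_prefix (lo₁ := 19) (T := 60) (lo' := 22) (T' := 670 * d)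
    (Q := fun s' => s'.nreg 19 = (leftRound d q).1 ∧
      s'.nreg 21 = if (leftRound d q).2 then 1 else 0) ?_
    (fun s6 f6 h6' => ?_) le_rfl (by norm_num) (by omega)
  -- The round number is at most 3d, hence within the range of the parity table.
  · have hpar := hs5.tables.parity (leftRound d q).1 (by have := H.two_mul; nlinarith)
    have r6 := hs5.params.r6
    have r7 := hs5.params.r7
    rw [does_seq_setN, does_seq_cond, does_seq_cond, does_seq_setN, does_cond]
    any_goals rfl
    refine ⟨⟨fun v hv => ?_, rfl, by simp⟩, ?_, ?_⟩
    · simp [show v ≠ 19 by omega, show v ≠ 21 by omega]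
    · simp [h18, r6, r7, hc]
    · simp only [hv]
      simp [h18, r6, r7, ← hc, hpar]
  obtain ⟨h19, h21⟩ := h6'
  have hs6 := hs5.of_frame f6 (by norm_num)
  refine Does.emits_loop (N := 3 * d + 1) (c := 3) (T := 180)
    (by simp [hs6.params.r6]) (by simp) (fun k hk s7 f7 h22 => ?_) (by omega)
  have hs7 := hs6.of_frame f7 (by norm_num)
  have f57 := f6.trans f7 (by norm_num)
  have f47 := f5.trans f57 (by norm_num)
  have h11 := (f47.nreg 11 (by norm_num)).trans h11
  have h15 := (f47.nreg 15 (by norm_num)).trans h15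
  have h16 := (f47.nreg 16 (by norm_num)).trans h16
  have h17 := (f47.nreg 17 (by norm_num)).trans h17
  have h18 := (f57.nreg 18 (by norm_num)).trans h18
  have h19 := (f7.nreg 19 (by norm_num)).trans h19
  have h21 := (f7.nreg 21 (by norm_num)).trans h21
  refine Does.emits_prefix (lo₁ := 23) (T := 100) (lo' := 34) (T' := 50)
    (Q := fun s' => s'.nreg 30 = 6 * d * r + q ∧
      s'.nreg 31 = leftLabel n d (superX n d p r) p k ∧
      s'.nreg 32 = leftLabel n d (superY n d p r) p ((k + (leftRound d q).1) % (3 * d + 1)) ∧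
      s'.nreg 33 = if (leftRound d q).2 then 1 else 0) ?_
    (fun s8 f8 h8 => ?_) le_rfl (by norm_num) (by norm_num)
  · have r6 := hs7.params.r6
    have r4 := hs7.params.r4
    have hlab : ∀ i k, k < 3 * d + 1 → leftLabel n d i p k =
        if 3 * d ≤ k then coreSize n d + p else 3 * d * i + k := by
      intro i k hk
      rw [leftLabel]
      split_ifs <;> omega
    have hk' : reduceBy (k + (leftRound d q).1) (3 * d + 1) =
      (k + (leftRound d q).1) % (3 * d + 1) := reduceBy_eq (by omega)
    have hk2 : (k + (leftRound d q).1) % (3 * d + 1) < 3 * d + 1 := Nat.mod_lt _ (by omega)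
    rw [does_seq_cond, does_seq_setN, does_seq_setN, does_seq_reduce, does_seq_cond, does_seq_setN,
      does_setN]
    any_goals rfl
    refine ⟨⟨fun v hv => ?_, rfl, by simp⟩, ?_, ?_, ?_, ?_⟩
    · simp [show v ≠ 23 by omega, show v ≠ 24 by omega, show v ≠ 30 by omega, show v ≠ 31 by omega,
        show v ≠ 32 by omega, show v ≠ 33 by omega]
    · simp [h17, h18]
    · simp [h22, r6, r4, h11, h15, hlab _ _ hk]
    · simp [h22, r6, r4, h11, h16, h19, hk', hlab _ _ hk2]
    · simp [h21]
  · obtain ⟨h30, h31, h32, h33⟩ := h8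
    exact does_write H hC (hs7.of_frame f8 (by norm_num)) h30 h31 h32 h33 (.left r p q k hr hp hq hk)

/-- The games of the teams in team-pairs on day `q` of the last slot. -/
def lastPairGames (n d q : ℕ) : Set GameData :=
  {g | ∃ k < numPairs n d, g ∈ ({(6 * d * numSuper n d + q, coreSize n d + k,
    coreSize n d + (k + (lastRound (numPairs n d) q).1) % numPairs n d,
    (lastRound (numPairs n d) q).2)} : Set GameData)}

/-- The games of the teams in super-teams on day `q` of the last slot. -/
def lastSuperGames (n d q : ℕ) : Set GameData :=
  {g | ∃ r < numSuper n d, g ∈ {g | ∃ k < 3 * d, g ∈ ({(6 * d * numSuper n d + q,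
    3 * d * superX n d (lastRound (numPairs n d) q).1 r + k,
    3 * d * superY n d (lastRound (numPairs n d) q).1 r + k,
    (lastRound (numPairs n d) q).2)} : Set GameData)}}

/-- The register form of the round of a day of the last slot. -/
lemma lastRound_reg {l q : ℕ} : (lastRound l q).1 = reduceBy q l ∧
    (if (lastRound l q).2 then 1 else 0) = if l ≤ q then 1 - reduceBy q l % 2 else
      reduceBy q l % 2 := by
  rw [lastRound, reduceBy]
  split_ifs <;> simp_all <;> omega

-- Each of the 2l days has n games. The number of the round is kept in register 11, where
-- `Prog.meet` expects a position, since round c completes the left super-games at position c.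
include H hC in
lemma does_last (hs : Ready n d XC YC s) : Does .last s
    (Emits n d XC YC 8 (2000 * n ^ 2) {g | ∃ q < 2 * numPairs n d,
      g ∈ lastPairGames n d q ∪ lastSuperGames n d q} s) := by
  have h6 := H.six_le
  have hm := numSuper_pos H
  have hlm := H.pairs_le
  have h2n := H.two_mul
  have hadd := H.core_add
  have hcore := coreSize_eq n d
  have hmn := numSuper_le (n := n) (show 0 < d by omega)
  refine Does.emits_loop (N := 2 * numPairs n d) (c := 3) (T := 500 * n)
    (by simp [hs.params.r5]; ring) (by simp) (fun q hq s1 f1 h8 => ?_) ?_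
  rotate_left
  · have h1 : 2 * numPairs n d * (500 * n + 1) ≤ 2 * n * (500 * n + 1) :=
      Nat.mul_le_mul_right _ (by omega)
    nlinarith
  have hs1 := hs.of_frame f1 (by norm_num)
  obtain ⟨hc, hv⟩ := lastRound_reg (l := numPairs n d) (q := q)
  have hcl := lastRound_lt (n := n) (d := d) hq
  refine Does.emits_prefix (lo₁ := 9) (T := 60) (lo' := 14) (T' := 450 * n)
    (Q := fun s' => s'.nreg 11 = (lastRound (numPairs n d) q).1 ∧
      s'.nreg 12 = (if (lastRound (numPairs n d) q).2 then 1 else 0) ∧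
      s'.nreg 13 = 6 * d * numSuper n d + q) ?_
    (fun s2 f2 h2 => ?_) (by norm_num) (by norm_num) (by nlinarith)
  · have hpar := hs1.tables.parity (lastRound (numPairs n d) q).1 (by omega)
    have hmul := hs1.tables.mult _ le_rfl
    have r5 := hs1.params.r5
    have r2 := hs1.params.r2
    rw [does_seq_setN, does_seq_reduce, does_seq_setN, does_seq_cond, does_setN]
    any_goals rfl
    refine ⟨⟨fun v hv => ?_, rfl, by simp⟩, ?_, ?_, ?_⟩
    · simp [show v ≠ 11 by omega, show v ≠ 12 by omega, show v ≠ 13 by omega]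
    · simp [h8, r5, hc]
    · rw [hv]
      simp [h8, r5, ← hc, hpar]
    · simp [h8, r2, hmul]
      ring
  obtain ⟨h11, h12, h13⟩ := h2
  have hs2 := hs1.of_frame f2 (by norm_num)
  refine Does.emits_seq (lo₁ := 14) (lo₂ := 14) (T := 120 * n) (T' := 330 * n) ?_
    (fun s3 f3 => ?_) le_rfl le_rfl (by omega)
  · refine Does.emits_loop (N := numPairs n d) (c := 1) (T := 100)
      (by simp [hs2.params.r5]) (by simp) (fun k hk s4 f4 h14 => ?_) (by omega)
    have hs4 := hs2.of_frame f4 (by norm_num)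
    have h11 := (f4.nreg 11 (by norm_num)).trans h11
    have h12 := (f4.nreg 12 (by norm_num)).trans h12
    have h13 := (f4.nreg 13 (by norm_num)).trans h13
    refine Does.emits_prefix (lo₁ := 30) (T := 50) (lo' := 34) (T' := 50)
      (Q := fun s' => s'.nreg 30 = 6 * d * numSuper n d + q ∧ s'.nreg 31 = coreSize n d + k ∧
        s'.nreg 32 = coreSize n d + (k + (lastRound (numPairs n d) q).1) % numPairs n d ∧
        s'.nreg 33 = if (lastRound (numPairs n d) q).2 then 1 else 0) ?_
      (fun s5 f5 h5 => ?_) (by norm_num) (by norm_num) (by norm_num)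
    · have r5 := hs4.params.r5
      have r4 := hs4.params.r4
      have e : reduceBy (k + (lastRound (numPairs n d) q).1) (numPairs n d) =
        (k + (lastRound (numPairs n d) q).1) % numPairs n d := reduceBy_eq (by omega)
      simp only [does_seq_setN, does_setN, does_seq_reduce]
      refine ⟨⟨fun v hv => ?_, rfl, by simp⟩, ?_, ?_, ?_, ?_⟩
      · simp [show v ≠ 30 by omega, show v ≠ 31 by omega, show v ≠ 32 by omega,
          show v ≠ 33 by omega]
      all_goals simp [h11, h12, h13, h14, r4, r5, e]
    · obtain ⟨h30, h31, h32, h33⟩ := h5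
      exact does_write H hC (hs4.of_frame f5 (by norm_num)) h30 h31 h32 h33 (.lastPair q k hq hk)
  · have hs3 := hs2.of_frame f3 (by norm_num)
    have h11 := (f3.nreg 11 (by norm_num)).trans h11
    have h12 := (f3.nreg 12 (by norm_num)).trans h12
    have h13 := (f3.nreg 13 (by norm_num)).trans h13
    refine Does.emits_loop (N := numSuper n d) (c := 1) (T := 320 * d)
      (by simp [hs3.params.r2]) (by simp) (fun r hr s4 f4 h14 => ?_) (by nlinarith)
    have hs4 := hs3.of_frame f4 (by norm_num)
    have h11 := (f4.nreg 11 (by norm_num)).trans h11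
    refine Does.emits_prefix (lo' := 18) (T' := 300 * d)
      (does_meet H hs4 h14 h11 hr (by omega)) (fun s5 f5 h5 => ?_)
      (by norm_num) (by norm_num) (by omega)
    have hs5 := hs4.of_frame f5 (by norm_num)
    have f35 := f4.trans f5 (by norm_num)
    have h12 := (f35.nreg 12 (by norm_num)).trans h12
    have h13 := (f35.nreg 13 (by norm_num)).trans h13
    obtain ⟨h15, h16, -⟩ := h5
    refine Does.emits_loop (N := 3 * d) (c := 1) (T := 90)
      (by simp [hs5.params.r6]) (by simp) (fun k hk s6 f6 h18 => ?_) (by omega)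
    have hs6 := hs5.of_frame f6 (by norm_num)
    have h12 := (f6.nreg 12 (by norm_num)).trans h12
    have h13 := (f6.nreg 13 (by norm_num)).trans h13
    have h15 := (f6.nreg 15 (by norm_num)).trans h15
    have h16 := (f6.nreg 16 (by norm_num)).trans h16
    refine Does.emits_prefix (lo₁ := 30) (T := 40) (lo' := 34) (T' := 50)
      (Q := fun s' => s'.nreg 30 = 6 * d * numSuper n d + q ∧
        s'.nreg 31 = 3 * d * superX n d (lastRound (numPairs n d) q).1 r + k ∧
        s'.nreg 32 = 3 * d * superY n d (lastRound (numPairs n d) q).1 r + k ∧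
        s'.nreg 33 = if (lastRound (numPairs n d) q).2 then 1 else 0) ?_
      (fun s7 f7 h7 => ?_) (by norm_num) (by norm_num) (by norm_num)
    · simp only [does_seq_setN, does_setN]
      refine ⟨⟨fun v hv => ?_, rfl, by simp⟩, ?_, ?_, ?_, ?_⟩
      · simp [show v ≠ 30 by omega, show v ≠ 31 by omega, show v ≠ 32 by omega,
          show v ≠ 33 by omega]
      all_goals simp [h12, h13, h15, h16, h18]
    · obtain ⟨h30, h31, h32, h33⟩ := h7
      exact does_write H hC (hs6.of_frame f7 (by norm_num)) h30 h31 h32 h33 (.lastSuper q r k hq hr hk)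

/-- Write the timetable. -/
def Prog.timetable : Prog := .seq .normal (.seq .left .last)

include H hC in
lemma does_timetable (hs : Ready n d XC YC s) : Does .timetable s fun s' =>
    s'.time ≤ s.time + 6000 * n ^ 2 ∧ ∀ g, IsGame n d g → Written XC YC s' g := by
  refine (Does.emits_seq (lo := 8) (T'' := 6000 * n ^ 2) (does_normal H hC hs)
    (fun s1 f1 => Does.emits_seq (lo := 8) (T'' := 4000 * n ^ 2)
      (does_left H hC (hs.of_frame f1 (by norm_num)))
      (fun s2 f2 => does_last H hC ((hs.of_frame f1 (by norm_num)).of_frame f2 (by norm_num)))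
      (by norm_num) le_rfl (by omega)) (by norm_num) le_rfl (by omega)).mono fun s' h => ?_
  refine ⟨h.time, fun g hg => h.writes g ?_⟩
  obtain ⟨t, i, j, b⟩ := g
  simp only [IsGame] at hg
  cases hg with
  | normalAway r p a a' b b' hr hp hp' ha ha' hb hb' =>
    refine Or.inl ⟨p - numPairs n d, by omega, r, hr, a, ha, a', ha', b, hb, b', hb', Or.inl ?_⟩
    rw [Nat.sub_add_cancel hp]
    rfl
  | normalHome r p a a' b b' hr hp hp' ha ha' hb hb' =>
    refine Or.inl ⟨p - numPairs n d, by omega, r, hr, a, ha, a', ha', b, hb, b', hb', Or.inr ?_⟩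
    rw [Nat.sub_add_cancel hp]
    rfl
  | left r p q k hr hp hq hk => exact Or.inr (Or.inl ⟨p, hp, r, hr, q, hq, k, hk, rfl⟩)
  | lastPair q k hq hk => exact Or.inr (Or.inr ⟨q, hq, Or.inl ⟨k, hk, rfl⟩⟩)
  | lastSuper q r k hq hr hk => exact Or.inr (Or.inr ⟨q, hq, Or.inr ⟨r, hr, k, hk, rfl⟩⟩)

end Write

/-! ### The construction -/

/-- The construction with random labeling. -/
def Prog.construct : Prog :=
  .seq (.seq .params .tables) <|
  .seq (.shuffle 0) <|
  .seq (.shuffle 1) <|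
  .seq (.setN 15 (.lit 0)) <|
  .seq (.labels 0) <|
  .seq (.setN 15 (.reg 0)) <|
  .seq (.labels 1) .timetable

variable {n d K : ℕ} {A B : Finset (Team n)}

/-- Every team has a game on every day, so the games that have been written determine all entries of
the output, and these agree with the schedule that exists for the labels. -/
lemma does_timetable_schedule (H : Admissible n d) {x y : Fin n → Team n} (hxy : LeagueLabels x y)
    {s : MState} (hp : HasParams n d s) (ht : HasTables n d s)
    (hx : ∀ i : Fin n, s.narr 4 0 i = code (x i)) (hy : ∀ j : Fin n, s.narr 4 1 j = code (y j)) :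
    Does .timetable s fun s' => s'.time ≤ s.time + 6000 * n ^ 2 ∧
      ∃ S, IsThreePathSchedule d x y S ∧ outputTable n s' = encode S := by
  have hC : TeamCodes n (s.narr 4 0) (s.narr 4 1) := by
    refine ⟨fun i hi j hj h => ?_, fun i hi j hj h => ?_, fun i hi j hj h => ?_⟩
    · rw [hx ⟨i, hi⟩, hx ⟨j, hj⟩] at h
      exact Fin.mk.inj (hxy.x_inj (code_injective n h))
    · rw [hy ⟨i, hi⟩, hy ⟨j, hj⟩] at h
      exact Fin.mk.inj (hxy.y_inj (code_injective n h))
    · rw [hx ⟨i, hi⟩, hy ⟨j, hj⟩] at h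
      exact hxy.x_ne_y _ _ (code_injective n h)
  refine (does_timetable H hC ⟨hp, ht, fun _ _ => rfl, fun _ _ => rfl⟩).mono fun s' h => ⟨h.1, ?_⟩
  obtain ⟨S, hS⟩ := hxy.exists_schedule H
  refine ⟨S, hS, ?_⟩
  funext t v
  rcases hxy.cases v with ⟨i, rfl⟩ | ⟨j, rfl⟩
  · obtain ⟨L, hL⟩ := exists_game_of_label_X H i.2
    obtain ⟨j, hj, h', g⟩ : ∃ j < n, ∃ h', Game n d t i j h' := by
      obtain ⟨j, hj, g⟩ := hL t t.2
      exact ⟨j, hj, _, g⟩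
    have hw := h.2 (t, i, j, h') g
    rw [outputTable, encode, ← hx i, hw.oppX, hw.homeX, hy ⟨j, hj⟩,
      IsThreePathSchedule.apply_x hS (j := ⟨j, hj⟩) g]
  · obtain ⟨L, hL⟩ := exists_game_of_label_Y H j.2
    obtain ⟨i, hi, h', g⟩ : ∃ i < n, ∃ h', Game n d t i j h' := by
      obtain ⟨i, hi, g⟩ := hL t t.2
      exact ⟨i, hi, _, g⟩
    have hw := h.2 (t, i, j, h') g
    rw [outputTable, encode, ← hy j, hw.oppY, hw.homeY, hx ⟨i, hi⟩,
      IsThreePathSchedule.apply_y hS (i := ⟨i, hi⟩) g]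
    cases h' <;> rfl

/-- Only the two shuffles are random. Once their permutations are fixed, everything that follows is
deterministic, so labels and schedule are functions of the pair of permutations. -/
lemma sim_construct (H : Admissible n d) (hK : K = numSuper n d * d) (I : Inst n)
    (hA : A ⊆ leagueX n) (hB : B ⊆ leagueY n) (P : Packing K A) (Q : Packing K B) :
    Sim .construct (packingInput d I P Q) (Perms K) fun ω s =>
      s.time ≤ 10000 * n ^ 2 ∧ ∃ x y, IsLabeling (leagueX n) P ω.1 x ∧
        IsLabeling (leagueY n) Q ω.2 y ∧ ∃ S, IsThreePathSchedule d x y S ∧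
        outputTable n s = encode S := by
  have h6 := H.six_le
  have hadd := H.core_add
  have hpairs := H.le_pairs
  have hKn : K ≤ n := by
    have := coreSize_eq_three_mul n d
    omega
  refine Does.seq_sim (Does.seq ((does_params (n := n) (d := d) (by simp [packingInput])
    (by simp [packingInput]) (by omega)).mono ?_))
  rintro s1 ⟨hp1, ha1, -, ht1⟩
  refine (does_tables hp1 (by omega)).mono ?_
  rintro s2 ⟨hp2, htab2, ha2, ht2⟩
  refine Sim.seq (R' := fun σ τ s => s.time ≤ 10000 * n ^ 2 ∧ ∃ x y, IsLabeling (leagueX n) P σ x ∧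
    IsLabeling (leagueY n) Q τ y ∧ ∃ S, IsThreePathSchedule d x y S ∧
    outputTable n s = encode S) (sim_shuffle 0 (hp2.r3.trans hK.symm)) fun σ s3 h3 => ?_
  refine Sim.seq_does (sim_shuffle 1 ((h3.nreg 3 (by norm_num)).trans (hp2.r3.trans hK.symm)))
    fun τ s4 h4 => ?_
  have hp4 : HasParams n d s4 := hp2.of_frame fun v hv =>
    (h4.nreg v (by omega)).trans (h3.nreg v (by omega))
  have harr4 : ∀ a, a ≠ 6 → s4.narr a = s2.narr a := fun a ha => by
    funext i j
    rw [h4.narr a i j (by omega), h3.narr a i j (by omega)]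
  have hin4 : ∀ a, a ≠ 6 → a ≠ 5 → s4.narr a = (packingInput d I P Q).narr a := fun a h6 h5 => by
    rw [harr4 a h6, ha2 a h5, ha1]
  have hσ4 : ∀ i : Fin K, s4.narr 6 0 i = σ i := fun i => by
    rw [h4.narr 6 0 i (by omega), h3.perm]
  simp only [does_seq_setN]
  refine Does.seq ((does_labels (a := 0) (off := 0) (L := leagueX n) H (by norm_num)
    (hp4.of_frame fun v hv => ?_) hK ?_ hA ?_ ?_ P σ ?_ ?_ ?_).mono ?_)
  · simp [show v ≠ 15 by omega]
  · simp
  · rintro (i | j)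
    · simp [leagueX, code]
    · simp [leagueX, code]
  · exact fun z _ hz => ⟨Sum.inl ⟨z, by omega⟩, rfl⟩
  · intro i j
    simp [hin4, packingInput]
  · simpa using hσ4
  · intro z
    simp [hin4, packingInput]
  rintro s5 ⟨hf5, ⟨x, hx, hx5⟩, ht5⟩
  have hp5 : HasParams n d s5 := hp4.of_frame fun v hv => by
    rw [hf5.nreg v (by omega)]
    simp [show v ≠ 15 by omega]
  simp only [does_seq_setN]
  refine Does.seq ((does_labels (a := 1) (off := n) (L := leagueY n) H (by norm_num)
    (hp5.of_frame fun v hv => ?_) hK ?_ hB ?_ ?_ Q τ ?_ ?_ ?_).mono ?_)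
  · simp [show v ≠ 15 by omega]
  · simp [hp5.r0]
  · rintro (i | j)
    · simp [leagueY, code]
    · simp [leagueY, code]
  · exact fun z h1 h2 => ⟨Sum.inr ⟨z - n, by omega⟩, by simp only [code]; omega⟩
  · intro i j
    simp [hf5.narr, hin4, packingInput]
  · intro i
    simp [hf5.narr, h4.perm]
  · intro z
    simp [hf5.narr, hin4, packingInput]
  rintro s6 ⟨hf6, ⟨y, hy, hy6⟩, ht6⟩
  have hp6 : HasParams n d s6 := hp5.of_frame fun v hv => by
    rw [hf6.nreg v (by omega)]
    simp [show v ≠ 15 by omega]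
  have h5 : s6.narr 5 = s2.narr 5 := by
    funext i j
    rw [hf6.narr 5 i j (by omega)]
    simp [hf5.narr, harr4]
  have htab6 : HasTables n d s6 := ⟨h5 ▸ htab2.mult, h5 ▸ htab2.parity⟩
  have hx6 : ∀ i : Fin n, s6.narr 4 0 i = code (x i) := fun i => by
    rw [hf6.narr 4 0 i (by omega)]
    exact hx5 i
  refine (does_timetable_schedule H (hx.leagueLabels hy) hp6 htab6 hx6 hy6).mono ?_
  rintro s7 ⟨ht7, S, hS, hout⟩
  refine ⟨?_, x, y, hx, hy, S, hS, hout⟩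
  have ht3 := h3.time
  have ht4 := h4.time
  simp [packingInput, hp5.r0] at ht1 ht2 ht3 ht4 ht5 ht6 ht7
  have hn : 18 ≤ n := by omega
  nlinarith

lemma Does.support {p : Prog} {s : MState} {R : MState → Prop} (h : Does p s R) :
    ∀ s' ∈ (p.run s).support, R s' := by
  obtain ⟨s', h1, h2⟩ := h
  rw [h1, PMF.support_pure]
  rintro _ rfl
  exact h2

end BTTP

theorem theorem3 :
    ∃ (select construct : BTTP.Prog) (C : ℕ),
      ∀ (ε : ℝ), 0 < ε → ∀ (n d : ℕ), d = BTTP.pathsPerSuperTeam ε → 108 * d ^ 3 ≤ n →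
      ∀ I : BTTP.Inst n,
        (∃ Xε Yε : Finset (BTTP.Team n),
          BTTP.IsTop (BTTP.leagueX n) (I.delta (BTTP.leagueY n)) (BTTP.coreSize n d) Xε ∧
          BTTP.IsTop (BTTP.leagueY n) (I.delta (BTTP.leagueX n)) (BTTP.coreSize n d) Yε ∧
          ∀ s ∈ (select.run (BTTP.coreInput d I)).support,
            s.time ≤ C * n ^ 2 ∧ BTTP.ShowsSet s (Xε ∪ Yε)) ∧
        ∀ Xε Yε : Finset (BTTP.Team n),
          BTTP.IsTop (BTTP.leagueX n) (I.delta (BTTP.leagueY n)) (BTTP.coreSize n d) Xε →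
          BTTP.IsTop (BTTP.leagueY n) (I.delta (BTTP.leagueX n)) (BTTP.coreSize n d) Yε →
          ∀ (P : BTTP.Packing (BTTP.numSuper n d * d) Xε)
            (Q : BTTP.Packing (BTTP.numSuper n d * d) Yε),
            (∀ x y : BTTP.Perms (BTTP.numSuper n d * d) → Fin n → BTTP.Team n,
              BTTP.LabelingChoice P Q x y →
              ∃ S : BTTP.Perms (BTTP.numSuper n d * d) → BTTP.Schedule n,
                ∀ ω, BTTP.IsThreePathSchedule d (x ω) (y ω) (S ω)) ∧
            (∀ S : BTTP.Perms (BTTP.numSuper n d * d) → BTTP.Schedule n,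
              BTTP.IsRandomThreePath d P Q S →
              (∀ ω, BTTP.Feasible (S ω)) ∧
              I.expectedWeight S ≤
                P.delta I Yε + (BTTP.coreSize n d : ℝ) * P.weight I +
                Q.delta I Xε + (BTTP.coreSize n d : ℝ) * Q.weight I + ε * I.opt) ∧
            (∃ S : BTTP.Perms (BTTP.numSuper n d * d) → BTTP.Schedule n,
              BTTP.IsRandomThreePath d P Q S ∧
              (∀ s ∈ (construct.run (BTTP.packingInput d I P Q)).support,
                s.time ≤ C * n ^ 2) ∧
              (construct.run (BTTP.packingInput d I P Q)).map (BTTP.outputTable n) =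
                (PMF.uniformOfFintype (BTTP.Perms (BTTP.numSuper n d * d))).map
                  (fun ω => BTTP.encode (S ω))) := by
  refine ⟨BTTP.Prog.select, BTTP.Prog.construct, 10000, ?_⟩
  intro ε hε n d hd hn I
  have H := BTTP.admissible_of_le hε hd hn
  refine ⟨?_, ?_⟩
  · obtain ⟨Xε, Yε, hX, hY, h⟩ := BTTP.exists_select H I
    refine ⟨Xε, Yε, hX, hY, fun s hs => ?_⟩
    obtain ⟨h1, h2⟩ := h.support s hs
    exact ⟨h1.trans (Nat.mul_le_mul_right _ (by norm_num)), h2⟩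
  · intro Xε Yε hX hY P Q
    refine ⟨fun x y hxy => ?_, ?_, ?_⟩
    · choose S hS using fun ω => ((hxy ω).1.leagueLabels (hxy ω).2).exists_schedule H
      exact ⟨S, hS⟩
    · rintro S ⟨x, y, hxy, hS⟩
      exact ⟨fun ω => (hS ω).feasible ((hxy ω).1.leagueLabels (hxy ω).2) H,
        BTTP.expectedWeight_le I hε hd H hX hY rfl hxy hS⟩
    · obtain ⟨Φ, hrun, hΦ⟩ := BTTP.sim_construct H rfl I hX.1 hY.1 P Q
      -- The labelings of the program are chosen as functions of the permutations, a dependence that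
      -- `LabelingChoice` permits.
      choose htime x y hx hy S hS hout using hΦ
      refine ⟨S, ⟨x, y, fun ω => ⟨hx ω, hy ω⟩, hS⟩, fun s hs => ?_, ?_⟩
      · rw [hrun, PMF.support_map] at hs
        obtain ⟨ω, -, rfl⟩ := hs
        exact htime ω
      · rw [hrun, PMF.map_comp]
        congr 1
        exact funext hout
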